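/- An instance of \textsc{Ext-TSP} consists of a finite undirected graph $G=(V,E)$ with $n=|V|\ge 1$ vertices, positive edge weights $w:E\to\mathbb{R}_{>0}$, an integer $k$, and a discount function $f$ that is non-increasing on $\{1,2,3,\dots\}$ with $f(1)=1$ and $f(i)=0$ for all $i>k$. For a bijection $d:V\to\{1,\dots,n\}$ let $$\mathrm{val}(d)=\sum_{\{u,v\}\in E} f(|d_u-d_v|)\,w(u,v).$$ \textbf{Theorem.} There is a $(1+\epsilon)$-approximation algorithm for \textsc{Ext-TSP} on graphs given with a tree decomposition of width $t$ that runs in time $n^{O(kt/\epsilon)}$. Precisely: there are a single program for the real RAM (unit-cost addition, subtraction, comparison and addressing with natural numbers; unit-cost addition, subtraction, multiplication and comparison of real numbers; no rounding) and a constant $C\in\mathbb{N}$ such that the following holds for all integers $n\ge 1$, $m$ and $t\ge 1$, all real $\epsilon>0$, all instances $(G,w,k,f)$ on the vertex set $V=\{1,\dots,n\}$, and all tree decompositions of $G$ of width at most $t$ whose tree has $m$ nodes. Given the weight matrix, $k$, the values $f(1),\dots,f(k)$, $\epsilon$, $t$, the tree and its bags as input, the program halts after at most $$C\,m^{C}\,n^{\,C\,k\,t\,\lceil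 1/\epsilon\rceil}$$ steps and outputs a bijection $d:V\to\{1,\dots,n\}$ such that $\mathrm{val}(d')\le(1+\epsilon)\,\mathrm{val}(d)$ for every bijection $d':V\to\{1,\dots,n\}$. For $\epsilon\le 1$ and decompositions with $m=n^{O(1)}$ nodes the running time is $n^{O(kt/\epsilon)}$. -/

import Mathlib

namespace ExtTSP

/-! ### The optimization problem -/

/-- An instance of Ext-TSP on the vertex set `Fin n`: an undirected graph with positive edge
weights, and a discount function `f`, non-increasing on `1, 2, 3, …`, with `f 1 = 1` and
`f i = 0` for `i > k`. (The value `f 0` and the weights of non-edges are never used.) -/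
structure Problem (n : ℕ) where
  graph : SimpleGraph (Fin n)
  weight : Fin n → Fin n → ℝ
  weight_symm : ∀ u v, weight u v = weight v u
  weight_pos : ∀ u v, graph.Adj u v → 0 < weight u v
  k : ℕ
  f : ℕ → ℝ
  f_antitone : AntitoneOn f (Set.Ici 1)
  f_one : f 1 = 1
  f_eq_zero : ∀ i, k < i → f i = 0

open Classical in
/-- The objective value of the sequencing that puts vertex `v` at position `d v`: the sum of
`f |d u - d v| * w(u,v)` over the edges `{u,v}`, each counted once. -/
noncomputable def Problem.value {n : ℕ} (P : Problem n) (d : Equiv.Perm (Fin n)) : ℝ :=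
  ∑ u, ∑ v, if u < v ∧ P.graph.Adj u v then
    P.f (Nat.dist (d u) (d v)) * P.weight u v else 0

/-- A tree decomposition of `G` whose tree has the node set `Fin m`. -/
structure TreeDecomposition {n : ℕ} (G : SimpleGraph (Fin n)) (m : ℕ) where
  tree : SimpleGraph (Fin m)
  isTree : tree.IsTree
  bag : Fin m → Finset (Fin n)
  vertex_cover : ∀ v, ∃ i, v ∈ bag i
  edge_cover : ∀ u v, G.Adj u v → ∃ i, u ∈ bag i ∧ v ∈ bag i
  connected : ∀ v, (tree.induce {i | v ∈ bag i}).Preconnected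

/-- The width: the largest size of a bag, minus one. -/
def TreeDecomposition.width {n m : ℕ} {G : SimpleGraph (Fin n)} (D : TreeDecomposition G m) :
    ℕ :=
  (Finset.univ.sup fun i => (D.bag i).card) - 1

/-! ### The machine model: a real RAM

A program is a fixed while-program over finitely many arrays of natural numbers and finitely
many arrays of real numbers. Natural numbers can be added, subtracted (truncated at 0), compared
and used as addresses; real numbers can be added, subtracted, multiplied and compared. There is
no rounding of reals and no unit-cost multiplication of natural numbers. Every elementary
operation (constant, memory access, arithmetic operation, comparison, connective, assignment,
evaluation of a branch or loop condition) takes at least one step. -/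

/-- The memory: `nat a i` and `real a i` are the `i`-th cells of the `a`-th arrays. -/
structure Memory where
  nat : ℕ → ℕ → ℕ
  real : ℕ → ℕ → ℝ

/-- Expressions for natural numbers; `get a e` reads cell `e` of the array `a`. -/
inductive NatExp where
  | const (c : ℕ)
  | get (a : ℕ) (e : NatExp)
  | add (e₁ e₂ : NatExp)
  | sub (e₁ e₂ : NatExp)

/-- Expressions for real numbers. -/
inductive RealExp where
  | zero
  | one
  | get (a : ℕ) (e : NatExp)
  | add (r₁ r₂ : RealExp)
  | sub (r₁ r₂ : RealExp)
  | mul (r₁ r₂ : RealExp)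

/-- Conditions. -/
inductive BoolExp where
  | leNat (e₁ e₂ : NatExp)
  | leReal (r₁ r₂ : RealExp)
  | neg (b : BoolExp)
  | and (b₁ b₂ : BoolExp)

def NatExp.eval (s : Memory) : NatExp → ℕ
  | const c => c
  | get a e => s.nat a (e.eval s)
  | add e₁ e₂ => e₁.eval s + e₂.eval s
  | sub e₁ e₂ => e₁.eval s - e₂.eval s

noncomputable def RealExp.eval (s : Memory) : RealExp → ℝ
  | zero => 0
  | one => 1
  | get a e => s.real a (e.eval s)
  | add r₁ r₂ => r₁.eval s + r₂.eval s
  | sub r₁ r₂ => r₁.eval s - r₂.eval s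
  | mul r₁ r₂ => r₁.eval s * r₂.eval s

def BoolExp.Holds (s : Memory) : BoolExp → Prop
  | leNat e₁ e₂ => e₁.eval s ≤ e₂.eval s
  | leReal r₁ r₂ => r₁.eval s ≤ r₂.eval s
  | neg b => ¬ b.Holds s
  | and b₁ b₂ => b₁.Holds s ∧ b₂.Holds s

/-- The number of steps that the evaluation of an expression takes. -/
def NatExp.cost : NatExp → ℕ
  | const _ => 1
  | get _ e => e.cost + 1
  | add e₁ e₂ => e₁.cost + e₂.cost + 1
  | sub e₁ e₂ => e₁.cost + e₂.cost + 1

/-- The number of steps that the evaluation of an expression for reals takes. -/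
def RealExp.cost : RealExp → ℕ
  | zero => 1
  | one => 1
  | get _ e => e.cost + 1
  | add r₁ r₂ => r₁.cost + r₂.cost + 1
  | sub r₁ r₂ => r₁.cost + r₂.cost + 1
  | mul r₁ r₂ => r₁.cost + r₂.cost + 1

/-- The number of steps that the evaluation of a condition takes. -/
def BoolExp.cost : BoolExp → ℕ
  | leNat e₁ e₂ => e₁.cost + e₂.cost + 1
  | leReal r₁ r₂ => r₁.cost + r₂.cost + 1
  | neg b => b.cost + 1
  | and b₁ b₂ => b₁.cost + b₂.cost + 1

/-- Programs; `setNat a e x` and `setReal a e r` assign to cell `e` of the array `a`, and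
`loop b p` repeats `p` while `b` holds. -/
inductive Program where
  | skip
  | setNat (a : ℕ) (e x : NatExp)
  | setReal (a : ℕ) (e : NatExp) (r : RealExp)
  | seq (p q : Program)
  | ite (b : BoolExp) (p q : Program)
  | loop (b : BoolExp) (p : Program)

/-- The memory after `x` has been written to cell `i` of the natural-number array `a`. -/
def Memory.writeNat (s : Memory) (a i x : ℕ) : Memory where
  nat := Function.update s.nat a (Function.update (s.nat a) i x)
  real := s.real

/-- The memory after `x` has been written to cell `i` of the real array `a`. -/
noncomputable def Memory.writeReal (s : Memory) (a i : ℕ) (x : ℝ) : Memory where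
  nat := s.nat
  real := Function.update s.real a (Function.update (s.real a) i x)

/-- `Runs p s s' T`: started in memory `s`, the program `p` halts in memory `s'` after exactly
`T` steps. -/
inductive Runs : Program → Memory → Memory → ℕ → Prop where
  | skip (s : Memory) : Runs .skip s s 1
  | setNat (a : ℕ) (e x : NatExp) (s : Memory) :
      Runs (.setNat a e x) s (s.writeNat a (e.eval s) (x.eval s)) (e.cost + x.cost + 1)
  | setReal (a : ℕ) (e : NatExp) (r : RealExp) (s : Memory) :
      Runs (.setReal a e r) s (s.writeReal a (e.eval s) (r.eval s)) (e.cost + r.cost + 1)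
  | seq {p q : Program} {s₁ s₂ s₃ : Memory} {T₁ T₂ : ℕ} :
      Runs p s₁ s₂ T₁ → Runs q s₂ s₃ T₂ → Runs (.seq p q) s₁ s₃ (T₁ + T₂)
  | ite_true {b : BoolExp} {p q : Program} {s₁ s₂ : Memory} {T : ℕ} :
      b.Holds s₁ → Runs p s₁ s₂ T → Runs (.ite b p q) s₁ s₂ (b.cost + 1 + T)
  | ite_false {b : BoolExp} {p q : Program} {s₁ s₂ : Memory} {T : ℕ} :
      ¬ b.Holds s₁ → Runs q s₁ s₂ T → Runs (.ite b p q) s₁ s₂ (b.cost + 1 + T)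
  | loop_true {b : BoolExp} {p : Program} {s₁ s₂ s₃ : Memory} {T₁ T₂ : ℕ} :
      b.Holds s₁ → Runs p s₁ s₂ T₁ → Runs (.loop b p) s₂ s₃ T₂ →
        Runs (.loop b p) s₁ s₃ (b.cost + 1 + T₁ + T₂)
  | loop_false {b : BoolExp} {p : Program} {s : Memory} :
      ¬ b.Holds s → Runs (.loop b p) s s (b.cost + 1)

/-! ### Input and output -/

/-- An array that holds the given list of numbers, followed by zeros. -/
def arrayOfList {α : Type} [Zero α] (l : List α) : ℕ → α := fun i => l.getD i 0

/-- An array that holds the given matrix row by row (entry `A i j` at address `i * q + j`),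
followed by zeros. -/
def arrayOfMatrix {α : Type} [Zero α] {p q : ℕ} (A : Fin p → Fin q → α) : ℕ → α := fun x =>
  if h : x < p * q then A (Fin.divNat ⟨x, h⟩) (Fin.modNat ⟨x, h⟩) else 0

open Classical in
/-- The memory at the start. Natural-number array 0 holds `n, m, k, t`; array 1 the adjacency
matrix of the decomposition tree; array 2 the `m × n` membership matrix of the bags. Real array 0
holds `ε`; array 1 holds `f i` at address `i` for `1 ≤ i ≤ k`; array 2 holds the `n × n` weight
matrix, with 0 for a non-edge. All other cells are 0. -/
noncomputable def inputMemory {n m : ℕ} (P : Problem n) (D : TreeDecomposition P.graph m)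
    (t : ℕ) (ε : ℝ) : Memory where
  nat
    | 0 => arrayOfList [n, m, P.k, t]
    | 1 => arrayOfMatrix fun i j => if D.tree.Adj i j then 1 else 0
    | 2 => arrayOfMatrix fun i v => if v ∈ D.bag i then 1 else 0
    | _ => 0
  real
    | 0 => arrayOfList [ε]
    | 1 => fun i => if 1 ≤ i ∧ i ≤ P.k then P.f i else 0
    | 2 => arrayOfMatrix fun u v => if P.graph.Adj u v then P.weight u v else 0
    | _ => 0

/-- The memory `s` holds the sequencing `d` as output: natural-number array 3 contains, at
address `v`, the position (in `{1, …, n}`) of the vertex `v`. -/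
def Outputs {n : ℕ} (s : Memory) (d : Equiv.Perm (Fin n)) : Prop :=
  ∀ v : Fin n, s.nat 3 v = d v + 1

end ExtTSP

open ExtTSP

namespace ExtTSP

/-! ### Weakest preconditions -/

/-- The `j`-fold iterate of a predicate transformer, started from the empty predicate. -/
def iteratePred (F : (Memory → Prop) → Memory → Prop) : ℕ → Memory → Prop
  | 0 => fun _ => False
  | j + 1 => F (iteratePred F j)

/-- `wp K p Q s`: started in `s`, the program `p` halts in a memory that satisfies `Q`, and every
execution of a loop makes at most `K` iterations. -/
def wp (K : ℕ) : Program → (Memory → Prop) → Memory → Prop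
  | .skip, Q, s => Q s
  | .setNat a e x, Q, s => Q (s.writeNat a (e.eval s) (x.eval s))
  | .setReal a e r, Q, s => Q (s.writeReal a (e.eval s) (r.eval s))
  | .seq p q, Q, s => wp K p (wp K q Q) s
  | .ite b p q, Q, s => (b.Holds s → wp K p Q s) ∧ (¬ b.Holds s → wp K q Q s)
  | .loop b p, Q, s => iteratePred
      (fun R s => (¬ b.Holds s ∧ Q s) ∨ (b.Holds s ∧ wp K p R s)) (K + 1) s

section

variable (K : ℕ) (Q : Memory → Prop)

theorem wp_skip : wp K .skip Q = Q := rfl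

theorem wp_setNat (a : ℕ) (e x : NatExp) :
    wp K (.setNat a e x) Q = fun s => Q (s.writeNat a (e.eval s) (x.eval s)) := rfl

theorem wp_setReal (a : ℕ) (e : NatExp) (r : RealExp) :
    wp K (.setReal a e r) Q = fun s => Q (s.writeReal a (e.eval s) (r.eval s)) := rfl

theorem wp_seq (p q : Program) : wp K (.seq p q) Q = wp K p (wp K q Q) := rfl

theorem wp_ite (b : BoolExp) (p q : Program) : wp K (.ite b p q) Q =
    fun s => (b.Holds s → wp K p Q s) ∧ (¬ b.Holds s → wp K q Q s) := rfl

end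

/-- A bound for the running time if every execution of a loop makes at most `K` iterations. -/
def Program.bound (K : ℕ) : Program → ℕ
  | skip => 1
  | setNat _ e x => e.cost + x.cost + 1
  | setReal _ e r => e.cost + r.cost + 1
  | seq p q => p.bound K + q.bound K
  | ite b p q => b.cost + 1 + (p.bound K + q.bound K)
  | loop b p => (K + 1) * (b.cost + 1 + p.bound K)

theorem wp_sound {K : ℕ} {p : Program} {Q : Memory → Prop} {s : Memory} (h : wp K p Q s) :
    ∃ s' T, Runs p s s' T ∧ T ≤ p.bound K ∧ Q s' := by
  induction p generalizing Q s with
  | skip => exact ⟨s, 1, .skip s, le_rfl, h⟩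
  | setNat a e x => exact ⟨_, _, .setNat a e x s, le_rfl, h⟩
  | setReal a e r => exact ⟨_, _, .setReal a e r s, le_rfl, h⟩
  | seq p q ihp ihq =>
    obtain ⟨s₁, T₁, h₁, hT₁, h⟩ := ihp h
    obtain ⟨s₂, T₂, h₂, hT₂, h⟩ := ihq h
    exact ⟨s₂, T₁ + T₂, .seq h₁ h₂, Nat.add_le_add hT₁ hT₂, h⟩
  | ite b p q ihp ihq =>
    by_cases hb : b.Holds s
    · obtain ⟨s₁, T₁, h₁, hT₁, h⟩ := ihp (h.1 hb)
      exact ⟨s₁, _, .ite_true hb h₁, by simp only [Program.bound]; omega, h⟩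
    · obtain ⟨s₁, T₁, h₁, hT₁, h⟩ := ihq (h.2 hb)
      exact ⟨s₁, _, .ite_false hb h₁, by simp only [Program.bound]; omega, h⟩
  | loop b p ih =>
    simp only [wp, Program.bound] at h ⊢
    generalize K + 1 = j at h
    induction j generalizing s with
    | zero => exact h.elim
    | succ j ihj =>
      rcases h with ⟨hb, h⟩ | ⟨hb, h⟩
      · exact ⟨s, _, .loop_false hb, by rw [Nat.succ_mul]; omega, h⟩
      · obtain ⟨s₁, T₁, h₁, hT₁, h⟩ := ih h
        obtain ⟨s₂, T₂, h₂, hT₂, h⟩ := ihj h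
        exact ⟨s₂, _, .loop_true hb h₁ h₂, by rw [Nat.succ_mul]; omega, h⟩

theorem wp_mono {K : ℕ} {p : Program} {Q Q' : Memory → Prop} {s : Memory} (h : wp K p Q s)
    (hQ : ∀ s, Q s → Q' s) : wp K p Q' s := by
  induction p generalizing Q Q' s with
  | skip => exact hQ _ h
  | setNat a e x => exact hQ _ h
  | setReal a e r => exact hQ _ h
  | seq p q ihp ihq => exact ihp h fun _ h => ihq h hQ
  | ite b p q ihp ihq => exact ⟨fun hb => ihp (h.1 hb) hQ, fun hb => ihq (h.2 hb) hQ⟩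
  | loop b p ih =>
    simp only [wp] at h ⊢
    generalize K + 1 = j at h ⊢
    induction j generalizing s with
    | zero => exact h.elim
    | succ j ihj =>
      rcases h with ⟨hb, h⟩ | ⟨hb, h⟩
      · exact .inl ⟨hb, hQ _ h⟩
      · exact .inr ⟨hb, ih h fun _ => ihj⟩

theorem wp_loop {K N : ℕ} {b : BoolExp} {p : Program} {Q : Memory → Prop} {s : Memory}
    (I : ℕ → Memory → Prop) (hN : N ≤ K) (h0 : I 0 s)
    (hstep : ∀ i < N, ∀ s, I i s → b.Holds s ∧ wp K p (I (i + 1)) s)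
    (hend : ∀ s, I N s → ¬ b.Holds s ∧ Q s) : wp K (.loop b p) Q s := by
  simp only [wp]
  obtain ⟨j, hj⟩ := Nat.exists_eq_add_of_le hN
  suffices H : ∀ r ≤ N, ∀ s, I (N - r) s → iteratePred
      (fun R s => (¬ b.Holds s ∧ Q s) ∨ (b.Holds s ∧ wp K p R s)) (r + j + 1) s by
    have := H N le_rfl s (by simpa using h0)
    rwa [← hj] at this
  intro r
  induction r with
  | zero => intro _ s hs; exact .inl (hend s hs)
  | succ r ih =>
    intro hr s hs
    obtain ⟨hb, h⟩ := hstep (N - (r + 1)) (by omega) s hs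
    rw [show r + 1 + j + 1 = (r + j + 1) + 1 by omega]
    refine .inr ⟨hb, wp_mono h fun s hs => ih (by omega) s ?_⟩
    rwa [show N - r = N - (r + 1) + 1 by omega]

theorem Program.bound_le (p : Program) : ∃ c, ∀ K, 2 ≤ K → p.bound K ≤ c * K ^ c := by
  have key : ∀ c c' K : ℕ, 2 ≤ K → c ≤ c' → c * K ^ c ≤ c' * K ^ c' := fun c c' K hK h =>
    Nat.mul_le_mul h (Nat.pow_le_pow_right (by omega) h)
  have one : ∀ c K : ℕ, 2 ≤ K → c ≤ c * K ^ c := fun c K hK =>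
    Nat.le_mul_of_pos_right _ (Nat.pow_pos (by omega))
  induction p with
  | skip => exact ⟨1, fun K hK => one 1 K hK⟩
  | setNat _ e x => exact ⟨_, fun K hK => one _ K hK⟩
  | setReal _ e x => exact ⟨_, fun K hK => one _ K hK⟩
  | seq p q ihp ihq =>
    obtain ⟨c₁, h₁⟩ := ihp
    obtain ⟨c₂, h₂⟩ := ihq
    refine ⟨c₁ + c₂, fun K hK => (Nat.add_le_add (h₁ K hK) (h₂ K hK)).trans ?_⟩
    rw [add_mul]
    exact Nat.add_le_add (Nat.mul_le_mul_left _ (Nat.pow_le_pow_right (by omega) (by omega)))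
      (Nat.mul_le_mul_left _ (Nat.pow_le_pow_right (by omega) (by omega)))
  | ite b p q ihp ihq =>
    obtain ⟨c₁, h₁⟩ := ihp
    obtain ⟨c₂, h₂⟩ := ihq
    refine ⟨b.cost + 1 + (c₁ + c₂), fun K hK => (Nat.add_le_add_left
      (Nat.add_le_add (h₁ K hK) (h₂ K hK)) _).trans ?_⟩
    rw [add_mul, add_mul c₁]
    exact Nat.add_le_add (Nat.le_mul_of_pos_right _ (Nat.pow_pos (by omega))) (Nat.add_le_add
      (Nat.mul_le_mul_left _ (Nat.pow_le_pow_right (by omega) (by omega)))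
      (Nat.mul_le_mul_left _ (Nat.pow_le_pow_right (by omega) (by omega))))
  | loop b p ih =>
    obtain ⟨c, h⟩ := ih
    refine ⟨2 * (b.cost + 1 + c), fun K hK => ?_⟩
    have h1 : b.cost + 1 + p.bound K ≤ (b.cost + 1 + c) * K ^ c := by
      rw [add_mul]
      exact Nat.add_le_add (Nat.le_mul_of_pos_right _ (Nat.pow_pos (by omega))) (h K hK)
    calc (K + 1) * (b.cost + 1 + p.bound K) ≤ (2 * K) * ((b.cost + 1 + c) * K ^ c) :=
          Nat.mul_le_mul (by omega) h1
      _ = 2 * (b.cost + 1 + c) * K ^ (c + 1) := by ring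
      _ ≤ _ := Nat.mul_le_mul_left _ (Nat.pow_le_pow_right (by omega) (by omega))

/-! ### Reading and writing -/

@[simp] theorem Memory.writeNat_real (s : Memory) (a i x : ℕ) :
    (s.writeNat a i x).real = s.real := rfl

@[simp] theorem Memory.writeReal_nat (s : Memory) (a i : ℕ) (x : ℝ) :
    (s.writeReal a i x).nat = s.nat := rfl

theorem Memory.writeNat_nat (s : Memory) (a i x b : ℕ) : (s.writeNat a i x).nat b =
    if b = a then Function.update (s.nat a) i x else s.nat b := by
  simp [Memory.writeNat, Function.update_apply]

theorem Memory.writeReal_real (s : Memory) (a i : ℕ) (x : ℝ) (b : ℕ) :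
    (s.writeReal a i x).real b =
    if b = a then Function.update (s.real a) i x else s.real b := by
  simp [Memory.writeReal, Function.update_apply]

end ExtTSP

namespace ExtTSP

/-! ### A language of polynomial-time expressions

Natural-number array 10 and real array 10 are the evaluation stacks, natural-number array 11 holds
the values of the variables. -/

local infixr:67 " ;; " => Program.seq

/-- Binds the variable `x` to `v`. -/
abbrev Memory.setVar (s : Memory) (x v : ℕ) : Memory := s.writeNat 11 x v

open Classical in
/-- The least `i < N` such that `p i`, and `N` if there is none. -/
noncomputable def leastBelow (N : ℕ) (p : ℕ → Prop) : ℕ :=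
  N.rec 0 fun i r => if r = i ∧ ¬ p i then i + 1 else r

theorem leastBelow_succ (N : ℕ) (p : ℕ → Prop) [Decidable (leastBelow N p = N ∧ ¬ p N)] :
    leastBelow (N + 1) p = if leastBelow N p = N ∧ ¬ p N then N + 1 else leastBelow N p := by
  simp only [leastBelow]
  congr

theorem leastBelow_le (N : ℕ) (p : ℕ → Prop) : leastBelow N p ≤ N := by
  classical
  induction N with
  | zero => exact le_rfl
  | succ N ih => rw [leastBelow_succ]; split_ifs <;> omega

theorem not_of_lt_leastBelow {N i : ℕ} {p : ℕ → Prop} (h : i < leastBelow N p) : ¬ p i := by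
  classical
  induction N with
  | zero => exact absurd h (Nat.not_lt_zero i)
  | succ N ih =>
    rw [leastBelow_succ] at h
    split_ifs at h with hN
    · rcases Nat.lt_succ_iff_lt_or_eq.1 h with h | rfl
      · exact ih (by omega)
      · exact hN.2
    · exact ih h

theorem leastBelow_spec_of_lt {N : ℕ} {p : ℕ → Prop} (h : leastBelow N p < N) :
    p (leastBelow N p) := by
  classical
  induction N with
  | zero => exact absurd h (Nat.not_lt_zero _)
  | succ N ih =>
    rw [leastBelow_succ] at h ⊢
    split_ifs at h ⊢ with hN
    · omega
    · rcases (leastBelow_le N p).lt_or_eq with h' | h'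
      · exact ih h'
      · rw [h'] at hN ⊢
        by_contra hp
        exact hN ⟨rfl, hp⟩

theorem leastBelow_lt {N i : ℕ} {p : ℕ → Prop} (hi : i < N) (h : p i) : leastBelow N p < N := by
  by_contra h'
  exact not_of_lt_leastBelow (hi.trans_le (not_lt.1 h')) h

theorem leastBelow_spec {N i : ℕ} {p : ℕ → Prop} (hi : i < N) (h : p i) : p (leastBelow N p) :=
  leastBelow_spec_of_lt (leastBelow_lt hi h)

mutual

/-- Natural-number expressions; a condition counts as true if its value is not 0. -/
inductive NExp where
  | const (c : ℕ)
  | var (x : ℕ)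
  | get (a : ℕ) (e : NExp)
  | add (e₁ e₂ : NExp)
  | sub (e₁ e₂ : NExp)
  | mul (e₁ e₂ : NExp)
  | div (e₁ e₂ : NExp)
  | leReal (r₁ r₂ : RExp)
  | sum (x : ℕ) (N e : NExp)
  | find (x : ℕ) (N e : NExp)
  | bind (x : ℕ) (v e : NExp)
  | ite (c e₁ e₂ : NExp)

/-- Real expressions. -/
inductive RExp where
  | zero
  | get (a : ℕ) (e : NExp)
  | add (r₁ r₂ : RExp)
  | mul (r₁ r₂ : RExp)
  | sum (x : ℕ) (N : NExp) (r : RExp)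
  | bind (x : ℕ) (v : NExp) (r : RExp)
  | ite (c : NExp) (r₁ r₂ : RExp)

end

open Classical in
mutual

noncomputable def NExp.eval : NExp → Memory → ℕ
  | .const c, _ => c
  | .var x, s => s.nat 11 x
  | .get a e, s => if a = 10 then 0 else s.nat a (e.eval s)
  | .add e₁ e₂, s => e₁.eval s + e₂.eval s
  | .sub e₁ e₂, s => e₁.eval s - e₂.eval s
  | .mul e₁ e₂, s => e₁.eval s * e₂.eval s
  | .div e₁ e₂, s => e₁.eval s / e₂.eval s
  | .leReal r₁ r₂, s => if r₁.eval s ≤ r₂.eval s then 1 else 0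
  | .sum x N e, s => ∑ i ∈ Finset.range (N.eval s), e.eval (s.setVar x i)
  | .find x N e, s => leastBelow (N.eval s) fun i => e.eval (s.setVar x i) ≠ 0
  | .bind x v e, s => e.eval (s.setVar x (v.eval s))
  | .ite c e₁ e₂, s => if c.eval s ≠ 0 then e₁.eval s else e₂.eval s

noncomputable def RExp.eval : RExp → Memory → ℝ
  | .zero, _ => 0
  | .get a e, s => if a = 10 then 0 else s.real a (e.eval s)
  | .add e₁ e₂, s => e₁.eval s + e₂.eval s
  | .mul e₁ e₂, s => e₁.eval s * e₂.eval s
  | .sum x N e, s => ∑ i ∈ Finset.range (N.eval s), e.eval (s.setVar x i)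
  | .bind x v e, s => e.eval (s.setVar x (v.eval s))
  | .ite c e₁ e₂, s => if c.eval s ≠ 0 then e₁.eval s else e₂.eval s

end

/-- The cell `d` of the stack. -/
abbrev cell (d : ℕ) : NatExp := .get 10 (.const d)

/-- The variable `x`. -/
abbrev varCell (x : ℕ) : NatExp := .get 11 (.const x)

abbrev put (d : ℕ) (e : NatExp) : Program := .setNat 10 (.const d) e

abbrev putReal (d : ℕ) (r : RealExp) : Program := .setReal 10 (.const d) r

abbrev putVar (x : ℕ) (e : NatExp) : Program := .setNat 11 (.const x) e

abbrev realCell (d : ℕ) : RealExp := .get 10 (.const d)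

/-- Runs `p` with the variable `x` bound to the value of the cell `d`. -/
def bindProgram (d x : ℕ) (p : Program) : Program :=
  put (d + 1) (varCell x) ;; putVar x (cell d) ;; p ;; putVar x (cell (d + 1))

/-- Runs `p` for all values of the variable `x` that are smaller than the value of the cell `d`. -/
def forProgram (d x : ℕ) (p : Program) : Program :=
  put (d + 1) (varCell x) ;; putVar x (.const 0) ;;
  .loop (.leNat (.add (varCell x) (.const 1)) (cell d))
    (p ;; putVar x (.add (varCell x) (.const 1))) ;; putVar x (cell (d + 1))

def mulProgram (d : ℕ) : Program :=
  put (d + 2) (.const 0) ;;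
  .loop (.leNat (.const 1) (cell (d + 1)))
    (put (d + 2) (.add (cell (d + 2)) (cell d)) ;;
      put (d + 1) (.sub (cell (d + 1)) (.const 1))) ;; put d (cell (d + 2))

def divProgram (d : ℕ) : Program :=
  put (d + 2) (.const 0) ;;
  .ite (.leNat (.const 1) (cell (d + 1)))
    (.loop (.leNat (cell (d + 1)) (cell d))
      (put (d + 2) (.add (cell (d + 2)) (.const 1)) ;;
        put d (.sub (cell d) (cell (d + 1))))) .skip ;; put d (cell (d + 2))

mutual

/-- A program that writes the value of the expression to the cell `d` of the stack and uses no
smaller cells. -/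
noncomputable def NExp.compile : NExp → ℕ → Program
  | .const c, d => put d (.const c)
  | .var x, d => put d (varCell x)
  | .get a e, d => e.compile d ;; if a = 10 then put d (.const 0) else put d (.get a (cell d))
  | .add e₁ e₂, d => e₁.compile d ;; e₂.compile (d + 1) ;; put d (.add (cell d) (cell (d + 1)))
  | .sub e₁ e₂, d => e₁.compile d ;; e₂.compile (d + 1) ;; put d (.sub (cell d) (cell (d + 1)))
  | .mul e₁ e₂, d => e₁.compile d ;; e₂.compile (d + 1) ;; mulProgram d
  | .div e₁ e₂, d => e₁.compile d ;; e₂.compile (d + 1) ;; divProgram d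
  | .leReal r₁ r₂, d => r₁.compile d ;; r₂.compile (d + 1) ;;
      .ite (.leReal (realCell d) (realCell (d + 1))) (put d (.const 1)) (put d (.const 0))
  | .sum x N e, d => N.compile d ;; put (d + 2) (.const 0) ;;
      forProgram d x (e.compile (d + 3) ;; put (d + 2) (.add (cell (d + 2)) (cell (d + 3)))) ;;
      put d (cell (d + 2))
  | .find x N e, d => N.compile d ;; put (d + 2) (.const 0) ;;
      forProgram d x (e.compile (d + 3) ;;
        .ite (.and (.leNat (cell (d + 3)) (.const 0)) (.leNat (varCell x) (cell (d + 2))))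
          (put (d + 2) (.add (varCell x) (.const 1))) .skip) ;;
      put d (cell (d + 2))
  | .bind x v e, d => v.compile d ;; bindProgram d x (e.compile (d + 2)) ;; put d (cell (d + 2))
  | .ite c e₁ e₂, d => c.compile d ;;
      .ite (.leNat (.const 1) (cell d)) (e₁.compile d) (e₂.compile d)

/-- A program that writes the value of the expression to the cell `d` of the real stack and uses
no smaller cells. -/
noncomputable def RExp.compile : RExp → ℕ → Program
  | .zero, d => putReal d .zero
  | .get a e, d => e.compile d ;;
      if a = 10 then putReal d .zero else putReal d (.get a (cell d))
  | .add r₁ r₂, d =>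
      r₁.compile d ;; r₂.compile (d + 1) ;; putReal d (.add (realCell d) (realCell (d + 1)))
  | .mul r₁ r₂, d =>
      r₁.compile d ;; r₂.compile (d + 1) ;; putReal d (.mul (realCell d) (realCell (d + 1)))
  | .sum x N r, d => N.compile d ;; putReal (d + 2) .zero ;;
      forProgram d x
        (r.compile (d + 3) ;; putReal (d + 2) (.add (realCell (d + 2)) (realCell (d + 3)))) ;;
      putReal d (realCell (d + 2))
  | .bind x v r, d =>
      v.compile d ;; bindProgram d x (r.compile (d + 2)) ;; putReal d (realCell (d + 2))
  | .ite c r₁ r₂, d => c.compile d ;;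
      .ite (.leNat (.const 1) (cell d)) (r₁.compile d) (r₂.compile d)

end

/-- The memories agree up to the cells of the stacks from `d` on. -/
structure Frame (d : ℕ) (s s' : Memory) : Prop where
  nat : ∀ a, a ≠ 10 → s'.nat a = s.nat a
  real : ∀ a, a ≠ 10 → s'.real a = s.real a
  stack : ∀ i < d, s'.nat 10 i = s.nat 10 i
  realStack : ∀ i < d, s'.real 10 i = s.real 10 i

theorem Frame.refl (d : ℕ) (s : Memory) : Frame d s s :=
  ⟨fun _ _ => rfl, fun _ _ => rfl, fun _ _ => rfl, fun _ _ => rfl⟩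

theorem Frame.trans {d d' : ℕ} {s s' s'' : Memory} (h : Frame d s s') (h' : Frame d' s' s'')
    (hd : d ≤ d' := by omega) : Frame d s s'' :=
  ⟨fun a ha => (h'.nat a ha).trans (h.nat a ha), fun a ha => (h'.real a ha).trans (h.real a ha),
    fun i hi => (h'.stack i (by omega)).trans (h.stack i hi),
    fun i hi => (h'.realStack i (by omega)).trans (h.realStack i hi)⟩

theorem Frame.mono {d d' : ℕ} {s s' : Memory} (h : Frame d' s s') (hd : d ≤ d' := by omega) :
    Frame d s s' :=
  (Frame.refl d s).trans h

theorem frame_writeNat {d i : ℕ} (s : Memory) (x : ℕ) (h : d ≤ i := by omega) :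
    Frame d s (s.writeNat 10 i x) where
  nat a ha := by simp [Memory.writeNat_nat, ha]
  real a ha := rfl
  stack j hj := by simp [Memory.writeNat_nat, (show j ≠ i by omega)]
  realStack j hj := rfl

theorem frame_writeReal {d i : ℕ} (s : Memory) (x : ℝ) (h : d ≤ i := by omega) :
    Frame d s (s.writeReal 10 i x) where
  nat a ha := rfl
  real a ha := by simp [Memory.writeReal_real, ha]
  stack j hj := rfl
  realStack j hj := by simp [Memory.writeReal_real, (show j ≠ i by omega)]

theorem Frame.writeNat {d : ℕ} {s s' : Memory} (h : Frame d s s') (i x : ℕ)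
    (hi : d ≤ i := by omega) : Frame d s (s'.writeNat 10 i x) :=
  h.trans (frame_writeNat s' x hi)

theorem Frame.writeReal {d : ℕ} {s s' : Memory} (h : Frame d s s') (i : ℕ) (x : ℝ)
    (hi : d ≤ i := by omega) : Frame d s (s'.writeReal 10 i x) :=
  h.trans (frame_writeReal s' x hi)

theorem Frame.setVar {d : ℕ} {s s' : Memory} (h : Frame d s s') (x v : ℕ) :
    Frame d (s.setVar x v) (s'.setVar x v) where
  nat a ha := by simp [Memory.writeNat_nat, ha, h.nat]
  real a ha := h.real a ha
  stack j hj := by simp [Memory.writeNat_nat, h.stack j hj]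
  realStack := h.realStack

mutual

theorem NExp.eval_congr {s s' : Memory} (h : Frame 0 s s') :
    ∀ e : NExp, e.eval s' = e.eval s
  | .const c => rfl
  | .var x => by simp only [NExp.eval, h.nat 11 (by decide)]
  | .get a e => by
    simp only [NExp.eval, NExp.eval_congr h e]
    split_ifs with ha
    · rfl
    · rw [h.nat a ha]
  | .add e₁ e₂ => by simp only [NExp.eval, NExp.eval_congr h e₁, NExp.eval_congr h e₂]
  | .sub e₁ e₂ => by simp only [NExp.eval, NExp.eval_congr h e₁, NExp.eval_congr h e₂]
  | .mul e₁ e₂ => by simp only [NExp.eval, NExp.eval_congr h e₁, NExp.eval_congr h e₂]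
  | .div e₁ e₂ => by simp only [NExp.eval, NExp.eval_congr h e₁, NExp.eval_congr h e₂]
  | .leReal e₁ e₂ => by simp only [NExp.eval, RExp.eval_congr h e₁, RExp.eval_congr h e₂]
  | .sum x N e => by
    simp only [NExp.eval, NExp.eval_congr h N, fun i => NExp.eval_congr (h.setVar x i) e]
  | .find x N e => by
    simp only [NExp.eval, NExp.eval_congr h N, fun i => NExp.eval_congr (h.setVar x i) e]
  | .bind x v e => by
    simp only [NExp.eval, NExp.eval_congr h v, fun i => NExp.eval_congr (h.setVar x i) e]
  | .ite c e₁ e₂ => by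
    simp only [NExp.eval, NExp.eval_congr h c, NExp.eval_congr h e₁, NExp.eval_congr h e₂]

theorem RExp.eval_congr {s s' : Memory} (h : Frame 0 s s') :
    ∀ e : RExp, e.eval s' = e.eval s
  | .zero => rfl
  | .get a e => by
    simp only [RExp.eval, NExp.eval_congr h e]
    split_ifs with ha
    · rfl
    · rw [h.real a ha]
  | .add e₁ e₂ => by simp only [RExp.eval, RExp.eval_congr h e₁, RExp.eval_congr h e₂]
  | .mul e₁ e₂ => by simp only [RExp.eval, RExp.eval_congr h e₁, RExp.eval_congr h e₂]
  | .sum x N e => by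
    simp only [RExp.eval, NExp.eval_congr h N, fun i => RExp.eval_congr (h.setVar x i) e]
  | .bind x v e => by
    simp only [RExp.eval, NExp.eval_congr h v, fun i => RExp.eval_congr (h.setVar x i) e]
  | .ite c e₁ e₂ => by
    simp only [RExp.eval, NExp.eval_congr h c, RExp.eval_congr h e₁, RExp.eval_congr h e₂]

end

end ExtTSP

namespace ExtTSP

/-! ### Correctness of the compiled programs -/

/-- All natural numbers in the memory, except those on the stack, are at most `B`. -/
def Memory.BoundedBy (B : ℕ) (s : Memory) : Prop := ∀ a, a ≠ 10 → ∀ i, s.nat a i ≤ B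

theorem Memory.BoundedBy.frame {B : ℕ} {s s' : Memory} (h : s.BoundedBy B) (hf : Frame 0 s s') :
    s'.BoundedBy B := fun a ha i => by rw [hf.nat a ha]; exact h a ha i

theorem Memory.BoundedBy.setVar {B B' v : ℕ} {s : Memory} (h : s.BoundedBy B) (x : ℕ)
    (hB : B ≤ B') (hv : v ≤ B') : (s.setVar x v).BoundedBy B' := fun a ha i => by
  rw [Memory.writeNat_nat]
  split_ifs with h'
  · rw [Function.update_apply]
    split_ifs
    · exact hv
    · exact (h _ (by decide) _).trans hB
  · exact (h a ha i).trans hB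

/-- The value of the expression is polynomially bounded, and its program is correct and makes
polynomially many iterations. -/
def NExp.Correct (e : NExp) : Prop := ∃ c, 1 ≤ c ∧ ∀ B s, 2 ≤ B → s.BoundedBy B →
  e.eval s ≤ B ^ c ∧ ∀ K d, B ^ c ≤ K →
    wp K (e.compile d) (fun s' => Frame d s s' ∧ s'.nat 10 d = e.eval s) s

/-- The program of the expression is correct and makes polynomially many iterations. -/
def RExp.Correct (e : RExp) : Prop := ∃ c, 1 ≤ c ∧ ∀ B s, 2 ≤ B → s.BoundedBy B →
  ∀ K d, B ^ c ≤ K →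
    wp K (e.compile d) (fun s' => Frame d s s' ∧ s'.real 10 d = e.eval s) s

theorem wp_bindProgram {K d x v : ℕ} {p : Program} {s : Memory} {R : Memory → Prop}
    (hv : s.nat 10 d = v) (hR : ∀ s v, R s → R (s.setVar x v))
    (hp : ∀ s', Frame 0 (s.setVar x v) s' → wp K p (fun s'' => Frame (d + 2) s' s'' ∧ R s'') s') :
    wp K (bindProgram d x p) (fun s' => Frame d s s' ∧ R s') s := by
  simp only [bindProgram, wp_seq, wp_setNat, NatExp.eval]
  set s₀ := s.writeNat 10 (d + 1) (s.nat 11 x)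
  have h₀ : Frame d s s₀ := frame_writeNat s _
  have hv' : s₀.nat 10 d = v := by simp [s₀, Memory.writeNat_nat, hv]
  rw [hv']
  refine wp_mono (hp _ ((h₀.setVar x v).mono (Nat.zero_le _))) ?_
  rintro s₁ ⟨h₁, hR₁⟩
  refine ⟨⟨fun a ha => ?_, fun a ha => ?_, fun i hi => ?_, fun i hi => ?_⟩, hR _ _ hR₁⟩
  · rw [Memory.writeNat_nat]
    split_ifs with h
    · rw [h₁.nat 11 (by decide), h₁.stack _ (by omega), h]
      simp [Memory.writeNat_nat, s₀]
    · simp [h₁.nat a ha, Memory.writeNat_nat, s₀, h, ha]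
  · simp [h₁.real a ha, s₀]
  · simp [Memory.writeNat_nat, h₁.stack i (by omega), s₀, (show i ≠ d + 1 by omega)]
  · simp [h₁.realStack i (by omega), s₀]

theorem wp_forProgram {K N d x : ℕ} {p : Program} {s : Memory} (Acc : ℕ → Memory → Prop)
    (hN : s.nat 10 d = N) (hK : N ≤ K) (h0 : Acc 0 s)
    (hAcc : ∀ i s s', s'.nat 10 (d + 2) = s.nat 10 (d + 2) →
      s'.real 10 (d + 2) = s.real 10 (d + 2) → Acc i s → Acc i s')
    (hstep : ∀ i < N, ∀ s', Frame 0 (s.setVar x i) s' → Acc i s' →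
      wp K p (fun s'' => Frame (d + 2) s' s'' ∧ Acc (i + 1) s'') s') :
    wp K (forProgram d x p) (fun s' => Frame d s s' ∧ Acc N s') s := by
  simp only [forProgram, wp_seq, wp_setNat, NatExp.eval]
  set s₀ := s.writeNat 10 (d + 1) (s.nat 11 x) with hs₀
  have h₀ : Frame d s s₀ := frame_writeNat s _
  have hN' : s₀.nat 10 d = N := by simp [s₀, Memory.writeNat_nat, hN]
  refine wp_loop (fun i s' => Frame (d + 2) (s₀.setVar x i) s' ∧ Acc i s') hK
    ⟨Frame.refl _ _, hAcc 0 s _ (by simp [Memory.writeNat_nat, s₀]) rfl h0⟩ ?_ ?_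
  · rintro i hi s' ⟨hf, ha⟩
    have hx : s'.nat 11 x = i := by rw [hf.nat 11 (by decide)]; simp [Memory.writeNat_nat]
    have hd : s'.nat 10 d = N := by
      rw [hf.stack d (by omega)]; simp [Memory.writeNat_nat, hN, s₀]
    refine ⟨by simp only [BoolExp.Holds, NatExp.eval, hx, hd]; omega, ?_⟩
    rw [wp_seq]
    refine wp_mono (hstep i hi s' (((h₀.setVar x i).trans hf).mono (Nat.zero_le _)) ha) ?_
    rintro s'' ⟨hf', ha'⟩
    have hx' : s''.nat 11 x = i := by rw [hf'.nat 11 (by decide), hx]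
    refine ⟨?_, hAcc _ s'' _ (by simp [Memory.writeNat_nat, NatExp.eval]) rfl ha'⟩
    have := (hf.trans hf').setVar x (i + 1)
    simp only [NatExp.eval, hx']
    convert this using 1
    simp [Memory.writeNat]
  · rintro s' ⟨hf, ha⟩
    have hx : s'.nat 11 x = N := by rw [hf.nat 11 (by decide)]; simp [Memory.writeNat_nat]
    have hd : s'.nat 10 d = N := by
      rw [hf.stack d (by omega)]; simp [Memory.writeNat_nat, hN, s₀]
    refine ⟨by simp only [BoolExp.Holds, NatExp.eval, hx, hd]; omega, ?_,
      hAcc _ s' _ (by simp [Memory.writeNat_nat]) rfl ha⟩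
    refine ⟨fun a ha => ?_, fun a ha => ?_, fun i hi => ?_, fun i hi => ?_⟩
    · rw [Memory.writeNat_nat]
      split_ifs with h
      · rw [hf.nat 11 (by decide), hf.stack _ (by omega), h]
        simp [Memory.writeNat_nat, s₀]
      · simp [hf.nat a ha, Memory.writeNat_nat, s₀, h, ha]
    · simp [hf.real a ha, s₀]
    · simp [Memory.writeNat_nat, hf.stack i (by omega), s₀, (show i ≠ d + 1 by omega)]
    · simp [hf.realStack i (by omega), s₀]

theorem wp_mulProgram {K d x y : ℕ} {s : Memory} (hx : s.nat 10 d = x)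
    (hy : s.nat 10 (d + 1) = y) (hK : y ≤ K) :
    wp K (mulProgram d) (fun s' => Frame d s s' ∧ s'.nat 10 d = x * y) s := by
  simp only [mulProgram, wp_seq, wp_setNat, NatExp.eval]
  refine wp_loop (fun i s' => Frame d s s' ∧ s'.nat 10 d = x ∧ s'.nat 10 (d + 1) = y - i ∧
    s'.nat 10 (d + 2) = x * i) hK ?_ ?_ ?_
  · exact ⟨frame_writeNat s _, by simp [Memory.writeNat_nat, hx, hy]⟩
  · rintro i hi s' ⟨hf, h₁, h₂, h₃⟩
    refine ⟨by simp only [BoolExp.Holds, NatExp.eval]; omega, ?_⟩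
    simp only [wp_seq, wp_setNat, NatExp.eval]
    refine ⟨(hf.writeNat (d + 2) _).writeNat (d + 1) _,
      ?_⟩
    simp only [Memory.writeNat_nat, if_true, Function.update_apply, h₁, h₂, h₃]
    refine ⟨by simp, by simp; omega, by simp; ring⟩
  · rintro s' ⟨hf, h₁, h₂, h₃⟩
    refine ⟨by simp only [BoolExp.Holds, NatExp.eval]; omega,
      hf.writeNat d _, by simp [Memory.writeNat_nat, h₃]⟩

theorem wp_divProgram {K d x y : ℕ} {s : Memory} (hx : s.nat 10 d = x)
    (hy : s.nat 10 (d + 1) = y) (hK : x ≤ K) :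
    wp K (divProgram d) (fun s' => Frame d s s' ∧ s'.nat 10 d = x / y) s := by
  simp only [divProgram, wp_seq, wp_setNat, wp_ite, wp_skip, NatExp.eval, BoolExp.Holds]
  have hf₀ : Frame d s (s.writeNat 10 (d + 2) 0) := frame_writeNat s _
  have hx₀ : (s.writeNat 10 (d + 2) 0).nat 10 d = x := by simp [Memory.writeNat_nat, hx]
  have hy₀ : (s.writeNat 10 (d + 2) 0).nat 10 (d + 1) = y := by simp [Memory.writeNat_nat, hy]
  have hz₀ : (s.writeNat 10 (d + 2) 0).nat 10 (d + 2) = 0 := by simp [Memory.writeNat_nat]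
  generalize s.writeNat 10 (d + 2) 0 = s₀ at hf₀ hx₀ hy₀ hz₀
  rw [hy₀]
  refine ⟨fun hy1 => ?_, fun hy1 => ⟨hf₀.writeNat d _, ?_⟩⟩
  · refine wp_loop (N := x / y) (fun i s' => Frame d s s' ∧ s'.nat 10 d = x - i * y ∧
      s'.nat 10 (d + 1) = y ∧ s'.nat 10 (d + 2) = i) ((Nat.div_le_self _ _).trans hK) ?_ ?_ ?_
    · exact ⟨hf₀, by simp [hx₀], hy₀, hz₀⟩
    · rintro i hi s' ⟨hf, h₁, h₂, h₃⟩
      have hle : i * y + y ≤ x := by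
        have := (Nat.le_div_iff_mul_le (by omega)).1 (Nat.succ_le_of_lt hi)
        rwa [Nat.succ_mul] at this
      refine ⟨by simp only [BoolExp.Holds, NatExp.eval]; omega, ?_⟩
      simp only [wp_seq, wp_setNat, NatExp.eval]
      refine ⟨(hf.writeNat (d + 2) _).writeNat d _, ?_⟩
      simp only [Memory.writeNat_nat, if_true, Function.update_apply, h₁, h₂, h₃]
      refine ⟨?_, by simp, by simp⟩
      simp [Nat.succ_mul]
      omega
    · rintro s' ⟨hf, h₁, h₂, h₃⟩
      have := Nat.div_add_mod' x y
      have := Nat.mod_lt x (show 0 < y by omega)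
      exact ⟨by simp only [BoolExp.Holds, NatExp.eval]; omega,
        hf.writeNat d _, by simp [Memory.writeNat_nat, h₃]⟩
  · have : y = 0 := by omega
    simp [Memory.writeNat_nat, hz₀, this]

theorem NExp.correct_const (c : ℕ) : (NExp.const c).Correct := by
  refine ⟨c + 1, by omega, fun B s hB hs => ⟨?_, fun K d hK => ?_⟩⟩
  · simp only [NExp.eval]
    exact (Nat.lt_pow_self (by omega)).le.trans (Nat.pow_le_pow_right (by omega) (by omega))
  · simp only [NExp.compile, wp_setNat, NatExp.eval]
    exact ⟨frame_writeNat _ _, by simp [NExp.eval, Memory.writeNat_nat]⟩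

theorem NExp.correct_var (x : ℕ) : (NExp.var x).Correct := by
  refine ⟨1, le_rfl, fun B s hB hs => ⟨?_, fun K d hK => ?_⟩⟩
  · simpa [NExp.eval] using hs 11 (by decide) x
  · simp only [NExp.compile, wp_setNat, NatExp.eval]
    exact ⟨frame_writeNat _ _, by simp [NExp.eval, Memory.writeNat_nat]⟩

theorem NExp.Correct.get {e : NExp} (h : e.Correct) (a : ℕ) : (NExp.get a e).Correct := by
  obtain ⟨c, hc, h⟩ := h
  refine ⟨c, hc, fun B s hB hs => ⟨?_, fun K d hK => ?_⟩⟩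
  · simp only [NExp.eval]
    split_ifs with ha
    · exact Nat.zero_le _
    · exact (hs a ha _).trans (Nat.le_self_pow (by omega) _)
  · simp only [NExp.compile, wp_seq]
    refine wp_mono ((h B s hB hs).2 K d hK) ?_
    rintro s' ⟨hf, hr⟩
    simp only [NExp.eval]
    split_ifs with ha <;> simp only [wp_setNat, NatExp.eval]
    · exact ⟨hf.writeNat d _, by simp [Memory.writeNat_nat]⟩
    · exact ⟨hf.writeNat d _, by simp [Memory.writeNat_nat, hr, hf.nat a ha]⟩

theorem Nat.add_le_pow_add {B x y c₁ c₂ : ℕ} (hB : 2 ≤ B) (h₁ : x ≤ B ^ c₁) (h₂ : y ≤ B ^ c₂)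
    (hc₁ : 1 ≤ c₁) (hc₂ : 1 ≤ c₂) : x + y ≤ B ^ (c₁ + c₂) := by
  rw [pow_add]
  have h1 : 2 ≤ B ^ c₁ := hB.trans (Nat.le_self_pow (by omega) _)
  have h2 : 2 ≤ B ^ c₂ := hB.trans (Nat.le_self_pow (by omega) _)
  nlinarith

theorem NExp.Correct.binary {e₁ e₂ e : NExp} {q : ℕ → Program} {f : ℕ → ℕ → ℕ}
    (h₁ : e₁.Correct) (h₂ : e₂.Correct)
    (he : ∀ d, e.compile d = .seq (e₁.compile d) (.seq (e₂.compile (d + 1)) (q d)))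
    (hf : ∀ s, e.eval s = f (e₁.eval s) (e₂.eval s))
    (hle : ∀ x y, f x y ≤ x + y ∨ f x y ≤ x * y)
    (hq : ∀ K d s, s.nat 10 d ≤ K → s.nat 10 (d + 1) ≤ K → wp K (q d) (fun s' =>
      Frame d s s' ∧ s'.nat 10 d = f (s.nat 10 d) (s.nat 10 (d + 1))) s) : e.Correct := by
  obtain ⟨c₁, hc₁, h₁⟩ := h₁
  obtain ⟨c₂, hc₂, h₂⟩ := h₂
  refine ⟨c₁ + c₂, by omega, fun B s hB hs => ⟨?_, fun K d hK => ?_⟩⟩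
  · rw [hf]
    rcases hle (e₁.eval s) (e₂.eval s) with h | h
    · exact h.trans (Nat.add_le_pow_add hB (h₁ B s hB hs).1 (h₂ B s hB hs).1 hc₁ hc₂)
    · rw [pow_add]
      exact h.trans (Nat.mul_le_mul (h₁ B s hB hs).1 (h₂ B s hB hs).1)
  · rw [he]
    have hK₁ : B ^ c₁ ≤ K := (Nat.pow_le_pow_right (by omega) (by omega)).trans hK
    have hK₂ : B ^ c₂ ≤ K := (Nat.pow_le_pow_right (by omega) (by omega)).trans hK
    rw [wp_seq, wp_seq]
    refine wp_mono ((h₁ B s hB hs).2 K d hK₁) ?_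
    rintro s₁ ⟨hf₁, hr₁⟩
    have h0 : Frame 0 s s₁ := hf₁.mono
    refine wp_mono ((h₂ B s₁ hB (hs.frame h0)).2 K (d + 1) hK₂) ?_
    rintro s₂ ⟨hf₂, hr₂⟩
    rw [NExp.eval_congr h0] at hr₂
    rw [← hf₂.stack d (by omega)] at hr₁
    refine wp_mono (hq K d s₂ ?_ ?_) ?_
    · rw [hr₁]; exact (h₁ B s hB hs).1.trans hK₁
    · rw [hr₂]; exact (h₂ B s hB hs).1.trans hK₂
    · rintro s₃ ⟨hf₃, hr₃⟩
      exact ⟨(hf₁.trans hf₂).trans hf₃, by rw [hr₃, hr₁, hr₂, hf]⟩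

theorem RExp.Correct.binary {r₁ r₂ : RExp} {P : ℕ → Program}
    {q : ℕ → Program} {R : ℕ → Memory → Memory → Prop} (h₁ : r₁.Correct) (h₂ : r₂.Correct)
    (he : ∀ d, P d = .seq (r₁.compile d) (.seq (r₂.compile (d + 1)) (q d)))
    (hq : ∀ K d s s', s'.real 10 d = r₁.eval s → s'.real 10 (d + 1) = r₂.eval s →
      wp K (q d) (fun s'' => Frame d s' s'' ∧ R d s s'') s') :
    ∃ c, 1 ≤ c ∧ ∀ B s, 2 ≤ B → s.BoundedBy B → ∀ K d, B ^ c ≤ K →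
      wp K (P d) (fun s' => Frame d s s' ∧ R d s s') s := by
  obtain ⟨c₁, hc₁, h₁⟩ := h₁
  obtain ⟨c₂, hc₂, h₂⟩ := h₂
  refine ⟨c₁ + c₂, by omega, fun B s hB hs K d hK => ?_⟩
  rw [he]
  have hK₁ : B ^ c₁ ≤ K := (Nat.pow_le_pow_right (by omega) (by omega)).trans hK
  have hK₂ : B ^ c₂ ≤ K := (Nat.pow_le_pow_right (by omega) (by omega)).trans hK
  rw [wp_seq, wp_seq]
  refine wp_mono (h₁ B s hB hs K d hK₁) ?_
  rintro s₁ ⟨hf₁, hr₁⟩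
  have h0 : Frame 0 s s₁ := hf₁.mono
  refine wp_mono (h₂ B s₁ hB (hs.frame h0) K (d + 1) hK₂) ?_
  rintro s₂ ⟨hf₂, hr₂⟩
  rw [RExp.eval_congr h0] at hr₂
  rw [← hf₂.realStack d (by omega)] at hr₁
  refine wp_mono (hq K d s s₂ hr₁ hr₂) ?_
  rintro s₃ ⟨hf₃, hr₃⟩
  exact ⟨(hf₁.trans hf₂).trans hf₃, hr₃⟩

theorem NExp.Correct.leReal {r₁ r₂ : RExp} (h₁ : r₁.Correct) (h₂ : r₂.Correct) :
    (NExp.leReal r₁ r₂).Correct := by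
  obtain ⟨c, hc, h⟩ := RExp.Correct.binary (P := (NExp.leReal r₁ r₂).compile)
    (R := fun d s s' => s'.nat 10 d = (NExp.leReal r₁ r₂).eval s) h₁ h₂
    (fun d => by simp only [NExp.compile]; rfl) (fun K d s s' hr₁ hr₂ => by
      simp only [wp_ite, wp_setNat, BoolExp.Holds, RealExp.eval, NatExp.eval, hr₁, hr₂,
        NExp.eval]
      refine ⟨fun h => ⟨frame_writeNat _ _, ?_⟩, fun h => ⟨frame_writeNat _ _, ?_⟩⟩
      · simp [h, Memory.writeNat_nat]
      · simp [h, Memory.writeNat_nat])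
  refine ⟨c, hc, fun B s hB hs => ⟨?_, h B s hB hs⟩⟩
  simp only [NExp.eval]
  have : 1 ≤ B ^ c := Nat.one_le_pow _ _ (by omega)
  split_ifs <;> omega

theorem wp_bind_compile {v : NExp} (hv : v.Correct) (x : ℕ) {p : ℕ → Program}
    {R : Memory → ℕ → Memory → Prop} {c : ℕ}
    (hR : ∀ s d s' v, R s d s' → R s d (s'.setVar x v))
    (hR' : ∀ s d s₀ s', Frame 0 s₀ s → R s d s' → R s₀ d s')
    (h : ∀ B s, 2 ≤ B → s.BoundedBy B → ∀ K d, B ^ c ≤ K →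
      wp K (p d) (fun s' => Frame d s s' ∧ R s d s') s) :
    ∃ c', 1 ≤ c' ∧ ∀ B s, 2 ≤ B → s.BoundedBy B → ∀ K d, B ^ c' ≤ K →
      wp K (.seq (v.compile d) (bindProgram d x (p (d + 2))))
        (fun s' => Frame d s s' ∧ R (s.setVar x (v.eval s)) (d + 2) s') s := by
  obtain ⟨c₁, hc₁, h₁⟩ := hv
  refine ⟨c₁ + c₁ * c, by omega, fun B s hB hs K d hK => ?_⟩
  have hK₁ : B ^ c₁ ≤ K := (Nat.pow_le_pow_right (by omega) (by omega)).trans hK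
  have hK₂ : B ^ (c₁ * c) ≤ K := (Nat.pow_le_pow_right (by omega) (by omega)).trans hK
  have hB₁ : B ≤ B ^ c₁ := Nat.le_self_pow (by omega) _
  rw [wp_seq]
  refine wp_mono ((h₁ B s hB hs).2 K d hK₁) ?_
  rintro s₁ ⟨hf₁, hr₁⟩
  refine wp_mono (wp_bindProgram (R := R (s.setVar x (v.eval s)) (d + 2)) hr₁
    (fun s' v h => hR _ _ _ _ h) fun s₂ hs₂ => ?_) ?_
  · have hf₂ : Frame 0 (s.setVar x (v.eval s)) s₂ := ((hf₁.setVar x (v.eval s)).mono (Nat.zero_le _)).trans hs₂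
    refine wp_mono (h (B ^ c₁) s₂ (hB.trans hB₁)
      ((hs.setVar x hB₁ (h₁ B s hB hs).1).frame hf₂) K (d + 2) (by rwa [← pow_mul])) ?_
    exact fun s₃ h₃ => ⟨h₃.1, hR' _ _ _ _ hf₂ h₃.2⟩
  · exact fun s₃ h₃ => ⟨hf₁.trans h₃.1, h₃.2⟩

theorem NExp.Correct.bind {v e : NExp} (hv : v.Correct) (h : e.Correct) (x : ℕ) :
    (NExp.bind x v e).Correct := by
  obtain ⟨c, hc, h⟩ := h
  obtain ⟨c', hc', h'⟩ := wp_bind_compile hv x (p := e.compile)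
    (R := fun s d s' => s'.nat 10 d = e.eval s) (c := c)
    (fun s d s' v h => by simpa [Memory.writeNat_nat] using h)
    (fun s d s₀ s' hf h => by rw [h, NExp.eval_congr hf]) (fun B s hB hs => (h B s hB hs).2)
  obtain ⟨c₁, hc₁, h₁⟩ := hv
  refine ⟨c' + c₁ * c, by omega, fun B s hB hs => ⟨?_, fun K d hK => ?_⟩⟩
  · have hB₁ : B ≤ B ^ c₁ := Nat.le_self_pow (by omega) _
    refine ((h (B ^ c₁) _ (hB.trans hB₁) (hs.setVar x hB₁ (h₁ B s hB hs).1)).1).trans ?_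
    rw [← pow_mul]
    exact Nat.pow_le_pow_right (by omega) (by omega)
  · have := h' B s hB hs K d ((Nat.pow_le_pow_right (by omega) (by omega)).trans hK)
    rw [wp_seq] at this
    simp only [NExp.compile, wp_seq]
    refine wp_mono this fun s₁ h₁ => wp_mono h₁ fun s₂ h₂ => ?_
    simp only [wp_setNat, NatExp.eval]
    exact ⟨h₂.1.writeNat d _, by simp [Memory.writeNat_nat, h₂.2, NExp.eval]⟩

theorem RExp.Correct.bind {v : NExp} {e : RExp} (hv : v.Correct) (h : e.Correct) (x : ℕ) :
    (RExp.bind x v e).Correct := by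
  obtain ⟨c, hc, h⟩ := h
  obtain ⟨c', hc', h'⟩ := wp_bind_compile hv x (p := e.compile)
    (R := fun s d s' => s'.real 10 d = e.eval s) (c := c)
    (fun s d s' v h => h) (fun s d s₀ s' hf h => by rw [h, RExp.eval_congr hf]) h
  refine ⟨c', hc', fun B s hB hs K d hK => ?_⟩
  have := h' B s hB hs K d hK
  rw [wp_seq] at this
  simp only [RExp.compile, wp_seq]
  refine wp_mono this fun s₁ h₁ => wp_mono h₁ fun s₂ h₂ => ?_
  simp only [wp_setReal, NatExp.eval, RealExp.eval]
  exact ⟨h₂.1.writeReal d _, by simp [Memory.writeReal_real, h₂.2, RExp.eval]⟩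

theorem NExp.Correct.ite {b e₁ e₂ : NExp} (hb : b.Correct) (h₁ : e₁.Correct) (h₂ : e₂.Correct) :
    (NExp.ite b e₁ e₂).Correct := by
  obtain ⟨c, hc, h⟩ := hb
  obtain ⟨c₁, hc₁, h₁⟩ := h₁
  obtain ⟨c₂, hc₂, h₂⟩ := h₂
  refine ⟨c + c₁ + c₂, by omega, fun B s hB hs => ⟨?_, fun K d hK => ?_⟩⟩
  · simp only [NExp.eval]
    split_ifs
    · exact (h₁ B s hB hs).1.trans (Nat.pow_le_pow_right (by omega) (by omega))
    · exact (h₂ B s hB hs).1.trans (Nat.pow_le_pow_right (by omega) (by omega))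
  · simp only [NExp.compile, wp_seq]
    refine wp_mono ((h B s hB hs).2 K d
      ((Nat.pow_le_pow_right (by omega) (by omega)).trans hK)) ?_
    rintro s₁ ⟨hf₁, hr₁⟩
    have h0 : Frame 0 s s₁ := hf₁.mono
    simp only [wp_ite, BoolExp.Holds, NatExp.eval, hr₁, NExp.eval]
    refine ⟨fun hb => ?_, fun hb => ?_⟩
    · refine wp_mono ((h₁ B s₁ hB (hs.frame h0)).2 K d
        ((Nat.pow_le_pow_right (by omega) (by omega)).trans hK)) ?_
      rintro s₂ ⟨hf₂, hr₂⟩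
      exact ⟨hf₁.trans hf₂, by rw [hr₂, NExp.eval_congr h0, if_pos (by omega)]⟩
    · refine wp_mono ((h₂ B s₁ hB (hs.frame h0)).2 K d
        ((Nat.pow_le_pow_right (by omega) (by omega)).trans hK)) ?_
      rintro s₂ ⟨hf₂, hr₂⟩
      exact ⟨hf₁.trans hf₂, by rw [hr₂, NExp.eval_congr h0, if_neg (by omega)]⟩

theorem RExp.Correct.ite {b : NExp} {e₁ e₂ : RExp} (hb : b.Correct) (h₁ : e₁.Correct)
    (h₂ : e₂.Correct) : (RExp.ite b e₁ e₂).Correct := by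
  obtain ⟨c, hc, h⟩ := hb
  obtain ⟨c₁, hc₁, h₁⟩ := h₁
  obtain ⟨c₂, hc₂, h₂⟩ := h₂
  refine ⟨c + c₁ + c₂, by omega, fun B s hB hs K d hK => ?_⟩
  simp only [RExp.compile, wp_seq]
  refine wp_mono ((h B s hB hs).2 K d
    ((Nat.pow_le_pow_right (by omega) (by omega)).trans hK)) ?_
  rintro s₁ ⟨hf₁, hr₁⟩
  have h0 : Frame 0 s s₁ := hf₁.mono
  simp only [wp_ite, BoolExp.Holds, NatExp.eval, hr₁, RExp.eval]
  refine ⟨fun hb => ?_, fun hb => ?_⟩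
  · refine wp_mono (h₁ B s₁ hB (hs.frame h0) K d
      ((Nat.pow_le_pow_right (by omega) (by omega)).trans hK)) ?_
    rintro s₂ ⟨hf₂, hr₂⟩
    exact ⟨hf₁.trans hf₂, by rw [hr₂, RExp.eval_congr h0, if_pos (by omega)]⟩
  · refine wp_mono (h₂ B s₁ hB (hs.frame h0) K d
      ((Nat.pow_le_pow_right (by omega) (by omega)).trans hK)) ?_
    rintro s₂ ⟨hf₂, hr₂⟩
    exact ⟨hf₁.trans hf₂, by rw [hr₂, RExp.eval_congr h0, if_neg (by omega)]⟩

theorem wp_for_compile {N : NExp} (hN : N.Correct) (x : ℕ) {init p fin : ℕ → Program} {c : ℕ}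
    {Acc : Memory → ℕ → ℕ → Memory → Prop} {Post : Memory → ℕ → Memory → Prop}
    (hAcc : ∀ s d i s' s'', s''.nat 10 (d + 2) = s'.nat 10 (d + 2) →
      s''.real 10 (d + 2) = s'.real 10 (d + 2) → Acc s d i s' → Acc s d i s'')
    (hinit : ∀ K d s s', wp K (init d) (fun s'' => Frame (d + 2) s' s'' ∧ Acc s d 0 s'') s')
    (hp : ∀ B s i, 2 ≤ B → s.BoundedBy B → i < N.eval s → i ≤ B → ∀ K d, B ^ c ≤ K → ∀ s',
      Frame 0 (s.setVar x i) s' → Acc s d i s' →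
      wp K (p d) (fun s'' => Frame (d + 2) s' s'' ∧ Acc s d (i + 1) s'') s')
    (hfin : ∀ K d s s', Acc s d (N.eval s) s' →
      wp K (fin d) (fun s'' => Frame d s' s'' ∧ Post s d s'') s') :
    ∃ c', 1 ≤ c' ∧ ∀ B s, 2 ≤ B → s.BoundedBy B → ∀ K d, B ^ c' ≤ K →
      wp K (.seq (N.compile d) (.seq (init d) (.seq (forProgram d x (p d)) (fin d))))
        (fun s' => Frame d s s' ∧ Post s d s') s := by
  obtain ⟨c₁, hc₁, h₁⟩ := hN
  refine ⟨c₁ + c₁ * c, by omega, fun B s hB hs K d hK => ?_⟩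
  have hK₁ : B ^ c₁ ≤ K := (Nat.pow_le_pow_right (by omega) (by omega)).trans hK
  have hK₂ : B ^ (c₁ * c) ≤ K := (Nat.pow_le_pow_right (by omega) (by omega)).trans hK
  have hB₁ : B ≤ B ^ c₁ := Nat.le_self_pow (by omega) _
  have hs₁ : s.BoundedBy (B ^ c₁) := fun a ha i => (hs a ha i).trans hB₁
  simp only [wp_seq]
  refine wp_mono ((h₁ B s hB hs).2 K d hK₁) ?_
  rintro s₁ ⟨hf₁, hr₁⟩
  refine wp_mono (hinit K d s s₁) ?_
  rintro s₂ ⟨hf₂, hr₂⟩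
  have hN₂ : s₂.nat 10 d = N.eval s := by rw [hf₂.stack d (by omega), hr₁]
  refine wp_mono (wp_forProgram (Acc s d) hN₂ ((h₁ B s hB hs).1.trans hK₁) hr₂ (hAcc s d) ?_) ?_
  · intro i hi s' hs' ha
    exact hp (B ^ c₁) s i (hB.trans hB₁) hs₁ hi (hi.le.trans (h₁ B s hB hs).1) K d
      (by rwa [← pow_mul]) s' ((((hf₁.trans hf₂).setVar x i).mono (Nat.zero_le _)).trans hs') ha
  · rintro s₃ ⟨hf₃, hr₃⟩
    refine wp_mono (hfin K d s s₃ hr₃) fun s₄ h₄ => ⟨?_, h₄.2⟩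
    exact ((hf₁.trans hf₂).trans hf₃).trans h₄.1

theorem NExp.Correct.sum {N e : NExp} (hN : N.Correct) (h : e.Correct) (x : ℕ) :
    (NExp.sum x N e).Correct := by
  obtain ⟨c, hc, h⟩ := h
  obtain ⟨c', hc', h'⟩ := wp_for_compile hN x (c := c)
    (init := fun d => put (d + 2) (.const 0))
    (p := fun d => .seq (e.compile (d + 3)) (put (d + 2) (.add (cell (d + 2)) (cell (d + 3)))))
    (fin := fun d => put d (cell (d + 2)))
    (Acc := fun s d i s' => s'.nat 10 (d + 2) = ∑ j ∈ Finset.range i, e.eval (s.setVar x j))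
    (Post := fun s d s' => s'.nat 10 d = (NExp.sum x N e).eval s)
    (fun s d i s' s'' h _ h' => h.trans h')
    (fun K d s s' => by
      simp only [wp_setNat, NatExp.eval]
      exact ⟨frame_writeNat _ _, by simp [Memory.writeNat_nat]⟩)
    (fun B s i hB hs hi hiB K d hK s' hf ha => by
      rw [wp_seq]
      refine wp_mono ((h B s' hB ((hs.setVar x le_rfl hiB).frame hf)).2 K (d + 3) hK) ?_
      rintro s'' ⟨hf', hr⟩
      simp only [wp_setNat, NatExp.eval]
      refine ⟨hf'.mono.writeNat (d + 2) _, ?_⟩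
      simp only [Memory.writeNat_nat, if_true, Function.update_self]
      rw [hf'.stack _ (by omega), ha, hr, NExp.eval_congr hf, Finset.sum_range_succ])
    (fun K d s s' ha => by
      simp only [wp_setNat, NatExp.eval]
      exact ⟨frame_writeNat _ _, by simp [Memory.writeNat_nat, NExp.eval, ha]⟩)
  obtain ⟨c₁, hc₁, h₁⟩ := hN
  refine ⟨c' + (c₁ + c₁ * c), by omega, fun B s hB hs => ⟨?_, fun K d hK => ?_⟩⟩
  · have hB₁ : B ≤ B ^ c₁ := Nat.le_self_pow (by omega) _
    have hN := (h₁ B s hB hs).1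
    calc (NExp.sum x N e).eval s = ∑ i ∈ Finset.range (N.eval s), e.eval (s.setVar x i) := by
          rw [NExp.eval]
      _ ≤ ∑ i ∈ Finset.range (N.eval s), (B ^ c₁) ^ c := Finset.sum_le_sum fun i hi =>
          (h (B ^ c₁) _ (hB.trans hB₁)
            (hs.setVar x hB₁ ((Finset.mem_range.1 hi).le.trans hN))).1
      _ ≤ B ^ (c₁ + c₁ * c) := by
          rw [Finset.sum_const, Finset.card_range, smul_eq_mul, pow_add, pow_mul]
          exact Nat.mul_le_mul_right _ hN
      _ ≤ _ := Nat.pow_le_pow_right (by omega) (by omega)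
  · simpa only [NExp.compile] using
      h' B s hB hs K d ((Nat.pow_le_pow_right (by omega) (by omega)).trans hK)

theorem NExp.Correct.find {N e : NExp} (hN : N.Correct) (h : e.Correct) (x : ℕ) :
    (NExp.find x N e).Correct := by
  classical
  obtain ⟨c, hc, h⟩ := h
  obtain ⟨c', hc', h'⟩ := wp_for_compile hN x (c := c)
    (init := fun d => put (d + 2) (.const 0))
    (p := fun d => .seq (e.compile (d + 3))
      (.ite (.and (.leNat (cell (d + 3)) (.const 0)) (.leNat (varCell x) (cell (d + 2))))
        (put (d + 2) (.add (varCell x) (.const 1))) .skip))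
    (fin := fun d => put d (cell (d + 2)))
    (Acc := fun s d i s' =>
      s'.nat 10 (d + 2) = leastBelow i fun j => e.eval (s.setVar x j) ≠ 0)
    (Post := fun s d s' => s'.nat 10 d = (NExp.find x N e).eval s)
    (fun s d i s' s'' h _ h' => h.trans h')
    (fun K d s s' => by
      simp only [wp_setNat, NatExp.eval]
      exact ⟨frame_writeNat _ _, by simp [Memory.writeNat_nat, leastBelow]⟩)
    (fun B s i hB hs hi hiB K d hK s' hf ha => by
      rw [wp_seq]
      refine wp_mono ((h B s' hB ((hs.setVar x le_rfl hiB).frame hf)).2 K (d + 3) hK) ?_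
      rintro s'' ⟨hf', hr⟩
      have hle := leastBelow_le i fun j => e.eval (s.setVar x j) ≠ 0
      have hx : s''.nat 11 x = i := by
        rw [hf'.nat 11 (by decide), hf.nat 11 (by decide)]; simp [Memory.writeNat_nat]
      rw [NExp.eval_congr hf] at hr
      rw [← hf'.stack _ (by omega)] at ha
      simp only [wp_ite, wp_setNat, wp_skip, BoolExp.Holds, NatExp.eval, hx, hr, ha,
        leastBelow_succ]
      refine ⟨fun hc => ⟨hf'.mono.writeNat (d + 2) _, ?_⟩, fun hc => ⟨hf'.mono, ?_⟩⟩
      · rw [if_pos ⟨by omega, by simp; omega⟩]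
        simp [Memory.writeNat_nat]
      · rw [if_neg]
        rintro ⟨h1, h2⟩
        exact hc ⟨by simpa using h2, by omega⟩)
    (fun K d s s' ha => by
      simp only [wp_setNat, NatExp.eval]
      exact ⟨frame_writeNat _ _, by simp [Memory.writeNat_nat, NExp.eval, ha]⟩)
  obtain ⟨c₁, hc₁, h₁⟩ := hN
  refine ⟨c' + c₁, by omega, fun B s hB hs => ⟨?_, fun K d hK => ?_⟩⟩
  · rw [NExp.eval]
    exact ((leastBelow_le _ _).trans (h₁ B s hB hs).1).trans
      (Nat.pow_le_pow_right (by omega) (by omega))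
  · simpa only [NExp.compile] using
      h' B s hB hs K d ((Nat.pow_le_pow_right (by omega) (by omega)).trans hK)

theorem RExp.Correct.sum {N : NExp} {e : RExp} (hN : N.Correct) (h : e.Correct) (x : ℕ) :
    (RExp.sum x N e).Correct := by
  obtain ⟨c, hc, h⟩ := h
  obtain ⟨c', hc', h'⟩ := wp_for_compile hN x (c := c)
    (init := fun d => putReal (d + 2) .zero)
    (p := fun d => .seq (e.compile (d + 3))
      (putReal (d + 2) (.add (realCell (d + 2)) (realCell (d + 3)))))
    (fin := fun d => putReal d (realCell (d + 2)))
    (Acc := fun s d i s' => s'.real 10 (d + 2) = ∑ j ∈ Finset.range i, e.eval (s.setVar x j))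
    (Post := fun s d s' => s'.real 10 d = (RExp.sum x N e).eval s)
    (fun s d i s' s'' _ h h' => h.trans h')
    (fun K d s s' => by
      simp only [wp_setReal, NatExp.eval, RealExp.eval]
      exact ⟨frame_writeReal _ _, by simp [Memory.writeReal_real]⟩)
    (fun B s i hB hs hi hiB K d hK s' hf ha => by
      rw [wp_seq]
      refine wp_mono (h B s' hB ((hs.setVar x le_rfl hiB).frame hf) K (d + 3) hK) ?_
      rintro s'' ⟨hf', hr⟩
      simp only [wp_setReal, NatExp.eval, RealExp.eval]
      refine ⟨hf'.mono.writeReal (d + 2) _, ?_⟩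
      simp only [Memory.writeReal_real, if_true, Function.update_self]
      rw [hf'.realStack _ (by omega), ha, hr, RExp.eval_congr hf, Finset.sum_range_succ])
    (fun K d s s' ha => by
      simp only [wp_setReal, NatExp.eval, RealExp.eval]
      exact ⟨frame_writeReal _ _, by simp [Memory.writeReal_real, RExp.eval, ha]⟩)
  exact ⟨c', hc', fun B s hB hs K d hK => by
    simpa only [RExp.compile] using h' B s hB hs K d hK⟩

theorem RExp.correct_zero : RExp.zero.Correct := by
  refine ⟨1, le_rfl, fun B s hB hs K d hK => ?_⟩
  simp only [RExp.compile, wp_setReal, NatExp.eval, RealExp.eval]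
  exact ⟨frame_writeReal _ _, by simp [RExp.eval, Memory.writeReal_real]⟩

theorem RExp.correct_get {e : NExp} (h : e.Correct) (a : ℕ) : (RExp.get a e).Correct := by
  obtain ⟨c, hc, h⟩ := h
  refine ⟨c, hc, fun B s hB hs K d hK => ?_⟩
  simp only [RExp.compile, wp_seq]
  refine wp_mono ((h B s hB hs).2 K d hK) ?_
  rintro s' ⟨hf, hr⟩
  simp only [RExp.eval]
  split_ifs with ha <;> simp only [wp_setReal, NatExp.eval, RealExp.eval]
  · exact ⟨hf.writeReal d _, by simp [Memory.writeReal_real]⟩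
  · exact ⟨hf.writeReal d _, by simp [Memory.writeReal_real, hr, hf.real a ha]⟩

theorem RExp.Correct.add {r₁ r₂ : RExp} (h₁ : r₁.Correct) (h₂ : r₂.Correct) :
    (RExp.add r₁ r₂).Correct :=
  RExp.Correct.binary (P := (RExp.add r₁ r₂).compile)
    (R := fun d s s' => s'.real 10 d = (RExp.add r₁ r₂).eval s) h₁ h₂
    (fun d => by simp only [RExp.compile]; rfl) (fun K d s s' hr₁ hr₂ => by
      simp only [wp_setReal, RealExp.eval, NatExp.eval, hr₁, hr₂, RExp.eval]
      exact ⟨frame_writeReal _ _, by simp [Memory.writeReal_real]⟩)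

theorem RExp.Correct.mul {r₁ r₂ : RExp} (h₁ : r₁.Correct) (h₂ : r₂.Correct) :
    (RExp.mul r₁ r₂).Correct :=
  RExp.Correct.binary (P := (RExp.mul r₁ r₂).compile)
    (R := fun d s s' => s'.real 10 d = (RExp.mul r₁ r₂).eval s) h₁ h₂
    (fun d => by simp only [RExp.compile]; rfl) (fun K d s s' hr₁ hr₂ => by
      simp only [wp_setReal, RealExp.eval, NatExp.eval, hr₁, hr₂, RExp.eval]
      exact ⟨frame_writeReal _ _, by simp [Memory.writeReal_real]⟩)

mutual

theorem NExp.correct : ∀ e : NExp, e.Correct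
  | .const c => NExp.correct_const c
  | .var x => NExp.correct_var x
  | .get a e => (NExp.correct e).get a
  | .add e₁ e₂ => NExp.Correct.binary (f := fun x y => x + y)
      (q := fun d => put d (.add (cell d) (cell (d + 1))))
      (NExp.correct e₁) (NExp.correct e₂) (fun d => by simp only [NExp.compile])
      (fun s => by simp only [NExp.eval]) (fun x y => .inl le_rfl) fun K d s _ _ => by
        simp only [wp_setNat, NatExp.eval]
        exact ⟨frame_writeNat _ _, by simp [Memory.writeNat_nat]⟩
  | .sub e₁ e₂ => NExp.Correct.binary (f := fun x y => x - y)
      (q := fun d => put d (.sub (cell d) (cell (d + 1))))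
      (NExp.correct e₁) (NExp.correct e₂) (fun d => by simp only [NExp.compile])
      (fun s => by simp only [NExp.eval]) (fun x y => .inl (by omega)) fun K d s _ _ => by
        simp only [wp_setNat, NatExp.eval]
        exact ⟨frame_writeNat _ _, by simp [Memory.writeNat_nat]⟩
  | .mul e₁ e₂ => NExp.Correct.binary (f := fun x y => x * y) (q := mulProgram)
      (NExp.correct e₁) (NExp.correct e₂) (fun d => by simp only [NExp.compile])
      (fun s => by simp only [NExp.eval]) (fun x y => .inr le_rfl)
      fun K d s _ h => wp_mulProgram rfl rfl h
  | .div e₁ e₂ => NExp.Correct.binary (f := fun x y => x / y) (q := divProgram)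
      (NExp.correct e₁) (NExp.correct e₂) (fun d => by simp only [NExp.compile])
      (fun s => by simp only [NExp.eval])
      (fun x y => .inl ((Nat.div_le_self x y).trans (Nat.le_add_right x y)))
      fun K d s h _ => wp_divProgram rfl rfl h
  | .leReal r₁ r₂ => NExp.Correct.leReal (RExp.correct r₁) (RExp.correct r₂)
  | .sum x N e => (NExp.correct N).sum (NExp.correct e) x
  | .find x N e => (NExp.correct N).find (NExp.correct e) x
  | .bind x v e => (NExp.correct v).bind (NExp.correct e) x
  | .ite c e₁ e₂ => (NExp.correct c).ite (NExp.correct e₁) (NExp.correct e₂)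

theorem RExp.correct : ∀ r : RExp, r.Correct
  | .zero => RExp.correct_zero
  | .get a e => RExp.correct_get (NExp.correct e) a
  | .add r₁ r₂ => (RExp.correct r₁).add (RExp.correct r₂)
  | .mul r₁ r₂ => (RExp.correct r₁).mul (RExp.correct r₂)
  | .sum x N r => RExp.Correct.sum (NExp.correct N) (RExp.correct r) x
  | .bind x v r => RExp.Correct.bind (NExp.correct v) (RExp.correct r) x
  | .ite c r₁ r₂ => RExp.Correct.ite (NExp.correct c) (RExp.correct r₁) (RExp.correct r₂)

end

end ExtTSP

namespace ExtTSP

/-! ### Filling tables -/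

local infixr:67 " ;; " => Program.seq

/-- The function that agrees with `F` below `N` and vanishes from `N` on. -/
def truncate {β : Type} [Zero β] (N : ℕ) (F : ℕ → β) : ℕ → β := fun i => if i < N then F i else 0

theorem truncate_of_lt {β : Type} [Zero β] {N i : ℕ} (F : ℕ → β) (h : i < N) :
    truncate N F i = F i := if_pos h

theorem truncate_succ {β : Type} [Zero β] (N : ℕ) (F : ℕ → β) :
    truncate (N + 1) F = Function.update (truncate N F) N (F N) := by
  funext i
  rw [Function.update_apply]
  simp only [truncate]
  split_ifs with h1 h2 h3 <;> first | omega | simp_all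

/-- The function with `F y = Φ (F|_{<y}) y`. -/
noncomputable def tabulate {β : Type} [Zero β] (Φ : (ℕ → β) → ℕ → β) (y : ℕ) : β :=
  Φ (fun i => if _h : i < y then tabulate Φ i else 0) y
termination_by y

theorem tabulate_eq {β : Type} [Zero β] (Φ : (ℕ → β) → ℕ → β) (y : ℕ) :
    tabulate Φ y = Φ (truncate y (tabulate Φ)) y := by
  rw [tabulate]
  congr

/-- Sets the variable 1 to the value of `N`, and runs `p` for all values of the variable 0 that are
smaller. -/
noncomputable def fillProgram (N : NExp) (p : Program) : Program :=
  N.compile 0 ;; putVar 1 (cell 0) ;; putVar 0 (.const 0) ;;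
  .loop (.leNat (.add (varCell 0) (.const 1)) (varCell 1))
    (p ;; putVar 0 (.add (varCell 0) (.const 1)))

/-- Writes the value of `e` to cell `y` of the natural-number array `a`, for all `y < N`, where `y`
is the variable 0. -/
noncomputable def fillNat (a : ℕ) (N e : NExp) : Program :=
  fillProgram N (e.compile 0 ;; .setNat a (varCell 0) (cell 0))

/-- Writes the value of `e` to cell `y` of the real array `a`, for all `y < N`, where `y` is the
variable 0. -/
noncomputable def fillReal (a : ℕ) (N : NExp) (e : RExp) : Program :=
  fillProgram N (e.compile 0 ;; .setReal a (varCell 0) (realCell 0))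

/-- The memories agree outside of the stacks and the variables. -/
structure SameData (s s' : Memory) : Prop where
  nat : ∀ a, a ≠ 10 → a ≠ 11 → s'.nat a = s.nat a
  real : ∀ a, a ≠ 10 → s'.real a = s.real a

theorem SameData.trans {s s' s'' : Memory} (h : SameData s s') (h' : SameData s' s'') :
    SameData s s'' :=
  ⟨fun a h1 h2 => (h'.nat a h1 h2).trans (h.nat a h1 h2),
    fun a h1 => (h'.real a h1).trans (h.real a h1)⟩

theorem SameData.symm {s s' : Memory} (h : SameData s s') : SameData s' s :=
  ⟨fun a h1 h2 => (h.nat a h1 h2).symm, fun a h1 => (h.real a h1).symm⟩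

theorem Frame.sameData {d : ℕ} {s s' : Memory} (h : Frame d s s') : SameData s s' :=
  ⟨fun a h1 _ => h.nat a h1, h.real⟩

theorem sameData_setVar (s : Memory) (x v : ℕ) : SameData s (s.setVar x v) :=
  ⟨fun a _ h2 => by simp [Memory.writeNat_nat, h2], fun _ _ => rfl⟩

theorem SameData.writeNat {s s' : Memory} (h : SameData s s') (a i x : ℕ) :
    SameData (s.writeNat a i x) (s'.writeNat a i x) where
  nat b h1 h2 := by
    simp only [Memory.writeNat_nat]
    split_ifs with hb
    · rw [h.nat a (hb ▸ h1) (hb ▸ h2)]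
    · exact h.nat b h1 h2
  real := h.real

theorem SameData.writeReal {s s' : Memory} (h : SameData s s') (a i : ℕ) (x : ℝ) :
    SameData (s.writeReal a i x) (s'.writeReal a i x) where
  nat := h.nat
  real b h1 := by
    simp only [Memory.writeReal_real]
    split_ifs with hb
    · rw [h.real a (hb ▸ h1)]
    · exact h.real b h1

theorem wp_fillProgram (N : NExp) : ∃ c, ∀ (B K : ℕ) (s : Memory) (n : ℕ) (p : Program)
    (S : ℕ → Memory), 2 ≤ B → s.BoundedBy B → B ^ c ≤ K → N.eval s = n → n ≤ B →
    SameData s (S 0) →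
    (∀ y < n, ∀ s', SameData (S y) s' → s'.nat 11 0 = y → s'.BoundedBy B →
      wp K p (fun s'' => SameData (S (y + 1)) s'' ∧ s''.nat 11 = s'.nat 11 ∧ s''.BoundedBy B) s') →
    wp K (fillProgram N p) (fun s' => SameData (S n) s' ∧ s'.BoundedBy B) s := by
  obtain ⟨c, hc, h⟩ := NExp.correct N
  refine ⟨c, fun B K s n p S hB hs hK hN hn hS hstep => ?_⟩
  simp only [fillProgram, wp_seq]
  refine wp_mono ((h B s hB hs).2 K 0 hK) ?_
  rintro s₁ ⟨hf₁, hr₁⟩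
  simp only [wp_setNat, NatExp.eval]
  rw [hr₁, hN]
  have hBK : B ≤ K := (Nat.le_self_pow (by omega) _).trans hK
  refine wp_loop (fun y s' => SameData (S y) s' ∧ s'.nat 11 0 = y ∧ s'.nat 11 1 = n ∧
    s'.BoundedBy B) (hn.trans hBK) ?_ ?_ ?_
  · refine ⟨hS.symm.trans (hf₁.sameData.trans ((sameData_setVar _ _ _).trans
      (sameData_setVar _ _ _))), by simp [Memory.writeNat_nat], by simp [Memory.writeNat_nat],
      ((hs.frame hf₁).setVar 1 le_rfl hn).setVar 0 le_rfl (Nat.zero_le _)⟩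
  · rintro y hy s' ⟨h₁, h₂, h₃, h₄⟩
    refine ⟨by simp only [BoolExp.Holds, NatExp.eval]; omega, ?_⟩
    rw [wp_seq]
    refine wp_mono (hstep y hy s' h₁ h₂ h₄) ?_
    rintro s'' ⟨h₁', h₂', h₄'⟩
    simp only [wp_setNat, NatExp.eval, h₂', h₂]
    exact ⟨h₁'.trans (sameData_setVar _ _ _), by simp [Memory.writeNat_nat],
      by simp [Memory.writeNat_nat, h₂', h₃], h₄'.setVar 0 le_rfl (by omega)⟩
  · rintro s' ⟨h₁, h₂, h₃, h₄⟩
    exact ⟨by simp only [BoolExp.Holds, NatExp.eval]; omega, h₁, h₄⟩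

/-- The memory `s` with the array of natural numbers `a` replaced. -/
def Memory.setNatArray (s : Memory) (a : ℕ) (F : ℕ → ℕ) : Memory :=
  ⟨Function.update s.nat a F, s.real⟩

/-- The memory `s` with the real array `a` replaced. -/
def Memory.setRealArray (s : Memory) (a : ℕ) (F : ℕ → ℝ) : Memory :=
  ⟨s.nat, Function.update s.real a F⟩

theorem wp_fillNat {a : ℕ} (ha : a ≠ 10) (ha' : a ≠ 11) (N e : NExp) :
    ∃ c, ∀ (B K : ℕ) (s : Memory) (n : ℕ) (F : ℕ → ℕ), 2 ≤ B → s.BoundedBy B → B ^ c ≤ K →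
    s.nat a = 0 → N.eval s = n → n ≤ B → (∀ y < n, F y ≤ B) →
    (∀ y < n, ∀ s', SameData (s.setNatArray a (truncate y F)) s' → s'.nat 11 0 = y →
      e.eval s' = F y) →
    wp K (fillNat a N e)
      (fun s' => SameData (s.setNatArray a (truncate n F)) s' ∧ s'.BoundedBy B) s := by
  obtain ⟨c₁, h₁⟩ := wp_fillProgram N
  obtain ⟨c₂, hc₂, h₂⟩ := NExp.correct e
  refine ⟨c₁ + c₂, fun B K s n F hB hs hK ha0 hN hn hFB hF => ?_⟩
  refine h₁ B K s n _ (fun y => s.setNatArray a (truncate y F)) hB hs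
    ((Nat.pow_le_pow_right (by omega) (by omega)).trans hK) hN hn ?_ ?_
  · have : truncate 0 F = s.nat a := by
      rw [ha0]; funext i; simp [truncate]
    simp only [Memory.setNatArray, this, Function.update_eq_self]
    exact (Frame.refl 0 s).sameData
  · intro y hy s' hs' hy' hB'
    rw [wp_seq]
    refine wp_mono ((h₂ B s' hB hB').2 K 0
      ((Nat.pow_le_pow_right (by omega) (by omega)).trans hK)) ?_
    rintro s'' ⟨hf, hr⟩
    have hy'' : s''.nat 11 0 = y := by rw [hf.nat 11 (by decide), hy']
    simp only [wp_setNat, NatExp.eval, hr, hy'', hF y hy s' hs' hy']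
    refine ⟨?_, ?_, ?_⟩
    · have := (hs'.trans hf.sameData).writeNat a y (F y)
      convert this using 1
      simp [Memory.setNatArray, Memory.writeNat, truncate_succ]
    · rw [Memory.writeNat_nat, if_neg (Ne.symm ha'), hf.nat 11 (by decide)]
    · intro b hb i
      rw [Memory.writeNat_nat]
      split_ifs with h
      · rw [Function.update_apply]
        split_ifs
        · exact hFB y hy
        · exact (hB'.frame hf) a ha i
      · exact (hB'.frame hf) b hb i

theorem wp_fillReal (a : ℕ) (N : NExp) (e : RExp) :
    ∃ c, ∀ (B K : ℕ) (s : Memory) (n : ℕ) (F : ℕ → ℝ), 2 ≤ B → s.BoundedBy B → B ^ c ≤ K →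
    s.real a = 0 → N.eval s = n → n ≤ B →
    (∀ y < n, ∀ s', SameData (s.setRealArray a (truncate y F)) s' → s'.nat 11 0 = y →
      e.eval s' = F y) →
    wp K (fillReal a N e)
      (fun s' => SameData (s.setRealArray a (truncate n F)) s' ∧ s'.BoundedBy B) s := by
  obtain ⟨c₁, h₁⟩ := wp_fillProgram N
  obtain ⟨c₂, hc₂, h₂⟩ := RExp.correct e
  refine ⟨c₁ + c₂, fun B K s n F hB hs hK ha0 hN hn hF => ?_⟩
  refine h₁ B K s n _ (fun y => s.setRealArray a (truncate y F)) hB hs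
    ((Nat.pow_le_pow_right (by omega) (by omega)).trans hK) hN hn ?_ ?_
  · have : truncate 0 F = s.real a := by
      rw [ha0]; funext i; simp [truncate]
    simp only [Memory.setRealArray, this, Function.update_eq_self]
    exact (Frame.refl 0 s).sameData
  · intro y hy s' hs' hy' hB'
    rw [wp_seq]
    refine wp_mono (h₂ B s' hB hB' K 0
      ((Nat.pow_le_pow_right (by omega) (by omega)).trans hK)) ?_
    rintro s'' ⟨hf, hr⟩
    have hy'' : s''.nat 11 0 = y := by rw [hf.nat 11 (by decide), hy']
    simp only [wp_setReal, RealExp.eval, NatExp.eval, hr, hy'', hF y hy s' hs' hy']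
    refine ⟨?_, ?_, fun b hb i => hB'.frame hf b hb i⟩
    · have := (hs'.trans hf.sameData).writeReal a y (F y)
      convert this using 1
      simp [Memory.setRealArray, Memory.writeReal, truncate_succ]
    · rw [Memory.writeReal_nat, hf.nat 11 (by decide)]

end ExtTSP

namespace ExtTSP

/-! ### The algorithm -/

/-- The input of the algorithm, with `q = ⌈1 / ε⌉`, and matrices stored row by row. -/
structure Data where
  n : ℕ
  m : ℕ
  k : ℕ
  t : ℕ
  q : ℕ
  tree : ℕ → ℕ
  bag : ℕ → ℕ
  f : ℕ → ℝ
  w : ℕ → ℝ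

namespace Data

variable (D : Data)

/-- The length of the blocks into which the sequencing is cut. A *label* is a sequence of that many
vertices or blanks, encoded as a number by its digits in base `n + 1`. -/
def len : ℕ := D.k * (D.q + 1)

/-- The number of digits of a *state*, the sequence of the labels of the vertices of a bag. -/
def digits : ℕ := D.len * (D.t + 1)

/-- The table of the powers of `n + 1`. -/
def power : ℕ → ℕ := truncate (D.digits + 1) fun i => (D.n + 1) ^ i

/-- The number of states. -/
def card : ℕ := D.power D.digits

/-- The nodes of the tree in an order such that every initial segment is connected. -/
noncomputable def node : ℕ → ℕ := truncate D.m (tabulate fun g r => leastBelow D.m fun c =>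
  (∀ j < r, g j ≠ c) ∧ (r = 0 ∨ ∃ p < r, D.tree (g p * D.m + c) ≠ 0))

/-- The parent of the `r`-th node; it is `r` if `r` is the root. -/
noncomputable def parent (r : ℕ) : ℕ :=
  leastBelow r fun p => D.tree (D.node p * D.m + D.node r) ≠ 0

def InBag (r v : ℕ) : Prop := D.bag (D.node r * D.n + v) ≠ 0

/-- The vertex `v` is in the bag of the parent of the `r`-th node. -/
def InParent (r v : ℕ) : Prop := D.parent r < r ∧ D.InBag (D.parent r) v

open Classical in
/-- The index of `v` among the vertices of the `r`-th bag. -/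
noncomputable def slot (r v : ℕ) : ℕ :=
  ∑ u ∈ Finset.range v, if D.InBag r u then 1 else 0

/-- The label of the vertex `v` in the state `X` of the `r`-th node. -/
noncomputable def label (r X v : ℕ) : ℕ :=
  X / D.power (D.len * D.slot r v) % D.power D.len

/-- The position of the vertex `v` in the sequence with the number `S`. -/
noncomputable def pos (S v : ℕ) : ℕ :=
  leastBelow D.len fun i => S / D.power i % (D.n + 1) = v

open Classical in
/-- The contribution of the pair `u`, `v` if these vertices have labels `S` and `S'`. -/
noncomputable def gain (S S' u v : ℕ) : ℝ :=
  if S = S' ∧ D.pos S u < D.len ∧ D.pos S v < D.len then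
    D.f (Nat.dist (D.pos S u) (D.pos S v)) * D.w (u * D.n + v) else 0

open Classical in
/-- The contribution of the pairs in the `r`-th bag that are not both in the bag of the parent. -/
noncomputable def localValue (r X : ℕ) : ℝ :=
  ∑ u ∈ Finset.range D.n, ∑ v ∈ Finset.range D.n,
    if u < v ∧ D.InBag r u ∧ D.InBag r v ∧ ¬ (D.InParent r u ∧ D.InParent r v) then
      D.gain (D.label r X u) (D.label r X v) u v else 0

/-- The state `X` of the `r`-th node agrees with the state `Y` of its parent `p`. -/
def Agree (r X p Y : ℕ) : Prop :=
  ∀ v < D.n, ¬ (D.InBag r v ∧ D.InParent r v) ∨ D.label r X v = D.label p Y v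

/-- The address of the entry of the main table for the state `X` of the `r`-th node. -/
def address (r X : ℕ) : ℕ := (D.m - 1 - r) * D.card + X

/-- The best state of the `r`-th node that agrees with the state `Y` of its parent `p`. -/
noncomputable def best (A : ℕ → ℝ) (r p Y : ℕ) : ℕ := leastBelow D.card fun X =>
  D.Agree r X p Y ∧ ∀ Z < D.card, ¬ D.Agree r Z p Y ∨ A (D.address r Z) ≤ A (D.address r X)

open Classical in
/-- The right-hand side of the recursion for the main table. -/
noncomputable def tableStep (A : ℕ → ℝ) (r X : ℕ) : ℝ :=
  D.localValue r X + ∑ r' ∈ Finset.range D.m,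
    if r < r' ∧ D.parent r' = r then A (D.address r' (D.best A r' r X)) else 0

/-- The main table of the dynamic program. -/
noncomputable def table : ℕ → ℝ := truncate (D.m * D.card) (tabulate fun A y =>
  D.tableStep A (D.m - 1 - y / D.card) (y % D.card))

/-- The states that the algorithm chooses. -/
noncomputable def choice : ℕ → ℕ := truncate D.m (tabulate fun g r =>
  D.best D.table r (D.parent r) (g (D.parent r)))

/-- The first bag that contains `v`. -/
noncomputable def home (v : ℕ) : ℕ := leastBelow D.m fun r => D.InBag r v

/-- The label that the algorithm chooses for the vertex `v`. -/
noncomputable def assigned (v : ℕ) : ℕ := D.label (D.home v) (D.choice (D.home v)) v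

/-- The vertices are sorted by their keys. -/
noncomputable def key (v : ℕ) : ℕ :=
  (D.assigned v * (D.len + 1) + D.pos (D.assigned v) v) * D.n + v

open Classical in
noncomputable def output (v : ℕ) : ℕ :=
  1 + ∑ u ∈ Finset.range D.n, if D.key u < D.key v then 1 else 0

end Data

/-! ### Expressions for the algorithm

Every bound variable has a name of its own. -/

namespace NExp

def lt (a b : NExp) : NExp := sub b a
def not (a : NExp) : NExp := sub (const 1) a
def and (a b : NExp) : NExp := mul a b
def or (a b : NExp) : NExp := add a b
def eq (a b : NExp) : NExp := not (add (sub a b) (sub b a))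
def all (x : ℕ) (N e : NExp) : NExp := not (sum x N (not e))
def ex (x : ℕ) (N e : NExp) : NExp := sum x N e
def mod (a b : NExp) : NExp := sub a (mul b (div a b))

variable (a b e : NExp) (x : ℕ) (s : Memory)

theorem lt_ne_zero : (lt a b).eval s ≠ 0 ↔ a.eval s < b.eval s := by
  simp only [lt, eval]; omega

theorem not_ne_zero : (not a).eval s ≠ 0 ↔ ¬ a.eval s ≠ 0 := by
  simp only [not, eval]; omega

theorem and_ne_zero : (and a b).eval s ≠ 0 ↔ a.eval s ≠ 0 ∧ b.eval s ≠ 0 := by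
  simp only [and, eval, ne_eq, mul_eq_zero, not_or]

theorem or_ne_zero : (or a b).eval s ≠ 0 ↔ a.eval s ≠ 0 ∨ b.eval s ≠ 0 := by
  simp only [or, eval]; omega

theorem eq_ne_zero : (eq a b).eval s ≠ 0 ↔ a.eval s = b.eval s := by
  simp only [eq, not, eval]; omega

theorem ex_ne_zero :
    (ex x a e).eval s ≠ 0 ↔ ∃ i < a.eval s, e.eval (s.setVar x i) ≠ 0 := by
  simp [ex, eval, Finset.sum_eq_zero_iff]

theorem all_ne_zero :
    (all x a e).eval s ≠ 0 ↔ ∀ i < a.eval s, e.eval (s.setVar x i) ≠ 0 := by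
  simp only [all, not_ne_zero, eval, Finset.sum_eq_zero_iff, ne_eq, Finset.mem_range, not_not]
  exact forall₂_congr fun i _ => by simpa using not_congr (not_ne_zero e (s.setVar x i))

theorem leReal_ne_zero (r₁ r₂ : RExp) : (leReal r₁ r₂).eval s ≠ 0 ↔ r₁.eval s ≤ r₂.eval s := by
  simp [eval]

theorem eval_mod : (mod a b).eval s = a.eval s % b.eval s := by
  simp only [mod, eval]
  have := Nat.div_add_mod (a.eval s) (b.eval s)
  omega

end NExp

open NExp in
section

def nExp : NExp := get 0 (const 0)
def mExp : NExp := get 0 (const 1)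
def lenExp : NExp := mul (get 0 (const 2)) (add (get 4 (const 0)) (const 1))
def digitsExp : NExp := mul lenExp (add (get 0 (const 3)) (const 1))
def cardExp : NExp := get 5 digitsExp

def powerExp : NExp :=
  ite (var 0) (mul (get 5 (sub (var 0) (const 1))) (add nExp (const 1))) (const 1)

def nodeExp : NExp := find 2 mExp (and (all 3 (var 0) (not (eq (get 6 (var 3)) (var 2))))
  (or (not (var 0)) (ex 3 (var 0) (get 1 (add (mul (get 6 (var 3)) mExp) (var 2))))))

def parentExp (r : ℕ) : NExp :=
  find 2 (var r) (get 1 (add (mul (get 6 (var 2)) mExp) (get 6 (var r))))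

def inBagExp (r v : ℕ) : NExp := get 2 (add (mul (get 6 (var r)) nExp) (var v))

def inParentExp (r v : ℕ) : NExp :=
  bind 3 (parentExp r) (and (lt (var 3) (var r)) (inBagExp 3 v))

def slotExp (r v : ℕ) : NExp := sum 4 (var v) (ite (inBagExp r 4) (const 1) (const 0))

def labelExp (r X v : ℕ) : NExp :=
  bind 5 (slotExp r v) (mod (div (var X) (get 5 (mul lenExp (var 5)))) (get 5 lenExp))

def posExp (S v : ℕ) : NExp :=
  find 6 lenExp (eq (mod (div (var S) (get 5 (var 6))) (add nExp (const 1))) (var v))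

def gainExp (S S' u v : ℕ) : RExp := .bind 7 (posExp S u) <| .bind 8 (posExp S v) <|
  .ite (and (eq (var S) (var S')) (and (lt (var 7) lenExp) (lt (var 8) lenExp)))
    (.mul (.get 1 (add (sub (var 7) (var 8)) (sub (var 8) (var 7))))
      (.get 2 (add (mul (var u) nExp) (var v)))) .zero

def localValueExp (r X : ℕ) : RExp := .sum 9 nExp <| .sum 10 nExp <|
  .ite (and (lt (var 9) (var 10)) (and (inBagExp r 9) (and (inBagExp r 10)
    (not (and (inParentExp r 9) (inParentExp r 10))))))
    (.bind 11 (labelExp r X 9) <| .bind 12 (labelExp r X 10) <| gainExp 11 12 9 10) .zero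

def agreeExp (r X p Y : ℕ) : NExp := all 13 nExp <|
  or (not (and (inBagExp r 13) (inParentExp r 13))) (eq (labelExp r X 13) (labelExp p Y 13))

def addressExp (r X : ℕ) : NExp :=
  add (mul (sub (sub mExp (const 1)) (var r)) cardExp) (var X)

def bestExp (r p Y : ℕ) : NExp := find 14 cardExp <| and (agreeExp r 14 p Y) <|
  all 15 cardExp <| or (not (agreeExp r 15 p Y))
    (leReal (.get 3 (addressExp r 15)) (.get 3 (addressExp r 14)))

def tableExp : RExp := .bind 16 (sub (sub mExp (const 1)) (div (var 0) cardExp)) <|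
  .bind 17 (mod (var 0) cardExp) <| .add (localValueExp 16 17) <| .sum 18 mExp <|
    .ite (and (lt (var 16) (var 18)) (eq (parentExp 18) (var 16)))
      (.bind 19 (bestExp 18 16 17) <| .get 3 (addressExp 18 19)) .zero

def choiceExp : NExp := bind 20 (parentExp 0) <| bind 21 (get 7 (var 20)) <| bestExp 0 20 21

def keyExp (v : ℕ) : NExp := bind 22 (find 23 mExp (inBagExp 23 v)) <|
  bind 24 (get 7 (var 22)) <| bind 25 (labelExp 22 24 v) <|
    add (mul (add (mul (var 25) (add lenExp (const 1))) (posExp 25 v)) nExp) (var v)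

def outputExp : NExp :=
  add (const 1) (sum 26 nExp (ite (lt (keyExp 26) (keyExp 0)) (const 1) (const 0)))

end

/-- The memory contains the input data. -/
structure Input (D : Data) (s : Memory) : Prop where
  n : s.nat 0 0 = D.n
  m : s.nat 0 1 = D.m
  k : s.nat 0 2 = D.k
  t : s.nat 0 3 = D.t
  q : s.nat 4 0 = D.q
  tree : s.nat 1 = D.tree
  bag : s.nat 2 = D.bag
  f : s.real 1 = D.f
  w : s.real 2 = D.w

/-- The memory contains the input data and the auxiliary tables. -/
structure Prepared (D : Data) (s : Memory) : Prop extends Input D s where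
  power : s.nat 5 = D.power
  node : s.nat 6 = D.node

theorem Input.sameData {D : Data} {s s' : Memory} (h : Input D s) (h' : SameData s s') :
    Input D s' where
  n := by rw [h'.nat 0 (by decide) (by decide), h.n]
  m := by rw [h'.nat 0 (by decide) (by decide), h.m]
  k := by rw [h'.nat 0 (by decide) (by decide), h.k]
  t := by rw [h'.nat 0 (by decide) (by decide), h.t]
  q := by rw [h'.nat 4 (by decide) (by decide), h.q]
  tree := by rw [h'.nat 1 (by decide) (by decide), h.tree]
  bag := by rw [h'.nat 2 (by decide) (by decide), h.bag]
  f := by rw [h'.real 1 (by decide), h.f]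
  w := by rw [h'.real 2 (by decide), h.w]

theorem Prepared.sameData {D : Data} {s s' : Memory} (h : Prepared D s) (h' : SameData s s') :
    Prepared D s' where
  toInput := h.toInput.sameData h'
  power := by rw [h'.nat 5 (by decide) (by decide), h.power]
  node := by rw [h'.nat 6 (by decide) (by decide), h.node]

theorem Prepared.setVar {D : Data} {s : Memory} (h : Prepared D s) (x v : ℕ) :
    Prepared D (s.setVar x v) := h.sameData (sameData_setVar s x v)

theorem Input.setVar {D : Data} {s : Memory} (h : Input D s) (x v : ℕ) :
    Input D (s.setVar x v) := h.sameData (sameData_setVar s x v)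

@[simp] theorem Memory.setVar_nat_self (s : Memory) (x v : ℕ) :
    (s.setVar x v).nat 11 x = v := by simp [Memory.writeNat_nat]

theorem Memory.setVar_nat_of_ne (s : Memory) {x y : ℕ} (v : ℕ) (h : y ≠ x) :
    (s.setVar x v).nat 11 y = s.nat 11 y := by simp [Memory.writeNat_nat, h]

section eval

variable {D : Data} {s : Memory}

theorem Input.eval_n (h : Input D s) : nExp.eval s = D.n := by simp [nExp, NExp.eval, h.n]
theorem Input.eval_m (h : Input D s) : mExp.eval s = D.m := by simp [mExp, NExp.eval, h.m]
theorem Input.eval_len (h : Input D s) : lenExp.eval s = D.len := by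
  simp [lenExp, NExp.eval, h.k, h.q, Data.len]
theorem Input.eval_digits (h : Input D s) : digitsExp.eval s = D.digits := by
  simp [digitsExp, NExp.eval, h.eval_len, h.t, Data.digits]
theorem Prepared.eval_card (h : Prepared D s) : cardExp.eval s = D.card := by
  simp [cardExp, NExp.eval, h.eval_digits, h.power, Data.card]

theorem Prepared.eval_parent (h : Prepared D s) {r : ℕ} (hr : r ≠ 2) :
    (parentExp r).eval s = D.parent (s.nat 11 r) := by
  simp [parentExp, NExp.eval, Data.parent, (h.setVar _ _).eval_m, (h.setVar _ _).tree,
    (h.setVar _ _).node, Memory.setVar_nat_of_ne, hr]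

theorem Prepared.inBag (h : Prepared D s) (r v : ℕ) :
    (inBagExp r v).eval s ≠ 0 ↔ D.InBag (s.nat 11 r) (s.nat 11 v) := by
  simp [inBagExp, NExp.eval, Data.InBag, h.eval_n, h.bag, h.node]

theorem Prepared.inParent (h : Prepared D s) {r v : ℕ} (hr : r ≠ 2) (hr' : r ≠ 3) (hv : v ≠ 3) :
    (inParentExp r v).eval s ≠ 0 ↔ D.InParent (s.nat 11 r) (s.nat 11 v) := by
  rw [inParentExp, NExp.eval, NExp.and_ne_zero, NExp.lt_ne_zero, (h.setVar _ _).inBag,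
    h.eval_parent hr]
  simp [NExp.eval, Data.InParent, Memory.setVar_nat_of_ne, hr', hv]

theorem Prepared.eval_slot (h : Prepared D s) {r v : ℕ} (hr : r ≠ 4) :
    (slotExp r v).eval s = D.slot (s.nat 11 r) (s.nat 11 v) := by
  classical
  simp only [slotExp, NExp.eval, Data.slot]
  refine Finset.sum_congr rfl fun i _ => if_congr ?_ rfl rfl
  rw [(h.setVar _ _).inBag, Memory.setVar_nat_self, Memory.setVar_nat_of_ne _ _ hr]

theorem Prepared.eval_label (h : Prepared D s) {r X v : ℕ} (hr : r ≠ 4) (hX : X ≠ 5) :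
    (labelExp r X v).eval s = D.label (s.nat 11 r) (s.nat 11 X) (s.nat 11 v) := by
  simp [labelExp, NExp.eval, NExp.eval_mod, Data.label, h.eval_slot hr, (h.setVar _ _).eval_len,
    (h.setVar _ _).power, Memory.setVar_nat_of_ne, hX]

theorem Prepared.eval_pos (h : Prepared D s) {S v : ℕ} (hS : S ≠ 6) (hv : v ≠ 6) :
    (posExp S v).eval s = D.pos (s.nat 11 S) (s.nat 11 v) := by
  simp only [posExp, NExp.eval, NExp.eq_ne_zero, NExp.eval_mod, Data.pos, h.eval_len,
    (h.setVar _ _).eval_n, (h.setVar _ _).power, Memory.setVar_nat_of_ne _ _ hS,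
    Memory.setVar_nat_of_ne _ _ hv, Memory.setVar_nat_self]
  simp

theorem Prepared.eval_gain (h : Prepared D s) {S S' u v : ℕ} (hS : 8 < S) (hS' : 8 < S')
    (hu : 8 < u) (hv : 8 < v) : (gainExp S S' u v).eval s =
      D.gain (s.nat 11 S) (s.nat 11 S') (s.nat 11 u) (s.nat 11 v) := by
  have ne : ∀ {x y}, y ≤ 8 → 8 < x → x ≠ y := fun h h' => by omega
  simp only [gainExp, RExp.eval, NExp.and_ne_zero, NExp.eq_ne_zero, NExp.lt_ne_zero, Data.gain,
    NExp.eval, h.eval_pos (show S ≠ 6 by omega) (show u ≠ 6 by omega),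
    (h.setVar _ _).eval_pos (show S ≠ 6 by omega) (show v ≠ 6 by omega),
    ((h.setVar _ _).setVar _ _).eval_len, ((h.setVar _ _).setVar _ _).eval_n,
    ((h.setVar _ _).setVar _ _).f, ((h.setVar _ _).setVar _ _).w, Memory.setVar_nat_self,
    Memory.setVar_nat_of_ne _ _ (show (7 : ℕ) ≠ 8 by decide),
    Memory.setVar_nat_of_ne _ _ (ne (le_refl 8) hS), Memory.setVar_nat_of_ne _ _ (ne (le_refl 8) hS'),
    Memory.setVar_nat_of_ne _ _ (ne (le_refl 8) hu), Memory.setVar_nat_of_ne _ _ (ne (le_refl 8) hv),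
    Memory.setVar_nat_of_ne _ _ (ne (show 7 ≤ 8 by decide) hS),
    Memory.setVar_nat_of_ne _ _ (ne (show 7 ≤ 8 by decide) hS'),
    Memory.setVar_nat_of_ne _ _ (ne (show 7 ≤ 8 by decide) hu),
    Memory.setVar_nat_of_ne _ _ (ne (show 7 ≤ 8 by decide) hv)]
  simp [Nat.dist]

theorem Prepared.eval_localValue (h : Prepared D s) {r X : ℕ} (hr : 12 < r) (hX : 12 < X) :
    (localValueExp r X).eval s = D.localValue (s.nat 11 r) (s.nat 11 X) := by
  classical
  have ne : ∀ {x y}, y ≤ 12 → 12 < x → x ≠ y := fun h h' => by omega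
  have hr9 := ne (show 9 ≤ 12 by decide) hr
  have hr10 := ne (show 10 ≤ 12 by decide) hr
  simp only [localValueExp, RExp.eval, Data.localValue, h.eval_n, (h.setVar _ _).eval_n]
  refine Finset.sum_congr rfl fun u _ => Finset.sum_congr rfl fun v _ => if_congr ?_ ?_ rfl
  · have h₁ := (h.setVar 9 u).setVar 10 v
    rw [NExp.and_ne_zero, NExp.and_ne_zero, NExp.and_ne_zero, NExp.not_ne_zero, NExp.and_ne_zero,
      NExp.lt_ne_zero, h₁.inBag, h₁.inBag, h₁.inParent (by omega) (by omega) (by omega),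
      h₁.inParent (by omega) (by omega) (by omega)]
    simp [NExp.eval, Memory.setVar_nat_of_ne, hr9, hr10]
  · have h₁ := (h.setVar 9 u).setVar 10 v
    rw [((h₁.setVar _ _).setVar _ _).eval_gain (by decide) (by decide) (by decide) (by decide),
      (h₁.setVar _ _).eval_label (by omega) (by omega), h₁.eval_label (by omega) (by omega)]
    simp [Memory.setVar_nat_of_ne, hr9, hr10, ne (show 9 ≤ 12 by decide) hX,
      ne (show 10 ≤ 12 by decide) hX, ne (show 11 ≤ 12 by decide) hX,
      ne (show 11 ≤ 12 by decide) hr]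

theorem Prepared.agree (h : Prepared D s) {r X p Y : ℕ} (hr : r ∉ [2, 3, 4, 13])
    (hX : X ∉ [5, 13]) (hp : p ∉ [4, 13]) (hY : Y ∉ [5, 13]) : (agreeExp r X p Y).eval s ≠ 0 ↔
      D.Agree (s.nat 11 r) (s.nat 11 X) (s.nat 11 p) (s.nat 11 Y) := by
  simp only [List.mem_cons, List.not_mem_nil, or_false, not_or] at hr hX hp hY
  rw [agreeExp, NExp.all_ne_zero, h.eval_n]
  refine forall₂_congr fun v _ => ?_
  have h₁ := h.setVar 13 v
  rw [NExp.or_ne_zero, NExp.not_ne_zero, NExp.and_ne_zero, NExp.eq_ne_zero, h₁.inBag,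
    h₁.inParent hr.1 hr.2.1 (by decide), h₁.eval_label hr.2.2.1 hX.1, h₁.eval_label hp.1 hY.1]
  simp [Memory.setVar_nat_of_ne, hr, hX, hp, hY]

theorem Prepared.eval_address (h : Prepared D s) (r X : ℕ) :
    (addressExp r X).eval s = D.address (s.nat 11 r) (s.nat 11 X) := by
  simp [addressExp, NExp.eval, h.eval_m, h.eval_card, Data.address]

theorem Prepared.eval_best (h : Prepared D s) {r p Y : ℕ} (hr : r ∉ [2, 3, 4, 13, 14, 15])
    (hp : p ∉ [4, 13, 14, 15]) (hY : Y ∉ [5, 13, 14, 15]) : (bestExp r p Y).eval s =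
      D.best (s.real 3) (s.nat 11 r) (s.nat 11 p) (s.nat 11 Y) := by
  simp only [List.mem_cons, List.not_mem_nil, or_false, not_or] at hr hp hY
  simp only [bestExp, NExp.eval, h.eval_card, Data.best]
  congr 1
  funext X
  have h₁ := h.setVar 14 X
  rw [NExp.and_ne_zero, NExp.all_ne_zero, h₁.eval_card, h₁.agree (by simp [hr]) (by decide)
    (by simp [hp]) (by simp [hY])]
  refine propext (and_congr ?_ (forall₂_congr fun Z _ => ?_))
  · simp [Memory.setVar_nat_of_ne, hr, hp, hY]
  · have h₂ := h₁.setVar 15 Z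
    rw [NExp.or_ne_zero, NExp.not_ne_zero, NExp.leReal_ne_zero, h₂.agree (by simp [hr])
      (by decide) (by simp [hp]) (by simp [hY])]
    simp [RExp.eval, h₂.eval_address, Memory.setVar_nat_of_ne, hr, hp, hY]

theorem Prepared.eval_table (h : Prepared D s) : tableExp.eval s =
    D.tableStep (s.real 3) (D.m - 1 - s.nat 11 0 / D.card) (s.nat 11 0 % D.card) := by
  have h₁ := (h.setVar 16 (D.m - 1 - s.nat 11 0 / D.card)).setVar 17 (s.nat 11 0 % D.card)
  simp only [tableExp, RExp.eval, NExp.eval, NExp.eval_mod, h.eval_m, h.eval_card,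
    (h.setVar _ _).eval_card, Memory.setVar_nat_of_ne _ _ (show (0 : ℕ) ≠ 16 by decide),
    h₁.eval_localValue (show 12 < 16 by decide) (show 12 < 17 by decide), h₁.eval_m,
    Data.tableStep]
  congr 1
  refine Finset.sum_congr rfl fun r _ => if_congr ?_ ?_ rfl
  · rw [NExp.and_ne_zero, NExp.lt_ne_zero, NExp.eq_ne_zero, (h₁.setVar _ _).eval_parent (by decide)]
    simp [NExp.eval, Memory.setVar_nat_of_ne]
  · rw [if_neg (by decide), ((h₁.setVar _ _).setVar _ _).eval_address,
      (h₁.setVar _ _).eval_best (by decide) (by decide) (by decide)]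
    simp [Memory.setVar_nat_of_ne]

theorem Prepared.eval_choice (h : Prepared D s) : choiceExp.eval s =
    D.best (s.real 3) (s.nat 11 0) (D.parent (s.nat 11 0)) (s.nat 7 (D.parent (s.nat 11 0))) := by
  simp only [choiceExp, NExp.eval]
  rw [((h.setVar _ _).setVar _ _).eval_best (by decide) (by decide) (by decide),
    h.eval_parent (by decide)]
  simp [Memory.setVar_nat_of_ne, Memory.writeNat_nat]

theorem Prepared.eval_key (h : Prepared D s) (hc : s.nat 7 = D.choice) {v : ℕ}
    (hv : v ∉ [6, 22, 23, 24, 25]) : (keyExp v).eval s = D.key (s.nat 11 v) := by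
  simp only [List.mem_cons, List.not_mem_nil, or_false, not_or] at hv
  have hh : (NExp.find 23 mExp (inBagExp 23 v)).eval s = D.home (s.nat 11 v) := by
    simp only [NExp.eval, h.eval_m, Data.home]
    congr 1
    funext r
    rw [(h.setVar _ _).inBag]
    simp [Memory.setVar_nat_of_ne, hv]
  have h₁ := (h.setVar 22 (D.home (s.nat 11 v))).setVar 24 (D.choice (D.home (s.nat 11 v)))
  rw [keyExp, NExp.eval, hh]
  simp only [NExp.eval, Memory.setVar_nat_self]
  rw [if_neg (by decide), Memory.writeNat_nat, if_neg (by decide), hc,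
    h₁.eval_label (by decide) (by decide), (h₁.setVar _ _).eval_pos (by decide) hv.1,
    (h₁.setVar _ _).eval_len, (h₁.setVar _ _).eval_n]
  simp [Memory.setVar_nat_of_ne, hv, Data.key, Data.assigned]

theorem Prepared.eval_output (h : Prepared D s) (hc : s.nat 7 = D.choice) :
    outputExp.eval s = D.output (s.nat 11 0) := by
  simp only [outputExp, NExp.eval, h.eval_n, Data.output]
  congr 1
  refine Finset.sum_congr rfl fun u _ => if_congr ?_ rfl rfl
  have hc' : (s.setVar 26 u).nat 7 = D.choice := by simp [Memory.writeNat_nat, hc]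
  rw [NExp.lt_ne_zero, (h.setVar _ _).eval_key hc' (by decide),
    (h.setVar _ _).eval_key hc' (by decide)]
  simp [Memory.setVar_nat_of_ne]

theorem Input.eval_power (h : Input D s) {y : ℕ}
    (hp : s.nat 5 = truncate y fun i => (D.n + 1) ^ i) (hy : s.nat 11 0 = y) :
    powerExp.eval s = (D.n + 1) ^ y := by
  simp only [powerExp, NExp.eval, hy, h.eval_n, hp]
  rcases Nat.eq_zero_or_pos y with rfl | hy
  · simp
  · rw [if_pos (by omega), if_neg (by omega), truncate_of_lt _ (by omega), ← pow_succ]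
    congr 1
    omega

theorem Input.eval_node (h : Input D s) : nodeExp.eval s = leastBelow D.m fun c =>
    (∀ j < s.nat 11 0, s.nat 6 j ≠ c) ∧
      (s.nat 11 0 = 0 ∨ ∃ p < s.nat 11 0, D.tree (s.nat 6 p * D.m + c) ≠ 0) := by
  simp only [nodeExp, NExp.eval, h.eval_m]
  congr 1
  funext c
  rw [NExp.and_ne_zero, NExp.or_ne_zero, NExp.all_ne_zero, NExp.not_ne_zero, NExp.ex_ne_zero]
  refine propext (and_congr ?_ (or_congr ?_ ?_))
  · simp [NExp.eval, NExp.not_ne_zero, NExp.eq_ne_zero, Memory.setVar_nat_of_ne,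
      Memory.writeNat_nat]
  · simp [NExp.eval, Memory.setVar_nat_of_ne]
  · simp [NExp.eval, ((h.setVar _ _).setVar _ _).eval_m, Memory.setVar_nat_of_ne,
      ((h.setVar _ _).setVar _ _).tree, Memory.writeNat_nat]

end eval

end ExtTSP

namespace ExtTSP

/-! ### The program -/

local infixr:67 " ;; " => Program.seq

/-- Computes `⌈1 / ε⌉`. -/
def ceilProgram : Program :=
  .loop (.neg (.leReal .one (.get 4 (.const 0))))
    (.setReal 4 (.const 0) (.add (.get 4 (.const 0)) (.get 0 (.const 0))) ;;
      .setNat 4 (.const 0) (.add (.get 4 (.const 0)) (.const 1)))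

/-- The algorithm for at least two vertices. -/
noncomputable def solveProgram : Program :=
  ceilProgram ;; fillNat 5 (.add digitsExp (.const 1)) powerExp ;; fillNat 6 mExp nodeExp ;;
  fillReal 3 (.mul mExp cardExp) tableExp ;; fillNat 7 mExp choiceExp ;; fillNat 3 nExp outputExp

noncomputable def mainProgram : Program :=
  .ite (.leNat (.get 0 (.const 0)) (.const 1)) (.setNat 3 (.const 0) (.const 1)) solveProgram

/-- The memory contains the input and is otherwise empty. -/
structure Start (D : Data) (ε : ℝ) (s : Memory) : Prop where
  n : s.nat 0 0 = D.n
  m : s.nat 0 1 = D.m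
  k : s.nat 0 2 = D.k
  t : s.nat 0 3 = D.t
  tree : s.nat 1 = D.tree
  bag : s.nat 2 = D.bag
  f : s.real 1 = D.f
  w : s.real 2 = D.w
  eps : s.real 0 0 = ε
  nat_eq_zero : ∀ a, 3 ≤ a → s.nat a = 0
  real_eq_zero : ∀ a, 3 ≤ a → s.real a = 0

/-- The memories agree up to the arrays number 4. -/
structure SameButFour (s s' : Memory) : Prop where
  nat : ∀ a, a ≠ 4 → s'.nat a = s.nat a
  real : ∀ a, a ≠ 4 → s'.real a = s.real a

theorem wp_ceilProgram {D : Data} {ε : ℝ} {s : Memory} {B K : ℕ} (h : Start D ε s) (hε : 0 < ε)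
    (hq : D.q = ⌈1 / ε⌉₊) (hs : s.BoundedBy B) (hqB : D.q ≤ B) (hK : B ≤ K) :
    wp K ceilProgram
      (fun s' => SameButFour s s' ∧ s'.nat 4 0 = D.q ∧ s'.BoundedBy B) s := by
  refine wp_loop (N := D.q) (fun i s' => SameButFour s s' ∧ s'.nat 4 0 = i ∧
    s'.BoundedBy B ∧ s'.real 4 0 = i * ε) (hqB.trans hK) ?_ ?_ ?_
  · exact ⟨⟨fun _ _ => rfl, fun _ _ => rfl⟩, by simp [h.nat_eq_zero], hs,
      by simp [h.real_eq_zero]⟩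
  · rintro i hi s' ⟨h₁, h₂, h₃, h₄⟩
    have hε' : s'.real 0 0 = ε := by rw [h₁.real 0 (by decide), h.eps]
    refine ⟨?_, ?_⟩
    · simp only [BoolExp.Holds, RealExp.eval, NatExp.eval, h₄, not_le]
      rw [hq] at hi
      exact (lt_div_iff₀ hε).1 (Nat.lt_ceil.1 hi)
    · simp only [wp_seq, wp_setNat, wp_setReal, NatExp.eval, RealExp.eval]
      refine ⟨⟨fun a ha => ?_, fun a ha => ?_⟩, ?_, fun a ha j => ?_, ?_⟩
      · simp [Memory.writeNat_nat, ha, h₁.nat a ha]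
      · simp [Memory.writeReal_real, ha, h₁.real a ha]
      · simp [Memory.writeNat_nat, h₂]
      · rw [Memory.writeNat_nat]
        split_ifs with ha'
        · rw [Function.update_apply]
          split_ifs
          · simp only [Memory.writeReal_nat, h₂]; omega
          · exact h₃ 4 (by decide) j
        · exact h₃ a ha j
      · simp [Memory.writeReal_real, h₄, hε']
        ring
  · rintro s' ⟨h₁, h₂, h₃, h₄⟩
    refine ⟨?_, h₁, h₂, h₃⟩
    simp only [BoolExp.Holds, RealExp.eval, NatExp.eval, h₄, not_not]
    rw [← div_le_iff₀ hε, hq]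
    exact Nat.le_ceil _

theorem Start.input {D : Data} {ε : ℝ} {s s' : Memory} (h : Start D ε s)
    (h' : SameButFour s s') (hq : s'.nat 4 0 = D.q) : Input D s' where
  n := by rw [h'.nat 0 (by decide), h.n]
  m := by rw [h'.nat 0 (by decide), h.m]
  k := by rw [h'.nat 0 (by decide), h.k]
  t := by rw [h'.nat 0 (by decide), h.t]
  q := hq
  tree := by rw [h'.nat 1 (by decide), h.tree]
  bag := by rw [h'.nat 2 (by decide), h.bag]
  f := by rw [h'.real 1 (by decide), h.f]
  w := by rw [h'.real 2 (by decide), h.w]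

theorem Input.setNatArray {D : Data} {s : Memory} (h : Input D s) {a : ℕ} (ha : 5 ≤ a)
    (F : ℕ → ℕ) : Input D (s.setNatArray a F) := by
  have ne : ∀ b ≤ 4, b ≠ a := fun b hb => by omega
  constructor <;> simp [Memory.setNatArray, ne, h.n, h.m, h.k, h.t, h.q, h.tree, h.bag, h.f, h.w]

theorem Input.setRealArray {D : Data} {s : Memory} (h : Input D s) {a : ℕ} (ha : 3 ≤ a)
    (F : ℕ → ℝ) : Input D (s.setRealArray a F) := by
  have ne : ∀ b ≤ 2, b ≠ a := fun b hb => by omega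
  constructor <;> simp [Memory.setRealArray, ne, h.n, h.m, h.k, h.t, h.q, h.tree, h.bag, h.f, h.w]

theorem Prepared.setNatArray {D : Data} {s : Memory} (h : Prepared D s) {a : ℕ} (ha : 7 ≤ a)
    (F : ℕ → ℕ) : Prepared D (s.setNatArray a F) where
  toInput := h.toInput.setNatArray (by omega) F
  power := by simp [Memory.setNatArray, (show 5 ≠ a by omega), h.power]
  node := by simp [Memory.setNatArray, (show 6 ≠ a by omega), h.node]

theorem Prepared.setRealArray {D : Data} {s : Memory} (h : Prepared D s) {a : ℕ} (ha : 3 ≤ a)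
    (F : ℕ → ℝ) : Prepared D (s.setRealArray a F) where
  toInput := h.toInput.setRealArray ha F
  power := h.power
  node := h.node

theorem Data.output_le (D : Data) (v : ℕ) : D.output v ≤ 1 + D.n := by
  classical
  rw [Data.output, ← Finset.card_filter]
  exact Nat.add_le_add_left ((Finset.card_filter_le _ _).trans (by simp)) _

theorem Data.card_eq (D : Data) : D.card = (D.n + 1) ^ D.digits :=
  truncate_of_lt _ (Nat.lt_succ_self _)

theorem wp_solveProgram : ∃ c, ∀ (B K : ℕ) (s : Memory) (D : Data) (ε : ℝ), 2 ≤ B →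
    s.BoundedBy B → B ^ c ≤ K → Start D ε s → 0 < ε → D.q = ⌈1 / ε⌉₊ → D.q ≤ B →
    D.digits + 1 ≤ B → D.n + 1 ≤ B → 1 ≤ D.m → D.m * (D.n + 1) ^ D.digits ≤ B →
    wp K solveProgram (fun s' => ∀ v < D.n, s'.nat 3 v = D.output v) s := by
  obtain ⟨c₁, h₁⟩ := wp_fillNat (a := 5) (by decide) (by decide) (.add digitsExp (.const 1))
    powerExp
  obtain ⟨c₂, h₂⟩ := wp_fillNat (a := 6) (by decide) (by decide) mExp nodeExp
  obtain ⟨c₃, h₃⟩ := wp_fillReal 3 (.mul mExp cardExp) tableExp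
  obtain ⟨c₄, h₄⟩ := wp_fillNat (a := 7) (by decide) (by decide) mExp choiceExp
  obtain ⟨c₅, h₅⟩ := wp_fillNat (a := 3) (by decide) (by decide) nExp outputExp
  refine ⟨1 + c₁ + c₂ + c₃ + c₄ + c₅, fun B K s D ε hB hs hK hD hε hq hqB hdB hnB hm hcB => ?_⟩
  have hK' : ∀ c ≤ 1 + c₁ + c₂ + c₃ + c₄ + c₅, B ^ c ≤ K := fun c hc =>
    (Nat.pow_le_pow_right (by omega) hc).trans hK
  have hcB' : (D.n + 1) ^ D.digits ≤ B := (Nat.le_mul_of_pos_left _ hm).trans hcB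
  have hmB : D.m ≤ B := (Nat.le_mul_of_pos_right _ (by positivity)).trans hcB
  simp only [solveProgram, wp_seq]
  refine wp_mono (wp_ceilProgram hD hε hq hs hqB (by simpa using hK' 1 (by omega))) ?_
  rintro s₀ ⟨e₀, hq₀, b₀⟩
  have i₀ := hD.input e₀ hq₀
  have zn : ∀ a, 5 ≤ a → s₀.nat a = 0 := fun a ha => by
    rw [e₀.nat a (by omega), hD.nat_eq_zero a (by omega)]
  have zn3 : s₀.nat 3 = 0 := by rw [e₀.nat 3 (by omega), hD.nat_eq_zero 3 (by omega)]
  have zr : s₀.real 3 = 0 := by rw [e₀.real 3 (by omega), hD.real_eq_zero 3 (by omega)]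
  clear e₀
  refine wp_mono (h₁ B K s₀ (D.digits + 1) (fun i => (D.n + 1) ^ i) hB b₀ (hK' _ (by omega))
    (zn 5 le_rfl) (by simp [NExp.eval, i₀.eval_digits]) hdB
    (fun y hy => (Nat.pow_le_pow_right (by omega) (by omega)).trans hcB') ?_) ?_
  · intro y hy s' hs' hy'
    refine ((i₀.setNatArray le_rfl _).sameData hs').eval_power ?_ hy'
    rw [hs'.nat 5 (by decide) (by decide)]
    simp [Memory.setNatArray]
  rintro s₁ ⟨e₁, b₁⟩
  have i₁ := (i₀.setNatArray le_rfl _).sameData e₁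
  have p₁ : s₁.nat 5 = D.power := by
    rw [e₁.nat 5 (by decide) (by decide)]; simp [Memory.setNatArray, Data.power]
  have n₁ : ∀ a, a ≠ 5 → a ≠ 10 → a ≠ 11 → s₁.nat a = s₀.nat a := fun a h h' h'' => by
    rw [e₁.nat a h' h'']; simp [Memory.setNatArray, h]
  have r₁ : s₁.real 3 = 0 := by rw [e₁.real 3 (by decide)]; exact zr
  set Φ : (ℕ → ℕ) → ℕ → ℕ := fun g r => leastBelow D.m fun c =>
    (∀ j < r, g j ≠ c) ∧ (r = 0 ∨ ∃ p < r, D.tree (g p * D.m + c) ≠ 0) with hΦ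
  have node : D.node = truncate D.m (tabulate Φ) := rfl
  refine wp_mono (h₂ B K s₁ D.m (tabulate Φ) hB b₁ (hK' _ (by omega))
    (by rw [n₁ 6 (by decide) (by decide) (by decide), zn 6 (by decide)]) i₁.eval_m hmB
    (fun y hy => by rw [tabulate_eq]; exact (leastBelow_le _ _).trans hmB) ?_) ?_
  · intro y hy s' hs' hy'
    rw [((i₁.setNatArray (by decide) _).sameData hs').eval_node, tabulate_eq,
      hs'.nat 6 (by decide) (by decide)]
    simp only [Memory.setNatArray, Function.update_self, hy', hΦ]
  rintro s₂ ⟨e₂, b₂⟩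
  have p₂ : Prepared D s₂ := by
    refine ⟨(i₁.setNatArray (by decide) _).sameData e₂, ?_, ?_⟩
    · rw [e₂.nat 5 (by decide) (by decide)]; simp [Memory.setNatArray, p₁]
    · rw [e₂.nat 6 (by decide) (by decide), node]; simp [Memory.setNatArray]
  have n₂ : ∀ a, a ≠ 6 → a ≠ 10 → a ≠ 11 → s₂.nat a = s₁.nat a := fun a h h' h'' => by
    rw [e₂.nat a h' h'']; simp [Memory.setNatArray, h]
  set Ψ : (ℕ → ℝ) → ℕ → ℝ := fun A y =>
    D.tableStep A (D.m - 1 - y / D.card) (y % D.card) with hΨ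
  have table : D.table = truncate (D.m * D.card) (tabulate Ψ) := rfl
  refine wp_mono (h₃ B K s₂ (D.m * D.card) (tabulate Ψ) hB b₂ (hK' _ (by omega))
    (by rw [e₂.real 3 (by decide)]; exact r₁)
    (by simp [NExp.eval, p₂.eval_m, p₂.eval_card]) (by rwa [D.card_eq]) ?_) ?_
  · intro y hy s' hs' hy'
    rw [((p₂.setRealArray le_rfl _).sameData hs').eval_table, tabulate_eq,
      hs'.real 3 (by decide)]
    simp only [Memory.setRealArray, Function.update_self, hy', hΨ]
  rintro s₃ ⟨e₃, b₃⟩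
  have p₃ := (p₂.setRealArray le_rfl _).sameData e₃
  have r₃ : s₃.real 3 = D.table := by
    rw [e₃.real 3 (by decide), table]; simp [Memory.setRealArray]
  have n₃ : ∀ a, a ≠ 10 → a ≠ 11 → s₃.nat a = s₂.nat a := fun a h h' => e₃.nat a h h'
  set Θ : (ℕ → ℕ) → ℕ → ℕ := fun g r => D.best D.table r (D.parent r) (g (D.parent r)) with hΘ
  have choice : D.choice = truncate D.m (tabulate Θ) := rfl
  refine wp_mono (h₄ B K s₃ D.m (tabulate Θ) hB b₃ (hK' _ (by omega))
    (by rw [n₃ 7 (by decide) (by decide), n₂ 7 (by decide) (by decide) (by decide),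
      n₁ 7 (by decide) (by decide) (by decide), zn 7 (by decide)]) p₃.eval_m hmB
    (fun y hy => by
      rw [tabulate_eq]; exact (leastBelow_le _ _).trans (by rwa [D.card_eq])) ?_) ?_
  · intro y hy s' hs' hy'
    rw [((p₃.setNatArray le_rfl _).sameData hs').eval_choice, tabulate_eq,
      hs'.nat 7 (by decide) (by decide), hs'.real 3 (by decide)]
    simp only [Memory.setNatArray, Function.update_self, hy', hΘ, r₃]
  rintro s₄ ⟨e₄, b₄⟩
  have p₄ := (p₃.setNatArray le_rfl _).sameData e₄
  have c₄ : s₄.nat 7 = D.choice := by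
    rw [e₄.nat 7 (by decide) (by decide), choice]; simp [Memory.setNatArray]
  refine wp_mono (h₅ B K s₄ D.n D.output hB b₄ (hK' _ (by omega)) ?_ p₄.eval_n (by omega)
    (fun y hy => (D.output_le y).trans (by omega)) ?_) ?_
  · rw [e₄.nat 3 (by decide) (by decide)]
    simp [Memory.setNatArray, n₃, n₂, n₁, zn3]
  · intro y hy s' hs' hy'
    have hi : Prepared D s' := by
      refine ⟨?_, ?_, ?_⟩
      · have h : ∀ a, a ≠ 3 → a ≠ 10 → a ≠ 11 → s'.nat a = s₄.nat a := fun a h h' h'' => by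
          rw [hs'.nat a h' h'']; simp [Memory.setNatArray, h]
        have h' : ∀ a, a ≠ 10 → s'.real a = s₄.real a := fun a h => hs'.real a h
        constructor <;> simp [h, h', p₄.n, p₄.m, p₄.k, p₄.t, p₄.q, p₄.tree, p₄.bag, p₄.f, p₄.w]
      · rw [hs'.nat 5 (by decide) (by decide)]; simp [Memory.setNatArray, p₄.power]
      · rw [hs'.nat 6 (by decide) (by decide)]; simp [Memory.setNatArray, p₄.node]
    rw [hi.eval_output, hy']
    rw [hs'.nat 7 (by decide) (by decide)]; simp [Memory.setNatArray, c₄]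
  · rintro s₅ ⟨e₅, -⟩ v hv
    rw [e₅.nat 3 (by decide) (by decide)]
    simp [Memory.setNatArray, truncate_of_lt _ hv]

end ExtTSP

namespace ExtTSP

/-! ### Correctness of the dynamic program -/

theorem leastBelow_congr {N : ℕ} {p p' : ℕ → Prop} (h : ∀ i < N, (p i ↔ p' i)) :
    leastBelow N p = leastBelow N p' := by
  classical
  induction N with
  | zero => rfl
  | succ N ih =>
    rw [leastBelow_succ, leastBelow_succ, ih fun i hi => h i (by omega)]
    simp only [h N (Nat.lt_succ_self N)]

namespace Data

/-- The nodes of the tree, in the order of the algorithm, form a tree decomposition of width at most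
`t` (a vertex without edges may be in no bag). -/
structure IsDecomposition (D : Data) : Prop where
  pos : 0 < D.m
  parent_lt : ∀ r < D.m, 0 < r → D.parent r < r
  inParent : ∀ r < D.m, ∀ r' < r, ∀ v < D.n, D.InBag r v → D.InBag r' v → D.InParent r v
  edge_cover : ∀ u < D.n, ∀ v < D.n, D.w (u * D.n + v) ≠ 0 →
    ∃ r < D.m, D.InBag r u ∧ D.InBag r v
  slot_le : ∀ r < D.m, ∀ v < D.n, D.InBag r v → D.slot r v ≤ D.t

variable {D : Data}

/-- The total contribution of all pairs for a labelling of the vertices. -/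
noncomputable def value (D : Data) (σ : ℕ → ℕ) : ℝ :=
  ∑ u ∈ Finset.range D.n, ∑ v ∈ Finset.range D.n,
    if u < v then D.gain (σ u) (σ v) u v else 0

theorem power_of_le {i : ℕ} (h : i ≤ D.digits) : D.power i = (D.n + 1) ^ i :=
  truncate_of_lt _ (Nat.lt_succ_of_le h)

theorem len_mul_le {j : ℕ} (h : j ≤ D.t + 1) : D.len * j ≤ D.digits := Nat.mul_le_mul_left _ h

theorem len_le : D.len ≤ D.digits := by simpa using D.len_mul_le (j := 1) (by omega)

theorem card_pos : 0 < D.card := by rw [card_eq]; positivity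

theorem label_lt (r X v : ℕ) : D.label r X v < (D.n + 1) ^ D.len := by
  rw [label, power_of_le len_le]
  exact Nat.mod_lt _ (by positivity)

theorem slot_lt {r u v : ℕ} (huv : u < v) (hu : D.InBag r u) : D.slot r u < D.slot r v := by
  classical
  refine Finset.sum_lt_sum_of_subset (i := u) ?_ (by simpa using huv) (by simp) (by simp [hu])
    (fun _ _ _ => Nat.zero_le _)
  exact Finset.range_subset_range.2 huv.le

theorem slot_injOn {r u v : ℕ} (hu : D.InBag r u) (hv : D.InBag r v)
    (h : D.slot r u = D.slot r v) : u = v := by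
  rcases lt_trichotomy u v with h' | h' | h'
  · exact absurd h (slot_lt h' hu).ne
  · exact h'
  · exact absurd h (slot_lt h' hv).ne'

theorem IsDecomposition.exists_state (hD : D.IsDecomposition) {r : ℕ} (hr : r < D.m) {σ : ℕ → ℕ}
    (hσ : ∀ v, σ v < (D.n + 1) ^ D.len) :
    ∃ X < D.card, ∀ v < D.n, D.InBag r v → D.label r X v = σ v := by
  classical
  let g : Fin (D.t + 1) → Fin ((D.n + 1) ^ D.len) := fun j =>
    if h : ∃ v < D.n, D.InBag r v ∧ D.slot r v = j then ⟨σ h.choose, hσ _⟩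
    else ⟨0, by positivity⟩
  refine ⟨finFunctionFinEquiv g, ?_, fun v hv hb => ?_⟩
  · rw [card_eq, digits, pow_mul]
    exact (finFunctionFinEquiv g).2
  · have hs := hD.slot_le r hr v hv hb
    have h1 := finFunctionFinEquiv_symm_apply_val (finFunctionFinEquiv g)
      ⟨D.slot r v, Nat.lt_succ_of_le hs⟩
    rw [Equiv.symm_apply_apply] at h1
    rw [label, power_of_le (len_mul_le (by omega)), power_of_le len_le, pow_mul]
    refine h1.symm.trans ?_
    have hex : ∃ v' < D.n, D.InBag r v' ∧ D.slot r v' = D.slot r v := ⟨v, hv, hb, rfl⟩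
    simp only [g, dif_pos hex]
    rw [slot_injOn hex.choose_spec.2.1 hb hex.choose_spec.2.2]

theorem IsDecomposition.best_spec (hD : D.IsDecomposition) (A : ℕ → ℝ) {r : ℕ} (hr : r < D.m)
    (p Y : ℕ) : D.best A r p Y < D.card ∧ D.Agree r (D.best A r p Y) p Y ∧
      ∀ Z < D.card, D.Agree r Z p Y → A (D.address r Z) ≤ A (D.address r (D.best A r p Y)) := by
  classical
  obtain ⟨X₀, h₀, hX₀⟩ := hD.exists_state hr (fun v => label_lt p Y v)
  obtain ⟨X, hX, hmax⟩ := ((Finset.range D.card).filter fun X => D.Agree r X p Y).exists_max_image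
    (fun X => A (D.address r X)) ⟨X₀, Finset.mem_filter.2 ⟨Finset.mem_range.2 h₀, fun v hv => by
      by_cases hb : D.InBag r v
      · exact .inr (hX₀ v hv hb)
      · exact .inl fun h => hb h.1⟩⟩
  simp only [Finset.mem_filter, Finset.mem_range] at hX hmax
  let P : ℕ → Prop := fun X => D.Agree r X p Y ∧ ∀ Z < D.card,
    ¬ D.Agree r Z p Y ∨ A (D.address r Z) ≤ A (D.address r X)
  have hp : P X := ⟨hX.2, fun Z hZ => or_iff_not_imp_left.2 fun h => hmax Z ⟨hZ, not_not.1 h⟩⟩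
  have h1 : leastBelow D.card P < D.card := leastBelow_lt hX.1 hp
  have h2 : P (leastBelow D.card P) := leastBelow_spec hX.1 hp
  exact ⟨h1, h2.1, fun Z hZ h => (h2.2 Z hZ).resolve_left (not_not.2 h)⟩

theorem IsDecomposition.table_eq (hD : D.IsDecomposition) {r X : ℕ} (hr : r < D.m)
    (hX : X < D.card) : D.table (D.address r X) = D.tableStep D.table r X := by
  have hlt : ∀ r' < D.m, ∀ Z < D.card, D.address r' Z < D.m * D.card := fun r' hr' Z hZ => by
    have : (D.m - 1 - r' + 1) * D.card ≤ D.m * D.card := Nat.mul_le_mul_right _ (by omega)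
    rw [Nat.succ_mul] at this
    rw [address]
    omega
  have hlt' : ∀ r' < D.m, r < r' → ∀ Z < D.card, D.address r' Z < D.address r X :=
    fun r' hr' h Z hZ => by
      have : (D.m - 1 - r' + 1) * D.card ≤ (D.m - 1 - r) * D.card :=
        Nat.mul_le_mul_right _ (by omega)
      rw [Nat.succ_mul] at this
      rw [address, address]
      omega
  have hdiv : D.m - 1 - D.address r X / D.card = r := by
    rw [address, Nat.mul_comm, Nat.mul_add_div card_pos, Nat.div_eq_of_lt hX]
    omega
  have hmod : D.address r X % D.card = X := by
    rw [address, Nat.mul_comm, Nat.mul_add_mod, Nat.mod_eq_of_lt hX]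
  conv_lhs => rw [table, truncate_of_lt _ (hlt r hr X hX), tabulate_eq, hdiv, hmod]
  rw [tableStep, tableStep]
  congr 1
  refine Finset.sum_congr rfl fun r' hr' => ?_
  rw [Finset.mem_range] at hr'
  split_ifs with h
  · have hA : ∀ Z < D.card, truncate (D.address r X) (tabulate fun A y =>
        D.tableStep A (D.m - 1 - y / D.card) (y % D.card)) (D.address r' Z) =
        D.table (D.address r' Z) := fun Z hZ => by
      rw [truncate_of_lt _ (hlt' r' hr' h.1 Z hZ), table, truncate_of_lt _ (hlt r' hr' Z hZ)]
    have hb : D.best (truncate (D.address r X) (tabulate fun A y =>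
        D.tableStep A (D.m - 1 - y / D.card) (y % D.card))) r' r X = D.best D.table r' r X := by
      refine leastBelow_congr fun Z hZ => and_congr_right fun _ => forall₂_congr fun Z' hZ' => ?_
      rw [hA Z hZ, hA Z' hZ']
    rw [hb, hA _ (hD.best_spec D.table hr' r X).1]
  · rfl

/-- A choice of states such that neighbouring states agree. -/
structure Consistent (D : Data) (X : ℕ → ℕ) : Prop where
  lt : ∀ r < D.m, X r < D.card
  agree : ∀ r < D.m, D.Agree r (X r) (D.parent r) (X (D.parent r))

theorem parent_zero : D.parent 0 = 0 := rfl

theorem best_zero (A : ℕ → ℝ) (Y Y' : ℕ) : D.best A 0 0 Y = D.best A 0 0 Y' := by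
  have h : ∀ X Y, D.Agree 0 X 0 Y := fun X Y v _ => .inl fun h => absurd h.2.1 (Nat.not_lt_zero _)
  simp only [best, h]

theorem IsDecomposition.sum_table (hD : D.IsDecomposition) {X : ℕ → ℕ} (hX : D.Consistent X) :
    ∑ r ∈ Finset.range D.m, D.table (D.address r (X r)) =
      ∑ r ∈ Finset.range D.m, D.localValue r (X r) + ∑ r ∈ (Finset.range D.m).erase 0,
        D.table (D.address r (D.best D.table r (D.parent r) (X (D.parent r)))) := by
  classical
  rw [Finset.sum_congr rfl fun r hr =>
    hD.table_eq (Finset.mem_range.1 hr) (hX.lt r (Finset.mem_range.1 hr))]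
  simp only [tableStep, Finset.sum_add_distrib]
  congr 1
  rw [Finset.sum_comm, ← Finset.sum_erase (Finset.range D.m) (a := 0)]
  · refine Finset.sum_congr rfl fun r' hr' => ?_
    rw [Finset.mem_erase, Finset.mem_range] at hr'
    have hp := hD.parent_lt r' hr'.2 (by omega)
    rw [Finset.sum_eq_single (D.parent r')]
    · rw [if_pos ⟨hp, rfl⟩]
    · exact fun r _ hr => if_neg fun h => hr h.2.symm
    · exact fun h => absurd (Finset.mem_range.2 (hp.trans hr'.2)) h
  · exact Finset.sum_eq_zero fun r _ => if_neg fun h => absurd h.1 (Nat.not_lt_zero _)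

theorem IsDecomposition.choice_eq (hD : D.IsDecomposition) {r : ℕ} (hr : r < D.m) :
    D.choice r = D.best D.table r (D.parent r) (D.choice (D.parent r)) := by
  conv_lhs => rw [choice, truncate_of_lt _ hr, tabulate_eq]
  rcases Nat.eq_zero_or_pos r with rfl | h0
  · rw [parent_zero]
    exact best_zero _ _ _
  · have hp := hD.parent_lt r hr h0
    rw [truncate_of_lt _ hp, choice, truncate_of_lt _ (hp.trans hr)]

theorem IsDecomposition.consistent_choice (hD : D.IsDecomposition) : D.Consistent D.choice where
  lt r hr := by rw [hD.choice_eq hr]; exact (hD.best_spec _ hr _ _).1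
  agree r hr := by
    have := (hD.best_spec D.table hr (D.parent r) (D.choice (D.parent r))).2.1
    rwa [← hD.choice_eq hr] at this

theorem IsDecomposition.sum_localValue_le (hD : D.IsDecomposition) {X : ℕ → ℕ}
    (hX : D.Consistent X) : ∑ r ∈ Finset.range D.m, D.localValue r (X r) ≤
      ∑ r ∈ Finset.range D.m, D.localValue r (D.choice r) := by
  have h0 : 0 ∈ Finset.range D.m := Finset.mem_range.2 hD.pos
  have h1 := hD.sum_table hX
  have h2 := hD.sum_table hD.consistent_choice
  rw [← Finset.add_sum_erase _ _ h0] at h1 h2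
  have h3 : D.table (D.address 0 (X 0)) ≤ D.table (D.address 0 (D.choice 0)) := by
    rw [hD.choice_eq hD.pos, parent_zero, best_zero _ _ (X 0)]
    exact (hD.best_spec D.table hD.pos 0 (X 0)).2.2 _ (hX.lt 0 hD.pos) (hX.agree 0 hD.pos)
  have h4 : ∑ r ∈ (Finset.range D.m).erase 0, D.table (D.address r (X r)) ≤
      ∑ r ∈ (Finset.range D.m).erase 0,
        D.table (D.address r (D.best D.table r (D.parent r) (X (D.parent r)))) :=
    Finset.sum_le_sum fun r hr => by
      have hr' := Finset.mem_range.1 (Finset.mem_of_mem_erase hr)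
      exact (hD.best_spec D.table hr' _ _).2.2 _ (hX.lt r hr') (hX.agree r hr')
  have h5 : ∑ r ∈ (Finset.range D.m).erase 0, D.table (D.address r (D.choice r)) =
      ∑ r ∈ (Finset.range D.m).erase 0,
        D.table (D.address r (D.best D.table r (D.parent r) (D.choice (D.parent r)))) :=
    Finset.sum_congr rfl fun r hr => by
      rw [← hD.choice_eq (Finset.mem_range.1 (Finset.mem_of_mem_erase hr))]
  linarith

theorem gain_eq_zero {S S' u v : ℕ} (h : D.w (u * D.n + v) = 0) : D.gain S S' u v = 0 := by
  simp [gain, h]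

theorem IsDecomposition.sum_localValue (hD : D.IsDecomposition) {X σ : ℕ → ℕ}
    (h : ∀ r < D.m, ∀ v < D.n, D.InBag r v → D.label r (X r) v = σ v) :
    ∑ r ∈ Finset.range D.m, D.localValue r (X r) = D.value σ := by
  classical
  simp only [localValue, value]
  rw [Finset.sum_comm]
  refine Finset.sum_congr rfl fun u hu => ?_
  rw [Finset.sum_comm]
  refine Finset.sum_congr rfl fun v hv => ?_
  rw [Finset.mem_range] at hu hv
  split_ifs with huv
  swap
  · exact Finset.sum_eq_zero fun r _ => if_neg fun h => huv h.1
  by_cases hw : D.w (u * D.n + v) = 0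
  · simp [gain_eq_zero hw]
  obtain ⟨r, ⟨hr, hru, hrv⟩, hmin⟩ : ∃ r, (r < D.m ∧ D.InBag r u ∧ D.InBag r v) ∧
      ∀ r' < r, ¬ (r' < D.m ∧ D.InBag r' u ∧ D.InBag r' v) :=
    ⟨_, Nat.find_spec (hD.edge_cover u hu v hv hw), fun r' h => Nat.find_min _ h⟩
  rw [Finset.sum_eq_single r]
  · rw [if_pos, h r hr u hu hru, h r hr v hv hrv]
    exact ⟨huv, hru, hrv, fun hp => hmin _ hp.1.1 ⟨hp.1.1.trans hr, hp.1.2, hp.2.2⟩⟩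
  · intro r' hr' hne
    rw [Finset.mem_range] at hr'
    refine if_neg fun h' => ?_
    have hlt : r < r' := lt_of_le_of_ne (not_lt.1 fun hlt => hmin r' hlt ⟨hr', h'.2.1, h'.2.2.1⟩)
      (Ne.symm hne)
    exact h'.2.2.2 ⟨hD.inParent r' hr' r hlt u hu h'.2.1 hru,
      hD.inParent r' hr' r hlt v hv h'.2.2.1 hrv⟩
  · exact fun h => absurd (Finset.mem_range.2 hr) h

theorem IsDecomposition.label_choice (hD : D.IsDecomposition) {r : ℕ} (hr : r < D.m) {v : ℕ}
    (hv : v < D.n) (hb : D.InBag r v) : D.label r (D.choice r) v = D.assigned v := by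
  induction r using Nat.strong_induction_on with
  | _ r ih =>
    have hle : D.home v ≤ r := not_lt.1 fun h => not_of_lt_leastBelow h hb
    rcases hle.eq_or_lt with h | h
    · rw [assigned, h]
    · have hh : D.InBag (D.home v) v := leastBelow_spec (p := fun r => D.InBag r v) hr hb
      have hp := hD.inParent r hr _ h v hv hb hh
      have := (hD.consistent_choice.agree r hr v hv).resolve_left (not_not.2 ⟨hb, hp⟩)
      rw [this, ih _ hp.1 (hp.1.trans hr) hp.2]

/-- The labelling that the algorithm chooses is optimal. -/
theorem IsDecomposition.value_le (hD : D.IsDecomposition) {σ : ℕ → ℕ}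
    (hσ : ∀ v, σ v < (D.n + 1) ^ D.len) : D.value σ ≤ D.value D.assigned := by
  choose! X hX hXσ using fun r (hr : r < D.m) => hD.exists_state hr hσ
  rw [← hD.sum_localValue hXσ, ← hD.sum_localValue fun r hr v hv hb => hD.label_choice hr hv hb]
  refine hD.sum_localValue_le ⟨hX, fun r hr v hv => or_iff_not_imp_left.2 fun h => ?_⟩
  obtain ⟨hb, hp⟩ := not_not.1 h
  rw [hXσ r hr v hv hb, hXσ _ (hp.1.trans hr) v hv hp.2]

end Data

end ExtTSP

namespace ExtTSP

/-! ### Labellings and sequencings -/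

theorem Problem.f_nonneg {n : ℕ} (P : Problem n) {i : ℕ} (hi : 1 ≤ i) : 0 ≤ P.f i := by
  rw [← P.f_eq_zero (P.k + i) (by omega)]
  exact P.f_antitone hi (show 1 ≤ P.k + i by omega) (by omega)

theorem Problem.value_nonneg {n : ℕ} (P : Problem n) (d : Equiv.Perm (Fin n)) :
    0 ≤ P.value d := by
  classical
  refine Finset.sum_nonneg fun u _ => Finset.sum_nonneg fun v _ => ?_
  split_ifs with h
  · exact mul_nonneg (P.f_nonneg (Nat.dist_pos_of_ne fun h' =>
      h.1.ne (d.injective (Fin.ext h')))) (P.weight_pos u v h.2).le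
  · exact le_rfl

theorem Problem.one_le_k {n : ℕ} (P : Problem n) : 1 ≤ P.k := by
  by_contra h
  have := P.f_eq_zero 1 (by omega)
  rw [P.f_one] at this
  exact one_ne_zero this

namespace Data

/-- The data describe the problem. -/
structure Represents (D : Data) (P : Problem D.n) : Prop where
  k : D.k = P.k
  f : ∀ i, 1 ≤ i → D.f i = P.f i
  weight : ∀ u v : Fin D.n, P.graph.Adj u v → D.w (u * D.n + v) = P.weight u v
  no_edge : ∀ u v : Fin D.n, ¬ P.graph.Adj u v → D.w (u * D.n + v) = 0

variable {D : Data}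

theorem pos_spec {S v : ℕ} (h : D.pos S v < D.len) :
    S / D.power (D.pos S v) % (D.n + 1) = v :=
  leastBelow_spec_of_lt h

theorem pos_injective {S u v : ℕ} (hu : D.pos S u < D.len) (h : D.pos S u = D.pos S v) :
    u = v := by
  rw [← pos_spec hu, h, pos_spec (h ▸ hu)]

theorem pos_eq {S v i : ℕ} (hi : i < D.len) (h : S / D.power i % (D.n + 1) = v)
    (h' : ∀ j < i, S / D.power j % (D.n + 1) ≠ v) : D.pos S v = i := by
  have hlt : D.pos S v < D.len := leastBelow_lt hi h
  refine le_antisymm (not_lt.1 fun h1 => not_of_lt_leastBelow h1 h)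
    (not_lt.1 fun h1 => h' _ h1 (pos_spec hlt))

theorem gain_nonneg {P : Problem D.n} (hP : D.Represents P) {u v : Fin D.n} (huv : u ≠ v)
    (S S' : ℕ) : 0 ≤ D.gain S S' u v := by
  rw [gain]
  split_ifs with h
  · by_cases ha : P.graph.Adj u v
    · have : 1 ≤ Nat.dist (D.pos S u) (D.pos S v) := Nat.dist_pos_of_ne fun h' =>
        huv (Fin.ext (pos_injective h.2.1 h'))
      rw [hP.f _ this, hP.weight u v ha]
      exact mul_nonneg (P.f_nonneg this) (P.weight_pos u v ha).le
    · rw [hP.no_edge u v ha, mul_zero]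
  · exact le_rfl

/-- The position of `v` in the order of the keys. -/
noncomputable def rank (D : Data) (v : ℕ) : ℕ :=
  ((Finset.range D.n).filter fun u => D.key u < D.key v).card

theorem key_mod {v : ℕ} (hv : v < D.n) : D.key v % D.n = v := by
  rw [key, Nat.mul_add_mod_self_right, Nat.mod_eq_of_lt hv]

theorem key_div {v : ℕ} (hv : v < D.n) :
    D.key v / D.n = D.assigned v * (D.len + 1) + D.pos (D.assigned v) v := by
  rw [key, Nat.mul_comm, Nat.mul_add_div (by omega), Nat.div_eq_of_lt hv, add_zero]

theorem key_div_div {v : ℕ} (hv : v < D.n) : D.key v / D.n / (D.len + 1) = D.assigned v := by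
  have : D.pos (D.assigned v) v ≤ D.len := leastBelow_le _ _
  rw [key_div hv, Nat.mul_comm, Nat.mul_add_div (by omega), Nat.div_eq_of_lt (by omega), add_zero]

theorem key_injOn {u v : ℕ} (hu : u < D.n) (hv : v < D.n) (h : D.key u = D.key v) : u = v := by
  rw [← key_mod hu, h, key_mod hv]

theorem rank_lt_rank {u v : ℕ} (hu : u < D.n) (h : D.key u < D.key v) : D.rank u < D.rank v := by
  refine Finset.card_lt_card ⟨fun x hx => ?_, fun hsub => ?_⟩
  · rw [Finset.mem_filter] at hx ⊢
    exact ⟨hx.1, hx.2.trans h⟩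
  · have := hsub (Finset.mem_filter.2 ⟨Finset.mem_range.2 hu, h⟩)
    exact lt_irrefl _ (Finset.mem_filter.1 this).2

theorem rank_lt {v : ℕ} (hv : v < D.n) : D.rank v < D.n := by
  have : (Finset.range D.n).filter (fun u => D.key u < D.key v) ⊆ (Finset.range D.n).erase v :=
    fun x hx => by
      rw [Finset.mem_filter] at hx
      exact Finset.mem_erase.2 ⟨fun h => lt_irrefl _ (h ▸ hx.2), hx.1⟩
  have h := Finset.card_le_card this
  rw [Finset.card_erase_of_mem (Finset.mem_range.2 hv), Finset.card_range] at h
  rw [rank]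
  omega

theorem rank_injOn {u v : ℕ} (hu : u < D.n) (hv : v < D.n) (h : D.rank u = D.rank v) :
    u = v := by
  rcases lt_trichotomy (D.key u) (D.key v) with h' | h' | h'
  · exact absurd h (rank_lt_rank hu h').ne
  · exact key_injOn hu hv h'
  · exact absurd h (rank_lt_rank hv h').ne'

theorem rank_sub_le {u v : ℕ} (hu : u < D.n) (hv : v < D.n) (h : D.key u < D.key v)
    (hS : D.assigned u = D.assigned v) (hp : D.pos (D.assigned v) v < D.len) :
    D.pos (D.assigned u) u < D.pos (D.assigned v) v ∧
    D.rank v - D.rank u ≤ D.pos (D.assigned v) v - D.pos (D.assigned u) u := by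
  have mono : ∀ x < D.n, D.key u ≤ D.key x → D.key x ≤ D.key v →
      D.assigned x = D.assigned v ∧ D.pos (D.assigned u) u ≤ D.pos (D.assigned v) x ∧
        D.pos (D.assigned v) x ≤ D.pos (D.assigned v) v := by
    intro x hx h1 h2
    have h3 := Nat.div_le_div_right (c := D.n) h1
    have h4 := Nat.div_le_div_right (c := D.n) h2
    have h5 := Nat.div_le_div_right (c := D.len + 1) h3
    have h6 := Nat.div_le_div_right (c := D.len + 1) h4
    rw [key_div_div hx, key_div_div hu] at h5
    rw [key_div_div hx, key_div_div hv] at h6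
    have h7 : D.assigned x = D.assigned v := by omega
    rw [key_div hx, key_div hu, h7, hS] at h3
    rw [key_div hx, key_div hv, h7] at h4
    rw [hS]
    exact ⟨h7, by omega, by omega⟩
  have hne : ∀ x < D.n, D.key u ≤ D.key x → D.key x < D.key v →
      D.pos (D.assigned v) x < D.pos (D.assigned v) v := by
    intro x hx h1 h2
    obtain ⟨h3, h4, h5⟩ := mono x hx h1 h2.le
    refine lt_of_le_of_ne h5 fun h6 => h2.ne ?_
    rw [pos_injective hp h6.symm]
  refine ⟨?_, ?_⟩
  · have := hne u hu le_rfl h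
    rwa [← hS] at this ⊢
  have hsub : (Finset.range D.n).filter (fun x => D.key x < D.key u) ⊆
      (Finset.range D.n).filter fun x => D.key x < D.key v := fun x hx => by
    rw [Finset.mem_filter] at hx ⊢
    exact ⟨hx.1, hx.2.trans h⟩
  rw [rank, rank, ← Finset.card_sdiff_of_subset hsub, ← Nat.card_Ico]
  have hmem : ∀ x ∈ (Finset.range D.n).filter (fun x => D.key x < D.key v) \
      (Finset.range D.n).filter (fun x => D.key x < D.key u),
      x < D.n ∧ D.key u ≤ D.key x ∧ D.key x < D.key v := fun x hx => by
    rw [Finset.mem_sdiff, Finset.mem_filter, Finset.mem_filter, Finset.mem_range] at hx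
    exact ⟨hx.1.1, not_lt.1 fun h => hx.2 ⟨hx.1.1, h⟩, hx.1.2⟩
  refine Finset.card_le_card_of_injOn (fun x => D.pos (D.assigned v) x) (fun x hx => ?_)
    (fun x hx y hy hxy => ?_)
  · obtain ⟨h1, h2, h3⟩ := hmem x hx
    exact Finset.mem_coe.2 (Finset.mem_Ico.2 ⟨(mono x h1 h2 h3.le).2.1, hne x h1 h2 h3⟩)
  · obtain ⟨h1, h2, h3⟩ := hmem x hx
    exact pos_injective ((hne x h1 h2 h3).trans hp) hxy

/-- The sequencing that the algorithm outputs. -/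
noncomputable def sequencing (D : Data) : Equiv.Perm (Fin D.n) :=
  Equiv.ofBijective (fun v => ⟨D.rank v, rank_lt v.2⟩) <| Finite.injective_iff_bijective.1
    fun u v h => Fin.ext (rank_injOn u.2 v.2 (congrArg Fin.val h))

theorem sequencing_apply (v : Fin D.n) : (D.sequencing v : ℕ) = D.rank v := rfl

theorem output_eq (v : Fin D.n) : D.output v = D.sequencing v + 1 := by
  classical
  rw [output, sequencing_apply, rank, Finset.card_filter, add_comm]

theorem outputs_sequencing {s : Memory} (h : ∀ v < D.n, s.nat 3 v = D.output v) :
    Outputs s D.sequencing := fun v => (h v v.2).trans (output_eq v)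

theorem dist_rank_le {u v : ℕ} (hu : u < D.n) (hv : v < D.n) (hS : D.assigned u = D.assigned v)
    (hpu : D.pos (D.assigned u) u < D.len) (hpv : D.pos (D.assigned v) v < D.len) :
    Nat.dist (D.rank u) (D.rank v) ≤
      Nat.dist (D.pos (D.assigned u) u) (D.pos (D.assigned v) v) := by
  rcases lt_trichotomy (D.key u) (D.key v) with h | h | h
  · have h1 := rank_sub_le hu hv h hS hpv
    have h2 := rank_lt_rank hu h
    simp only [Nat.dist]
    omega
  · rw [key_injOn hu hv h]
    simp
  · have h1 := rank_sub_le hv hu h hS.symm hpu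
    have h2 := rank_lt_rank hv h
    simp only [Nat.dist]
    omega

theorem value_eq (σ : ℕ → ℕ) :
    D.value σ = ∑ u : Fin D.n, ∑ v : Fin D.n, if u < v then D.gain (σ u) (σ v) u v else 0 := by
  simp only [value, Finset.sum_range, Fin.lt_def]

theorem value_le_sequencing {P : Problem D.n} (hP : D.Represents P) :
    D.value D.assigned ≤ P.value D.sequencing := by
  classical
  rw [value_eq, Problem.value]
  refine Finset.sum_le_sum fun u _ => Finset.sum_le_sum fun v _ => ?_
  by_cases huv : u < v
  swap
  · rw [if_neg huv, if_neg fun h => huv h.1]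
  rw [if_pos huv]
  by_cases ha : P.graph.Adj u v
  swap
  · rw [gain_eq_zero (hP.no_edge u v ha), if_neg fun h => ha h.2]
  rw [if_pos ⟨huv, ha⟩]
  have hd : 1 ≤ Nat.dist (D.sequencing u : ℕ) (D.sequencing v) :=
    Nat.dist_pos_of_ne fun h => huv.ne (D.sequencing.injective (Fin.ext h))
  have hw := P.weight_pos u v ha
  rw [gain]
  split_ifs with h
  · obtain ⟨hS, hu, hv⟩ := h
    have hdist := dist_rank_le u.2 v.2 hS hu (hS ▸ hv)
    rw [← hS] at hdist
    rw [hP.weight u v ha, hP.f _ (hd.trans hdist)]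
    exact mul_le_mul_of_nonneg_right (P.f_antitone hd (hd.trans hdist) hdist) hw.le
  · exact mul_nonneg (P.f_nonneg hd) hw.le

end Data

/-- Hermite's identity. -/
theorem sum_add_div (L x : ℕ) (hL : 0 < L) : ∑ a ∈ Finset.range L, (x + a) / L = x := by
  induction x with
  | zero =>
    refine Finset.sum_eq_zero fun a ha => ?_
    rw [zero_add, Nat.div_eq_of_lt (Finset.mem_range.1 ha)]
  | succ x ih =>
    have h1 := Finset.sum_range_succ (fun a => (x + a) / L) L
    have h2 := Finset.sum_range_succ' (fun a => (x + a) / L) L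
    rw [h1, ih, Nat.add_div_right _ hL] at h2
    simp only [add_zero] at h2
    simp only [show ∀ a, x + 1 + a = x + (a + 1) by intro a; omega]
    omega

theorem le_card_same_block {L x y : ℕ} (hL : 0 < L) (hxy : x ≤ y) :
    L ≤ ((Finset.range L).filter fun a => (x + a) / L = (y + a) / L).card + (y - x) := by
  have h1 : ∑ a ∈ Finset.range L, (x + a) / L +
      ((Finset.range L).filter fun a => ¬ (x + a) / L = (y + a) / L).card ≤
      ∑ a ∈ Finset.range L, (y + a) / L := by
    rw [Finset.card_filter, ← Finset.sum_add_distrib]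
    refine Finset.sum_le_sum fun a _ => ?_
    have := Nat.div_le_div_right (c := L) (show x + a ≤ y + a by omega)
    split_ifs <;> omega
  rw [sum_add_div L x hL, sum_add_div L y hL] at h1
  have h2 := Finset.card_filter_add_card_filter_not (s := Finset.range L)
    (fun a => (x + a) / L = (y + a) / L)
  rw [Finset.card_range] at h2
  omega

namespace Data

variable {D : Data}

/-- The `i`-th entry of the `s`-th block if the sequencing `d` is cut with offset `a`. -/
def blockEntry (D : Data) (d : Equiv.Perm (Fin D.n)) (a s i : ℕ) : Fin (D.n + 1) :=
  if h : a ≤ s * D.len + i ∧ s * D.len + i - a < D.n then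
    (d.symm ⟨s * D.len + i - a, h.2⟩).castSucc else Fin.last D.n

/-- The label of the `s`-th block. -/
def block (D : Data) (d : Equiv.Perm (Fin D.n)) (a s : ℕ) : ℕ :=
  finFunctionFinEquiv fun i : Fin D.len => D.blockEntry d a s i

theorem block_lt (d : Equiv.Perm (Fin D.n)) (a s : ℕ) : D.block d a s < (D.n + 1) ^ D.len :=
  (finFunctionFinEquiv _).2

theorem block_digit (d : Equiv.Perm (Fin D.n)) (a s : ℕ) {i : ℕ} (hi : i < D.len) :
    D.block d a s / D.power i % (D.n + 1) = D.blockEntry d a s i := by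
  rw [power_of_le (hi.le.trans len_le), block]
  rw [← finFunctionFinEquiv_symm_apply_val _ (⟨i, hi⟩ : Fin D.len), Equiv.symm_apply_apply]

theorem blockEntry_eq (d : Equiv.Perm (Fin D.n)) {a s i : ℕ} (v : Fin D.n) :
    (D.blockEntry d a s i : ℕ) = v ↔ s * D.len + i = d v + a := by
  rw [blockEntry]
  split_ifs with h
  · rw [Fin.val_castSucc, Fin.val_inj, Equiv.symm_apply_eq, Fin.ext_iff]
    simp only
    omega
  · have := (d v).2
    have := v.2
    simp only [Fin.val_last]
    omega

theorem pos_block (d : Equiv.Perm (Fin D.n)) (a : ℕ) (hL : 0 < D.len) (v : Fin D.n) :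
    D.pos (D.block d a ((d v + a) / D.len)) v = (d v + a) % D.len := by
  have hlt := Nat.mod_lt (d v + a) hL
  have h := Nat.div_add_mod' (d v + a) D.len
  refine pos_eq hlt ?_ fun j hj => ?_
  · rw [block_digit d a _ hlt, blockEntry_eq, h]
  · rw [block_digit d a _ (hj.trans hlt), Ne, blockEntry_eq]
    omega

theorem gain_block {P : Problem D.n} (hP : D.Represents P) (d : Equiv.Perm (Fin D.n)) (a : ℕ)
    (hL : 0 < D.len) {u v : Fin D.n} (huv : u ≠ v) (ha : P.graph.Adj u v)
    (h : (d u + a) / D.len = (d v + a) / D.len) :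
    D.gain (D.block d a ((d u + a) / D.len)) (D.block d a ((d v + a) / D.len)) u v =
      P.f (Nat.dist (d u) (d v)) * P.weight u v := by
  have hd : Nat.dist ((d u + a) % D.len) ((d v + a) % D.len) = Nat.dist (d u : ℕ) (d v) := by
    have h1 := Nat.div_add_mod' (d u + a) D.len
    have h2 := Nat.div_add_mod' (d v + a) D.len
    rw [← h] at h2
    simp only [Nat.dist]
    omega
  have hd1 : 1 ≤ Nat.dist (d u : ℕ) (d v) :=
    Nat.dist_pos_of_ne fun h => huv (d.injective (Fin.ext h))
  have hu := pos_block d a hL u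
  have hv := pos_block d a hL v
  rw [← h] at hv ⊢
  rw [gain, hu, hv, hd, if_pos ⟨rfl, Nat.mod_lt _ hL, Nat.mod_lt _ hL⟩, hP.f _ hd1,
    hP.weight u v ha]

theorem le_sum_value_block {P : Problem D.n} (hP : D.Represents P) (d : Equiv.Perm (Fin D.n))
    (hL : 0 < D.len) : ((D.len : ℝ) - D.k) * P.value d ≤ ∑ a ∈ Finset.range D.len, D.value fun v =>
      if h : v < D.n then D.block d a ((d ⟨v, h⟩ + a) / D.len) else 0 := by
  classical
  simp only [value_eq, Fin.is_lt, dite_true, Fin.eta]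
  rw [Finset.sum_comm, Problem.value, Finset.mul_sum]
  refine Finset.sum_le_sum fun u _ => ?_
  rw [Finset.sum_comm, Finset.mul_sum]
  refine Finset.sum_le_sum fun v _ => ?_
  by_cases huv : u < v
  swap
  · simp [huv]
  simp only [huv, true_and, if_true]
  have hg := fun a => gain_nonneg hP huv.ne (D.block d a ((d u + a) / D.len))
    (D.block d a ((d v + a) / D.len))
  by_cases ha : P.graph.Adj u v
  swap
  · rw [if_neg ha, mul_zero]
    exact Finset.sum_nonneg fun a _ => hg a
  rw [if_pos ha]
  have hw := P.weight_pos u v ha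
  have hd1 : 1 ≤ Nat.dist (d u : ℕ) (d v) :=
    Nat.dist_pos_of_ne fun h => huv.ne (d.injective (Fin.ext h))
  have hf := P.f_nonneg hd1
  by_cases hk : D.k < Nat.dist (d u : ℕ) (d v)
  · rw [P.f_eq_zero _ (hP.k ▸ hk), zero_mul, mul_zero]
    exact Finset.sum_nonneg fun a _ => hg a
  have hcard : D.len ≤ ((Finset.range D.len).filter fun a =>
      ((d u : ℕ) + a) / D.len = (d v + a) / D.len).card + D.k := by
    rcases le_total (d u : ℕ) (d v) with h | h
    · have := le_card_same_block hL h
      rw [Nat.dist_eq_sub_of_le h] at hk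
      omega
    · have := le_card_same_block hL h
      rw [Nat.dist_eq_sub_of_le_right h] at hk
      simp only [eq_comm (a := ((d v : ℕ) + _) / D.len)] at this
      omega
  calc ((D.len : ℝ) - D.k) * (P.f (Nat.dist (d u) (d v)) * P.weight u v) ≤
      ((Finset.range D.len).filter fun a => ((d u : ℕ) + a) / D.len = (d v + a) / D.len).card *
        (P.f (Nat.dist (d u) (d v)) * P.weight u v) := by
        refine mul_le_mul_of_nonneg_right ?_ (mul_nonneg hf hw.le)
        rw [sub_le_iff_le_add]
        exact_mod_cast hcard
    _ = ∑ a ∈ (Finset.range D.len).filter fun a => ((d u : ℕ) + a) / D.len = (d v + a) / D.len,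
        D.gain (D.block d a ((d u + a) / D.len)) (D.block d a ((d v + a) / D.len)) u v := by
        rw [Finset.sum_congr rfl fun a h => gain_block hP d a hL huv.ne ha
          (Finset.mem_filter.1 h).2, Finset.sum_const, nsmul_eq_mul]
    _ ≤ _ := Finset.sum_le_sum_of_subset_of_nonneg (Finset.filter_subset _ _) fun a _ _ => hg a

/-- The approximation guarantee. -/
theorem value_le_mul {P : Problem D.n} (hP : D.Represents P) (hD : D.IsDecomposition) {ε : ℝ}
    (hε : 0 < ε) (hq : D.q = ⌈1 / ε⌉₊) (d : Equiv.Perm (Fin D.n)) :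
    P.value d ≤ (1 + ε) * P.value D.sequencing := by
  have hk : 1 ≤ D.k := hP.k ▸ P.one_le_k
  have hL : 0 < D.len := Nat.mul_pos hk (Nat.succ_pos _)
  have h1 := (le_sum_value_block hP d hL).trans (Finset.sum_le_sum fun a _ =>
    hD.value_le (σ := fun v => if h : v < D.n then D.block d a ((d ⟨v, h⟩ + a) / D.len) else 0)
      fun v => by
        split_ifs
        · exact block_lt _ _ _
        · positivity)
  rw [Finset.sum_const, Finset.card_range, nsmul_eq_mul] at h1
  have h2 := value_le_sequencing hP
  have hlen : (D.len : ℝ) = D.k * (D.q + 1) := by simp [len]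
  have hk' : (0 : ℝ) < D.k := by exact_mod_cast hk
  have h3 : (D.q : ℝ) * P.value d ≤ (D.q + 1) * D.value D.assigned := by
    rw [hlen] at h1
    refine le_of_mul_le_mul_left (a := (D.k : ℝ)) ?_ hk'
    linarith
  have hq' : 1 / ε ≤ D.q := hq ▸ Nat.le_ceil _
  have hq0 : (0 : ℝ) < D.q := (by positivity : (0 : ℝ) < 1 / ε).trans_le hq'
  rw [div_le_iff₀ hε] at hq'
  have h4 := P.value_nonneg D.sequencing
  refine le_of_mul_le_mul_left (a := (D.q : ℝ)) ?_ hq0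
  nlinarith

end Data

end ExtTSP

namespace ExtTSP

/-! ### The input -/

theorem arrayOfMatrix_apply {α : Type} [Zero α] {p q : ℕ} (A : Fin p → Fin q → α) (i : Fin p)
    (j : Fin q) : arrayOfMatrix A (i * q + j) = A i j := by
  have hlt : (i : ℕ) * q + j < p * q := by
    have h1 : ((i : ℕ) + 1) * q ≤ p * q := Nat.mul_le_mul_right _ i.2
    rw [Nat.succ_mul] at h1
    omega
  have hq : 0 < q := j.pos
  rw [arrayOfMatrix, dif_pos hlt]
  congr 1
  · ext
    simp only [Fin.coe_divNat]
    rw [Nat.mul_comm, Nat.mul_add_div hq, Nat.div_eq_of_lt j.2, add_zero]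
  · ext
    simp only [Fin.coe_modNat]
    rw [Nat.mul_add_mod_self_right, Nat.mod_eq_of_lt j.2]

theorem arrayOfMatrix_le {p q : ℕ} (A : Fin p → Fin q → ℕ) {B : ℕ} (h : ∀ i j, A i j ≤ B)
    (x : ℕ) : arrayOfMatrix A x ≤ B := by
  rw [arrayOfMatrix]
  split_ifs
  · exact h _ _
  · exact Nat.zero_le _

variable {n m : ℕ} (P : Problem n) (T : TreeDecomposition P.graph m) (t : ℕ) (ε : ℝ)

section

open Classical in
theorem inputMemory_nat_one : (inputMemory P T t ε).nat 1 =
    arrayOfMatrix fun i j => if T.tree.Adj i j then 1 else 0 := rfl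

open Classical in
theorem inputMemory_nat_two : (inputMemory P T t ε).nat 2 =
    arrayOfMatrix fun i v => if v ∈ T.bag i then 1 else 0 := rfl

open Classical in
theorem inputMemory_real_two : (inputMemory P T t ε).real 2 =
    arrayOfMatrix fun u v => if P.graph.Adj u v then P.weight u v else 0 := rfl

open Classical in
theorem inputMemory_weight (u v : Fin n) : (inputMemory P T t ε).real 2 (u * n + v) =
    if P.graph.Adj u v then P.weight u v else 0 := by
  rw [inputMemory_real_two, arrayOfMatrix_apply _ u v]

end

/-- The data that the input describes. -/
noncomputable def inputData : Data where
  n := n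
  m := m
  k := P.k
  t := t
  q := ⌈1 / ε⌉₊
  tree := (inputMemory P T t ε).nat 1
  bag := (inputMemory P T t ε).nat 2
  f := (inputMemory P T t ε).real 1
  w := (inputMemory P T t ε).real 2

theorem start_inputMemory : Start (inputData P T t ε) ε (inputMemory P T t ε) where
  n := rfl
  m := rfl
  k := rfl
  t := rfl
  tree := rfl
  bag := rfl
  f := rfl
  w := rfl
  eps := rfl
  nat_eq_zero a ha := by
    obtain ⟨a, rfl⟩ := Nat.exists_eq_add_of_le' ha
    rfl
  real_eq_zero a ha := by
    obtain ⟨a, rfl⟩ := Nat.exists_eq_add_of_le' ha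
    rfl

theorem inputMemory_boundedBy {B : ℕ} (hn : n ≤ B) (hm : m ≤ B) (hk : P.k ≤ B) (ht : t ≤ B)
    (hB : 1 ≤ B) : (inputMemory P T t ε).BoundedBy B := by
  intro a _ i
  match a with
  | 0 =>
    match i with
    | 0 => exact hn
    | 1 => exact hm
    | 2 => exact hk
    | 3 => exact ht
    | i + 4 => exact Nat.zero_le _
  | 1 =>
    rw [inputMemory_nat_one]
    exact arrayOfMatrix_le _ (fun i j => by split_ifs <;> omega) i
  | 2 =>
    rw [inputMemory_nat_two]
    exact arrayOfMatrix_le _ (fun i j => by split_ifs <;> omega) i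
  | a + 3 => exact Nat.zero_le _

theorem represents_inputData : (inputData P T t ε).Represents P where
  k := rfl
  f i hi := by
    change (if 1 ≤ i ∧ i ≤ P.k then P.f i else 0) = P.f i
    split_ifs with h
    · rfl
    · exact (P.f_eq_zero i (by omega)).symm
  weight u v h := (inputMemory_weight P T t ε u v).trans (if_pos h)
  no_edge u v h := (inputMemory_weight P T t ε u v).trans (if_neg h)

theorem tree_inputData (i j : Fin m) :
    (inputData P T t ε).tree (i * m + j) ≠ 0 ↔ T.tree.Adj i j := by
  classical
  change (inputMemory P T t ε).nat 1 (i * m + j) ≠ 0 ↔ _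
  rw [inputMemory_nat_one, arrayOfMatrix_apply _ i j]
  simp

theorem bag_inputData (i : Fin m) (v : Fin n) :
    (inputData P T t ε).bag (i * n + v) ≠ 0 ↔ v ∈ T.bag i := by
  classical
  change (inputMemory P T t ε).nat 2 (i * n + v) ≠ 0 ↔ _
  rw [inputMemory_nat_two, arrayOfMatrix_apply _ i v]
  simp

theorem node_spec {r : ℕ} (hr : r < m) : (inputData P T t ε).node r < m ∧
    (∀ j < r, (inputData P T t ε).node j ≠ (inputData P T t ε).node r) ∧
    (r = 0 ∨ ∃ p < r, (inputData P T t ε).tree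
      ((inputData P T t ε).node p * m + (inputData P T t ε).node r) ≠ 0) := by
  classical
  set D := inputData P T t ε
  induction r using Nat.strong_induction_on with
  | _ r ih =>
    let Q : ℕ → Prop := fun c => (∀ j < r, D.node j ≠ c) ∧
      (r = 0 ∨ ∃ p < r, D.tree (D.node p * m + c) ≠ 0)
    have hnode : D.node r = leastBelow m Q := by
      have hlt : ∀ j < r, ∀ Φ : (ℕ → ℕ) → ℕ → ℕ,
          truncate r (tabulate Φ) j = truncate D.m (tabulate Φ) j :=
        fun j hj Φ => (truncate_of_lt _ hj).trans (truncate_of_lt _ (hj.trans hr)).symm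
      conv_lhs => rw [Data.node, truncate_of_lt _ (show r < D.m from hr), tabulate_eq]
      refine leastBelow_congr fun c _ => and_congr ?_ (or_congr_right ?_)
      · exact forall₂_congr fun j hj => by rw [hlt j hj]; rfl
      · exact exists_congr fun j => and_congr_right fun hj => by rw [hlt j hj]; rfl
    obtain ⟨c, hc, hQ⟩ : ∃ c < m, Q c := by
      rcases Nat.eq_zero_or_pos r with rfl | h0
      · exact ⟨0, hr, fun j hj => absurd hj (Nat.not_lt_zero _), .inl rfl⟩
      let S : Set (Fin m) := {c | ∃ j < r, D.node j = c}
      obtain ⟨c, hc⟩ : ∃ c : Fin m, c ∉ S := by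
        by_contra! hall
        have hsub : Finset.range m ⊆ (Finset.range r).image D.node := fun c hc => by
          obtain ⟨j, hj, hjc⟩ := hall ⟨c, Finset.mem_range.1 hc⟩
          exact Finset.mem_image.2 ⟨j, Finset.mem_range.2 hj, hjc⟩
        have := (Finset.card_le_card hsub).trans Finset.card_image_le
        rw [Finset.card_range, Finset.card_range] at this
        omega
      have h0' := (ih 0 h0 (by omega)).1
      obtain ⟨p⟩ := T.isTree.connected.preconnected ⟨D.node 0, h0'⟩ c
      obtain ⟨d, -, ⟨j, hj, hd⟩, hd'⟩ := p.exists_boundary_dart S ⟨0, h0, rfl⟩ hc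
      refine ⟨d.snd, d.snd.2, fun j hj h => hd' ⟨j, hj, h⟩, .inr ⟨j, hj, ?_⟩⟩
      rw [hd]
      exact (tree_inputData P T t ε _ _).2 d.adj
    rw [hnode]
    exact ⟨leastBelow_lt hc hQ, leastBelow_spec hc hQ⟩

/-- The `r`-th node of the tree in the order of the algorithm. -/
noncomputable def orderedNode (r : Fin m) : Fin m :=
  ⟨(inputData P T t ε).node r, (node_spec P T t ε r.2).1⟩

theorem orderedNode_injective : Function.Injective (orderedNode P T t ε) := by
  intro i j h
  have h' := congrArg Fin.val h
  rcases lt_trichotomy i j with hij | hij | hij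
  · exact absurd h' ((node_spec P T t ε j.2).2.1 i hij)
  · exact hij
  · exact absurd h'.symm ((node_spec P T t ε i.2).2.1 j hij)

theorem inBag_inputData {r v : ℕ} (hr : r < m) (hv : v < n) :
    (inputData P T t ε).InBag r v ↔ ⟨v, hv⟩ ∈ T.bag (orderedNode P T t ε ⟨r, hr⟩) :=
  bag_inputData P T t ε (orderedNode P T t ε ⟨r, hr⟩) ⟨v, hv⟩

theorem parent_inputData {r : ℕ} (hr : r < m) (h0 : 0 < r) :
    ∃ h : (inputData P T t ε).parent r < r,
      T.tree.Adj (orderedNode P T t ε ⟨r, hr⟩)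
        (orderedNode P T t ε ⟨(inputData P T t ε).parent r, h.trans hr⟩) := by
  obtain ⟨p, hp, h⟩ := (node_spec P T t ε hr).2.2.resolve_left h0.ne'
  let Q : ℕ → Prop := fun p => (inputData P T t ε).tree
    ((inputData P T t ε).node p * m + (inputData P T t ε).node r) ≠ 0
  have h1 : (inputData P T t ε).parent r < r := leastBelow_lt (p := Q) hp h
  have h2 : Q ((inputData P T t ε).parent r) := leastBelow_spec (p := Q) hp h
  refine ⟨h1, ((tree_inputData P T t ε _ _).1 ?_).symm⟩
  exact h2

theorem exists_walk {r : ℕ} (hr : r < m) :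
    ∃ p : T.tree.Walk (orderedNode P T t ε ⟨r, hr⟩) (orderedNode P T t ε ⟨0, by omega⟩),
      ∀ x ∈ p.support, ∃ i, ∃ h : i < m, i ≤ r ∧ x = orderedNode P T t ε ⟨i, h⟩ := by
  induction r using Nat.strong_induction_on with
  | _ r ih =>
    rcases Nat.eq_zero_or_pos r with rfl | h0
    · exact ⟨.nil, fun x hx => ⟨0, hr, le_rfl, by simpa using hx⟩⟩
    · obtain ⟨hp, hadj⟩ := parent_inputData P T t ε hr h0
      obtain ⟨p, hsupp⟩ := ih _ hp (hp.trans hr)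
      refine ⟨.cons hadj p, fun x hx => ?_⟩
      rw [SimpleGraph.Walk.support_cons, List.mem_cons] at hx
      rcases hx with rfl | hx
      · exact ⟨r, hr, le_rfl, rfl⟩
      · obtain ⟨i, hi, hir, hx⟩ := hsupp x hx
        exact ⟨i, hi, hir.trans hp.le, hx⟩

/-- If a vertex lies in the bag of a new node and in a previous bag, it lies in the bag of the
parent of the new node. -/
theorem mem_bag_parent {r r' : ℕ} (hr : r < m) (hr' : r' < r) {v : Fin n}
    (h : v ∈ T.bag (orderedNode P T t ε ⟨r, hr⟩))
    (h' : v ∈ T.bag (orderedNode P T t ε ⟨r', hr'.trans hr⟩))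
    (hp : (inputData P T t ε).parent r < r) :
    v ∈ T.bag (orderedNode P T t ε ⟨(inputData P T t ε).parent r, hp.trans hr⟩) := by
  obtain ⟨hp', hadj⟩ := parent_inputData P T t ε hr (by omega)
  obtain ⟨p₁, h₁⟩ := exists_walk P T t ε (hp.trans hr)
  obtain ⟨p₂, h₂⟩ := exists_walk P T t ε (hr'.trans hr)
  have hsupp : ∀ x ∈ (p₁.append p₂.reverse).support,
      ∃ i, ∃ h : i < m, i < r ∧ x = orderedNode P T t ε ⟨i, h⟩ := fun x hx => by
    rw [SimpleGraph.Walk.mem_support_append_iff, SimpleGraph.Walk.support_reverse,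
      List.mem_reverse] at hx
    rcases hx with hx | hx
    · obtain ⟨i, hi, hir, hx⟩ := h₁ x hx
      exact ⟨i, hi, hir.trans_lt hp, hx⟩
    · obtain ⟨i, hi, hir, hx⟩ := h₂ x hx
      exact ⟨i, hi, hir.trans_lt hr', hx⟩
  have hnot : orderedNode P T t ε ⟨r, hr⟩ ∉ (p₁.append p₂.reverse).bypass.support := fun hx => by
    obtain ⟨i, hi, hir, hx⟩ := hsupp _ (SimpleGraph.Walk.support_bypass_subset_support _ hx)
    have := congrArg Fin.val (orderedNode_injective P T t ε hx)
    simp only at this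
    omega
  have hpath : (SimpleGraph.Walk.cons hadj (p₁.append p₂.reverse).bypass).IsPath :=
    (SimpleGraph.Walk.cons_isPath_iff _ _).2 ⟨SimpleGraph.Walk.bypass_isPath _, hnot⟩
  obtain ⟨w⟩ := T.connected v ⟨_, h⟩ ⟨_, h'⟩
  let w' : T.tree.Walk (orderedNode P T t ε ⟨r, hr⟩)
    (orderedNode P T t ε ⟨r', hr'.trans hr⟩) := w.map (SimpleGraph.Embedding.induce {i | v ∈ T.bag i}).toHom
  have heq := congrArg (fun p : T.tree.Path (orderedNode P T t ε ⟨r, hr⟩)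
      (orderedNode P T t ε ⟨r', hr'.trans hr⟩) => p.1.support)
    ((T.isTree.isAcyclic.subsingleton_path _ _).elim ⟨_, hpath⟩ w'.toPath)
  have hmem : orderedNode P T t ε ⟨(inputData P T t ε).parent r, hp.trans hr⟩ ∈
      w'.toPath.1.support := by
    rw [← heq]
    simp
  have hmem' := List.mem_map.1 (SimpleGraph.Walk.support_map _ w ▸
    SimpleGraph.Walk.support_toPath_subset_support w' hmem)
  obtain ⟨x, -, hx⟩ := hmem'
  rw [← hx]
  exact x.2

theorem isDecomposition_inputData (hn : 1 ≤ n) (ht : T.width ≤ t) :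
    (inputData P T t ε).IsDecomposition where
  pos := by
    obtain ⟨i, -⟩ := T.vertex_cover ⟨0, hn⟩
    exact i.pos
  parent_lt r hr h0 := (parent_inputData P T t ε hr h0).1
  inParent r hr r' hr' v hv h h' := by
    obtain ⟨hp, -⟩ := parent_inputData P T t ε hr (by omega)
    refine ⟨hp, (inBag_inputData P T t ε (hp.trans hr) hv).2 ?_⟩
    exact mem_bag_parent P T t ε hr hr' ((inBag_inputData P T t ε hr hv).1 h)
      ((inBag_inputData P T t ε (hr'.trans hr) hv).1 h') hp
  edge_cover u hu v hv hw := by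
    have hadj : P.graph.Adj ⟨u, hu⟩ ⟨v, hv⟩ := by
      by_contra h
      exact hw ((represents_inputData P T t ε).no_edge ⟨u, hu⟩ ⟨v, hv⟩ h)
    obtain ⟨i, hi, hi'⟩ := T.edge_cover _ _ hadj
    obtain ⟨r, rfl⟩ := Finite.surjective_of_injective (orderedNode_injective P T t ε) i
    exact ⟨r, r.2, (inBag_inputData P T t ε r.2 hu).2 hi, (inBag_inputData P T t ε r.2 hv).2 hi'⟩
  slot_le r hr v hv h := by
    classical
    have h' := (inBag_inputData P T t ε hr hv).1 h
    have hcard : (T.bag (orderedNode P T t ε ⟨r, hr⟩)).card ≤ t + 1 := by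
      have := Finset.le_sup (f := fun i => (T.bag i).card)
        (Finset.mem_univ (orderedNode P T t ε ⟨r, hr⟩))
      simp only [TreeDecomposition.width] at ht
      omega
    have hslot : (inputData P T t ε).slot r v ≤
        ((T.bag (orderedNode P T t ε ⟨r, hr⟩)).erase ⟨v, hv⟩).card := by
      rw [Data.slot, ← Finset.card_filter]
      refine (Finset.card_le_card (t := (((T.bag (orderedNode P T t ε ⟨r, hr⟩)).erase
        ⟨v, hv⟩).image Fin.val)) fun u hu => ?_).trans Finset.card_image_le
      rw [Finset.mem_filter, Finset.mem_range] at hu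
      refine Finset.mem_image.2 ⟨⟨u, hu.1.trans hv⟩, Finset.mem_erase.2 ⟨fun h => ?_,
        (inBag_inputData P T t ε hr (hu.1.trans hv)).1 hu.2⟩, rfl⟩
      exact hu.1.ne (congrArg Fin.val h)
    rw [Finset.card_erase_of_mem h'] at hslot
    change _ ≤ t
    omega

end ExtTSP

theorem mainTheorem3 :
    ∃ (p : Program) (C : ℕ),
      ∀ (n m t : ℕ) (ε : ℝ) (P : Problem n) (D : TreeDecomposition P.graph m),
        1 ≤ n → 1 ≤ t → D.width ≤ t → 0 < ε →
          ∃ (s : Memory) (T : ℕ) (d : Equiv.Perm (Fin n)),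
            Runs p (inputMemory P D t ε) s T ∧
            T ≤ C * m ^ C * n ^ (C * P.k * t * ⌈1 / ε⌉₊) ∧
            Outputs s d ∧
            ∀ d' : Equiv.Perm (Fin n), P.value d' ≤ (1 + ε) * P.value d := by
  obtain ⟨c, hc⟩ := wp_solveProgram
  obtain ⟨c', hc'⟩ := mainProgram.bound_le
  refine ⟨mainProgram, c' * 2 ^ c' + c' + 8 * ((c + 1) * c'), fun n m t ε P D hn ht hw hε => ?_⟩
  have hD := isDecomposition_inputData P D t ε hn hw
  have hm : 1 ≤ m := hD.pos
  rcases hn.eq_or_lt with rfl | hn2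
  · have h : wp 2 mainProgram (fun s => Outputs s (Equiv.refl (Fin 1))) (inputMemory P D t ε) := by
      refine ⟨fun _ v => ?_, fun h => absurd le_rfl h⟩
      rw [Subsingleton.elim v 0]
      rfl
    obtain ⟨s, T, hrun, hT, hs⟩ := wp_sound h
    refine ⟨s, T, _, hrun, ?_, hs, fun d' => ?_⟩
    · rw [one_pow, mul_one]
      refine (hT.trans (hc' 2 le_rfl)).trans (le_trans ?_
        (Nat.le_mul_of_pos_right _ (Nat.pow_pos hm)))
      omega
    · rw [Subsingleton.elim d' (Equiv.refl _)]
      have := P.value_nonneg (Equiv.refl _)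
      nlinarith
  · set D' := inputData P D t ε with hD'
    have hk : 1 ≤ P.k := P.one_le_k
    have hq : 1 ≤ ⌈1 / ε⌉₊ := Nat.one_le_ceil_iff.2 (by positivity)
    have hdig : D'.digits = P.k * (⌈1 / ε⌉₊ + 1) * (t + 1) := rfl
    generalize hqq : ⌈1 / ε⌉₊ = q at hq hdig
    have hd8 : 2 * D'.digits ≤ 8 * (P.k * t * q) := by
      have h1 : P.k * (q + 1) ≤ P.k * (2 * q) := Nat.mul_le_mul_left _ (by omega)
      have h2 := Nat.mul_le_mul h1 (show t + 1 ≤ 2 * t by omega)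
      rw [hdig]
      calc 2 * (P.k * (q + 1) * (t + 1)) ≤ 2 * (P.k * (2 * q) * (2 * t)) :=
            Nat.mul_le_mul_left _ h2
        _ = _ := by ring
    have hkd : P.k ≤ D'.digits := by
      rw [hdig, mul_assoc]; exact Nat.le_mul_of_pos_right _ (by positivity)
    have htd : t ≤ D'.digits := by
      rw [hdig]; exact (Nat.le_succ t).trans (Nat.le_mul_of_pos_left _ (by positivity))
    have hqd : q ≤ D'.digits := by
      rw [hdig, mul_comm P.k, mul_assoc]
      exact (Nat.le_succ q).trans (Nat.le_mul_of_pos_right _ (by positivity))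
    set B := m * (n + 1) ^ D'.digits with hB
    have hBp : (n + 1) ^ D'.digits ≤ B := Nat.le_mul_of_pos_left _ hm
    have hBd : D'.digits + 1 ≤ B := (Nat.lt_pow_self (by omega)).trans_le hBp
    have hBn : n + 1 ≤ B := (Nat.le_self_pow (by omega) _).trans hBp
    have hBm : m ≤ B := Nat.le_mul_of_pos_right _ (by positivity)
    have hsolve := hc B (B ^ (c + 1)) (inputMemory P D t ε) D' ε (by omega)
      (inputMemory_boundedBy P D t ε (by omega) hBm (by omega) (by omega) (by omega))
      (Nat.pow_le_pow_right (by omega) (by omega)) (start_inputMemory P D t ε) hε rfl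
      (by change ⌈1 / ε⌉₊ ≤ B; omega) hBd hBn hm le_rfl
    have hmain : wp (B ^ (c + 1)) mainProgram (fun s => ∀ v < D'.n, s.nat 3 v = D'.output v)
        (inputMemory P D t ε) :=
      ⟨fun h => absurd (show n ≤ 1 from h) (by omega), fun _ => hsolve⟩
    obtain ⟨s, T, hrun, hT, hs⟩ := wp_sound hmain
    refine ⟨s, T, D'.sequencing, hrun, ?_, Data.outputs_sequencing hs,
      Data.value_le_mul (represents_inputData P D t ε) hD hε rfl⟩
    have hK : 2 ≤ B ^ (c + 1) :=
      (show 2 ≤ B by omega).trans (Nat.le_self_pow (Nat.succ_ne_zero c) B)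
    set C := c' * 2 ^ c' + c' + 8 * ((c + 1) * c') with hC
    set e := (c + 1) * c' with he
    have hpow : (B ^ (c + 1)) ^ c' = m ^ e * (n + 1) ^ (D'.digits * e) := by
      rw [← pow_mul, ← he, hB, mul_pow, ← pow_mul]
    have hsq : n + 1 ≤ n ^ 2 := by nlinarith
    have hexp : 2 * (D'.digits * e) ≤ C * P.k * t * q := by
      calc 2 * (D'.digits * e) = 2 * D'.digits * e := by ring
        _ ≤ 8 * (P.k * t * q) * e := Nat.mul_le_mul_right _ hd8
        _ = 8 * e * (P.k * t * q) := by ring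
        _ ≤ C * (P.k * t * q) := Nat.mul_le_mul_right _ (by omega)
        _ = C * P.k * t * q := by ring
    calc T ≤ c' * (m ^ e * (n + 1) ^ (D'.digits * e)) := hpow ▸ hT.trans (hc' _ hK)
      _ ≤ c' * (m ^ e * (n ^ 2) ^ (D'.digits * e)) := by gcongr
      _ = c' * m ^ e * n ^ (2 * (D'.digits * e)) := by rw [← pow_mul, mul_assoc]
      _ ≤ C * m ^ C * n ^ (C * P.k * t * q) := by
        refine Nat.mul_le_mul (Nat.mul_le_mul (by omega) (Nat.pow_le_pow_right hm (by omega)))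
          (Nat.pow_le_pow_right (by omega) hexp)
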